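/- **Theorem 3.5.** Let $n\ge 2$, let $R$ be a commutative ring with $1$ and let $q,r,\delta\in R$ be invertible elements with $r-1=\delta(q-1)$, so that $\delta$ plays the role of $\frac{r-1}{q-1}$. (The generic case is $R=\mathbb Z[q^{\pm1},r^{\pm1},(\frac{r-1}{q-1})^{\pm1}]$ with $\delta=\frac{r-1}{q-1}$; the case $q=1$, $r=q^N=1$, $\delta=N$ with $N\ne 0$ an integer invertible in $R$ is also included.) Let $Br_n(r,q)$ be the associative unital $R$-algebra with generators $g_1,\dots,g_{n-1},e$ and relations * (H) $g_i^2=(q-1)g_i+q$; $g_ig_{i+1}g_i=g_{i+1}g_ig_{i+1}$; $g_ig_j=g_jg_i$ for $|i-j|>1$; * $(E_1)$ $e^2=\delta e$; * $(E_2)$ $eg_i=g_ie$ for $i>2$; $eg_1=g_1e=qe$; $eg_2e=re$; $eg_2^{-1}e=q^{-1}e$; * $(E_3)$ $e_{(2)}=g_2g_3g_1^{-1}g_2^{-1}e_{(2)}=e_{(2)}g_2g_3g_1^{-1}g_2^{-1}$, where $e_{(2)}=e(g_2g_3g_1^{-1}g_2^{-1})e$, where a relation is imposed only if all the generators in it exist,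 and $g_i^{-1}=q^{-1}g_i+(q^{-1}-1)$. Put $e_{(0)}=1$, $e_{(1)}=e$ and $e_{(k+1)}=e\,(g_2g_3\cdots g_{2k+1})(g_1^{-1}g_2^{-1}\cdots g_{2k}^{-1})\,e_{(k)}$ for $k\ge1$, $2(k+1)\le n$. For $\omega\in S_n$ put $g_\omega=g_{j_1}\cdots g_{j_m}$, where $\omega=s_{j_1}\cdots s_{j_m}$ is a reduced expression in the simple transpositions $s_j=(j,j+1)$, and let $\ell(\omega)$ be the number of inversions of $\omega$. A Brauer diagram is a perfect matching of $2n$ vertices arranged in a top row and a bottom row of $n$ vertices each; an edge is horizontal if it joins two vertices of the same row, and vertical otherwise. Permutations are regarded as the diagrams without horizontal edges; products of permutations, and of permutations with diagrams, are concatenations from top to bottom. For $2k\le n$ let $e_{(k)}$ also denote the diagram in which, in each row, the vertices $2i-1$ and $2i$ are joined for $1\le i\le k$, and the $j$-th top vertex is joined to the $j$-th bottom vertex for $j>2k$. For a diagram $d$ with exactly $2k$ horizontal edges let $\ell(d)=\min\{\ell(\alpha)+\ell(\beta)\mid \alpha,\beta\in S_n,\ \alpha e_{(k)}\beta=d\}$.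 Let $B^*_k$ be the set of all products $t_{n-1}t_{n-2}\cdots t_{2k}\,t_{2k-2}t_{2k-4}\cdots t_2$, where each $t_j$ is either $1$ or $s_is_{i+1}\cdots s_j$ for some $1\le i\le j$; let $B_k=\{\omega^{-1}\mid\omega\in B^*_k\}$, and let $S_{2k+1,n}$ be the subgroup generated by $s_{2k+1},\dots,s_{n-1}$. A reduced expression of a diagram $d$ with exactly $2k$ horizontal edges is a triple $(\omega_1,\omega_{(d)},\omega_2)$ with $\omega_1\in B^*_k$, $\omega_{(d)}\in S_{2k+1,n}$, $\omega_2\in B_k$ such that $d=\omega_1e_{(k)}\omega_{(d)}\omega_2$, no two vertical edges of $d_1=\omega_1e_{(k)}$ intersect, no two vertical edges of $d_2=e_{(k)}\omega_2$ intersect, $\ell(d_1)=\ell(\omega_1)$, $\ell(d_2)=\ell(\omega_2)$ and $\ell(d)=\ell(\omega_1)+\ell(\omega_{(d)})+\ell(\omega_2)$. Then: 1. $g_\omega$ does not depend on the choice of the reduced expression of $\omega\in S_n$. 2. Every Brauer diagram $d$ has a unique reduced expression $(\omega_1,\omega_{(d)},\omega_2)$. Hence $g_d:=g_{\omega_1}\,e_{(k)}\,g_{\omega_{(d)}}\,g_{\omega_2}$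 is well defined, where $2k$ is the number of horizontal edges of $d$. 3. The $R$-module $Br_n(r,q)$ is free, with basis $\{g_d\}$ indexed by the Brauer diagrams $d$ on $2n$ vertices. -/

import Mathlib

namespace QBrauer

/-! ### Permutations, simple transpositions, lengths, reduced words

Vertices are `0, …, n-1`, while the simple transpositions keep their usual names
`s_1, …, s_{n-1}`; `s_j` exchanges the `j`-th and the `(j+1)`-st vertex, that is, the elements
`j - 1` and `j` of `Fin n`.  A product of simple transpositions written from left to right, which as
a diagram means concatenation from top to bottom, is the product in the same order in
`Equiv.Perm (Fin n)`. -/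

/-- The index set `{1, …, n-1}` of the simple transpositions. -/
abbrev SIndex (n : ℕ) : Type := {j : ℕ // 1 ≤ j ∧ j < n}

/-- The simple transposition `s_j`, for `1 ≤ j < n`. -/
def sgen {n : ℕ} (j : SIndex n) : Equiv.Perm (Fin n) :=
  Equiv.swap ⟨j.1 - 1, by have := j.2; omega⟩ ⟨j.1, j.2.2⟩

/-- `s_j` with a plain natural number as index (and `1` when `j` is out of range, which never
happens where it is used below). -/
def sNat (n j : ℕ) : Equiv.Perm (Fin n) :=
  if h : 1 ≤ j ∧ j < n then sgen ⟨j, h⟩ else 1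

/-- The length of a permutation: its number of inversions. -/
def permLength {n : ℕ} (ω : Equiv.Perm (Fin n)) : ℕ :=
  (Finset.univ.filter fun x : Fin n × Fin n => x.1 < x.2 ∧ ω x.2 < ω x.1).card

/-- `l` is a reduced expression of `ω`: a shortest word in the simple transpositions with
product `ω`. -/
def IsReducedWord {n : ℕ} (l : List (SIndex n)) (ω : Equiv.Perm (Fin n)) : Prop :=
  (l.map sgen).prod = ω ∧ ∀ l' : List (SIndex n), (l'.map sgen).prod = ω → l.length ≤ l'.length

/-- The increasing list `a, a+1, …, b` (empty if `b < a`). -/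
def ascList (a b : ℕ) : List ℕ := List.range' a (b + 1 - a)

/-- `s_{i,j} = s_i s_{i+1} ⋯ s_j`, for `i ≤ j`. -/
def sAsc (n i j : ℕ) : Equiv.Perm (Fin n) := ((ascList i j).map (sNat n)).prod

/-- The list of indices `n-1, n-2, …, 2k, 2k-2, 2k-4, …, 2`. -/
def bIndices (n k : ℕ) : List ℕ :=
  (List.range' (2 * k) (n - 2 * k)).reverse ++
    ((List.range' 1 (k - 1)).reverse.map fun m => 2 * m)

/-- `B*_k`: the set of products `t_{n-1} t_{n-2} ⋯ t_{2k} t_{2k-2} t_{2k-4} ⋯ t_2`, where every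
`t_j` is either `1` or one of the `s_{i,j}` with `1 ≤ i ≤ j`. -/
def BStar (n k : ℕ) : Set (Equiv.Perm (Fin n)) :=
  {ω | ∃ t : ℕ → Equiv.Perm (Fin n),
    (∀ j, t j = 1 ∨ ∃ i, 1 ≤ i ∧ i ≤ j ∧ t j = sAsc n i j) ∧
    ω = ((bIndices n k).map t).prod}

/-- `B_k = {ω⁻¹ | ω ∈ B*_k}`. -/
def BSet (n k : ℕ) : Set (Equiv.Perm (Fin n)) := {ω | ∃ α ∈ BStar n k, ω = α⁻¹}

/-- `S_{m,n}`: the subgroup generated by `s_m, s_{m+1}, …, s_{n-1}`. -/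
def permsFrom (m n : ℕ) : Subgroup (Equiv.Perm (Fin n)) :=
  Subgroup.closure {σ | ∃ j : SIndex n, m ≤ j.1 ∧ σ = sgen j}

/-! ### Brauer diagrams -/

/-- A Brauer diagram: a perfect matching of the `2n` vertices, of which `Sum.inl i` are in the top
row and `Sum.inr i` in the bottom row, given by the map that sends a vertex to the other end of its
edge. -/
def BrauerDiagram (n : ℕ) : Type :=
  {f : Equiv.Perm (Fin n ⊕ Fin n) // (∀ x, f (f x) = x) ∧ ∀ x, f x ≠ x}

/-- Move the ends of the edges of `d` along a permutation of the vertices. -/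
def BrauerDiagram.relabel {n : ℕ} (P : Equiv.Perm (Fin n ⊕ Fin n)) (d : BrauerDiagram n) :
    BrauerDiagram n :=
  ⟨P * d.1 * P⁻¹, fun x => by simp [d.2.1], fun x h => d.2.2 (P⁻¹ x) (by
    rw [Equiv.Perm.eq_inv_iff_eq]; simpa using h)⟩

/-- `ω d`: the concatenation of (the diagram of) the permutation `ω`, on top, with `d`.  No loop can
arise, and the top vertex `a` of `d` is moved to `ω a`. -/
def BrauerDiagram.leftMul {n : ℕ} (ω : Equiv.Perm (Fin n)) (d : BrauerDiagram n) :
    BrauerDiagram n :=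
  d.relabel (Equiv.sumCongr ω 1)

/-- `d ω`: the concatenation of `d`, on top, with (the diagram of) the permutation `ω`.  No loop can
arise, and the bottom vertex `b` of `d` is moved to `ω⁻¹ b`. -/
def BrauerDiagram.rightMul {n : ℕ} (d : BrauerDiagram n) (ω : Equiv.Perm (Fin n)) :
    BrauerDiagram n :=
  d.relabel (Equiv.sumCongr 1 ω⁻¹)

/-- An edge is horizontal if it joins two vertices of the same row. The set of all of them. -/
def BrauerDiagram.horizontalEdges {n : ℕ} (d : BrauerDiagram n) : Finset (Sym2 (Fin n ⊕ Fin n)) :=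
  (Finset.univ.filter fun x => (d.1 x).isLeft = x.isLeft).image fun x => s(x, d.1 x)

/-- No two vertical edges of `d` intersect. -/
def BrauerDiagram.NoVerticalCrossing {n : ℕ} (d : BrauerDiagram n) : Prop :=
  ∀ i j a b : Fin n, i < j → d.1 (Sum.inl i) = Sum.inr a → d.1 (Sum.inl j) = Sum.inr b → a < b

/-- The other vertex of the pair `{0,1}, {2,3}, {4,5}, …` that contains `i`. -/
def pairPartner (i : ℕ) : ℕ := if i % 2 = 0 then i + 1 else i - 1

/-- The other end of the edge of `e_{(k)}` at a given vertex: the first `2k` vertices of each row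
are joined in consecutive pairs, all the others are joined to the opposite vertex. -/
def eMap (n k : ℕ) (h : 2 * k ≤ n) : Fin n ⊕ Fin n → Fin n ⊕ Fin n
  | Sum.inl i =>
      if hi : i.1 < 2 * k then
        Sum.inl ⟨pairPartner i.1, by unfold pairPartner; split <;> omega⟩
      else Sum.inr i
  | Sum.inr i =>
      if hi : i.1 < 2 * k then
        Sum.inr ⟨pairPartner i.1, by unfold pairPartner; split <;> omega⟩
      else Sum.inl i

theorem pairPartner_pairPartner (i : ℕ) : pairPartner (pairPartner i) = i := by
  unfold pairPartner; split_ifs <;> omega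

theorem pairPartner_lt {i k : ℕ} (h : i < 2 * k) : pairPartner i < 2 * k := by
  unfold pairPartner; split_ifs <;> omega

theorem pairPartner_ne (i : ℕ) : pairPartner i ≠ i := by
  unfold pairPartner; split_ifs <;> omega

theorem eMap_eMap (n k : ℕ) (h : 2 * k ≤ n) (x : Fin n ⊕ Fin n) :
    eMap n k h (eMap n k h x) = x := by
  rcases x with i | i <;> by_cases hi : i.1 < 2 * k <;>
    simp [eMap, hi, pairPartner_lt, pairPartner_pairPartner]

theorem eMap_ne (n k : ℕ) (h : 2 * k ≤ n) (x : Fin n ⊕ Fin n) : eMap n k h x ≠ x := by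
  rcases x with i | i <;> by_cases hi : i.1 < 2 * k <;>
    simp [eMap, hi, Fin.ext_iff, pairPartner_ne]

/-- The diagram `e_{(k)}`. -/
def eDiagram (n k : ℕ) (h : 2 * k ≤ n) : BrauerDiagram n :=
  ⟨⟨eMap n k h, eMap n k h, eMap_eMap n k h, eMap_eMap n k h⟩, eMap_eMap n k h, eMap_ne n k h⟩

/-- The length of a diagram `d` with `2k` horizontal edges: the minimum of `ℓ(α) + ℓ(β)` over all
permutations `α`, `β` with `α e_{(k)} β = d`. -/
noncomputable def diagramLength {n : ℕ} (k : ℕ) (h : 2 * k ≤ n) (d : BrauerDiagram n) : ℕ :=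
  sInf {m | ∃ α β : Equiv.Perm (Fin n),
    ((eDiagram n k h).leftMul α).rightMul β = d ∧ m = permLength α + permLength β}

/-- `(ω₁, ω, ω₂)` is a reduced expression of the diagram `d` with exactly `2k` horizontal edges.
Here `d₁ = ω₁ e_{(k)}` is the diagram without intersecting vertical edges whose top row is that of
`d` and whose bottom row is that of `e_{(k)}`, symmetrically `d₂ = e_{(k)} ω₂`, and
`ω ∈ S_{2k+1,n}` records the vertical edges of `d`; `d` is `ω₁ e_{(k)} ω ω₂`, which is the
concatenation of `d₁`, `ω`, `d₂` with its `k` loops removed. -/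
structure IsReducedExpression {n : ℕ} (d : BrauerDiagram n) (k : ℕ)
    (ω₁ ω ω₂ : Equiv.Perm (Fin n)) : Prop where
  le : 2 * k ≤ n
  card_horizontalEdges : d.horizontalEdges.card = 2 * k
  left_mem : ω₁ ∈ BStar n k
  mid_mem : ω ∈ permsFrom (2 * k + 1) n
  right_mem : ω₂ ∈ BSet n k
  left_noCrossing : ((eDiagram n k le).leftMul ω₁).NoVerticalCrossing
  right_noCrossing : ((eDiagram n k le).rightMul ω₂).NoVerticalCrossing
  eq_mul : (((eDiagram n k le).leftMul ω₁).rightMul ω).rightMul ω₂ = d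
  left_length : diagramLength k le ((eDiagram n k le).leftMul ω₁) = permLength ω₁
  right_length : diagramLength k le ((eDiagram n k le).rightMul ω₂) = permLength ω₂
  length_eq : diagramLength k le d = permLength ω₁ + permLength ω + permLength ω₂

/-! ### The q-Brauer algebra -/

/-- The generators `g_1, …, g_{n-1}` and `e`. -/
inductive Gen (n : ℕ) : Type
  | g (j : SIndex n) : Gen n
  | e : Gen n

section Algebra

variable {R : Type*} [CommRing R]

/-- `g_j` in the free algebra on the generators. -/
def freeG (R : Type*) [CommRing R] {n : ℕ} (j : SIndex n) : FreeAlgebra R (Gen n) :=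
  FreeAlgebra.ι R (Gen.g j)

/-- `e` in the free algebra on the generators. -/
def freeE (R : Type*) [CommRing R] (n : ℕ) : FreeAlgebra R (Gen n) :=
  FreeAlgebra.ι R Gen.e

/-- `q⁻¹ g_j + (q⁻¹ - 1)`, which the quadratic relation makes the inverse of `g_j`. -/
def freeGInv {n : ℕ} (q : Rˣ) (j : SIndex n) : FreeAlgebra R (Gen n) :=
  (↑q⁻¹ : R) • freeG R j + ((↑q⁻¹ : R) - 1) • (1 : FreeAlgebra R (Gen n))

/-- The word `g_2 g_3 g_1⁻¹ g_2⁻¹`, from the three indices `1, 2, 3`. -/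
def freeMid {n : ℕ} (q : Rˣ) (i₁ i₂ i₃ : SIndex n) : FreeAlgebra R (Gen n) :=
  freeG R i₂ * freeG R i₃ * freeGInv q i₁ * freeGInv q i₂

/-- The defining relations of the q-Brauer algebra. -/
inductive Rel (n : ℕ) (q r δ : Rˣ) : FreeAlgebra R (Gen n) → FreeAlgebra R (Gen n) → Prop
  /-- (H) `g_j² = (q - 1) g_j + q` -/
  | quadratic (j : SIndex n) :
      Rel n q r δ (freeG R j * freeG R j) (((q : R) - 1) • freeG R j + (q : R) • 1)
  /-- (H) `g_i g_{i+1} g_i = g_{i+1} g_i g_{i+1}` -/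
  | braid (i j : SIndex n) (h : j.1 = i.1 + 1) :
      Rel n q r δ (freeG R i * freeG R j * freeG R i) (freeG R j * freeG R i * freeG R j)
  /-- (H) `g_i g_j = g_j g_i` if `|i - j| > 1` -/
  | comm (i j : SIndex n) (h : i.1 + 1 < j.1 ∨ j.1 + 1 < i.1) :
      Rel n q r δ (freeG R i * freeG R j) (freeG R j * freeG R i)
  /-- (E₁) `e² = δ e` -/
  | e_sq : Rel n q r δ (freeE R n * freeE R n) ((δ : R) • freeE R n)
  /-- (E₂) `e g_i = g_i e` if `i > 2` -/
  | e_comm (i : SIndex n) (h : 2 < i.1) :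
      Rel n q r δ (freeE R n * freeG R i) (freeG R i * freeE R n)
  /-- (E₂) `e g_1 = q e` -/
  | e_g_one (i : SIndex n) (h : i.1 = 1) :
      Rel n q r δ (freeE R n * freeG R i) ((q : R) • freeE R n)
  /-- (E₂) `g_1 e = q e` -/
  | g_one_e (i : SIndex n) (h : i.1 = 1) :
      Rel n q r δ (freeG R i * freeE R n) ((q : R) • freeE R n)
  /-- (E₂) `e g_2 e = r e` -/
  | e_g_two_e (i : SIndex n) (h : i.1 = 2) :
      Rel n q r δ (freeE R n * freeG R i * freeE R n) ((r : R) • freeE R n)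
  /-- (E₂) `e g_2⁻¹ e = q⁻¹ e` -/
  | e_g_two_inv_e (i : SIndex n) (h : i.1 = 2) :
      Rel n q r δ (freeE R n * freeGInv q i * freeE R n) ((↑q⁻¹ : R) • freeE R n)
  /-- (E₃) `e_{(2)} = g_2 g_3 g_1⁻¹ g_2⁻¹ e_{(2)}`, where `e_{(2)} = e (g_2 g_3 g_1⁻¹ g_2⁻¹) e` -/
  | e_two_left (i₁ i₂ i₃ : SIndex n) (h₁ : i₁.1 = 1) (h₂ : i₂.1 = 2) (h₃ : i₃.1 = 3) :
      Rel n q r δ (freeE R n * freeMid q i₁ i₂ i₃ * freeE R n)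
        (freeMid q i₁ i₂ i₃ * (freeE R n * freeMid q i₁ i₂ i₃ * freeE R n))
  /-- (E₃) `e_{(2)} = e_{(2)} g_2 g_3 g_1⁻¹ g_2⁻¹` -/
  | e_two_right (i₁ i₂ i₃ : SIndex n) (h₁ : i₁.1 = 1) (h₂ : i₂.1 = 2) (h₃ : i₃.1 = 3) :
      Rel n q r δ (freeE R n * freeMid q i₁ i₂ i₃ * freeE R n)
        (freeE R n * freeMid q i₁ i₂ i₃ * freeE R n * freeMid q i₁ i₂ i₃)

/-- The q-Brauer algebra `Br_n(r,q)` over `R`; the parameter `δ` stands for `(r-1)/(q-1)`. -/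
abbrev QBr (n : ℕ) (q r δ : Rˣ) : Type _ := RingQuot (Rel n q r δ)

variable (n : ℕ) (q r δ : Rˣ)

/-- The element `e` of the q-Brauer algebra. -/
noncomputable def eElt : QBr n q r δ := RingQuot.mkAlgHom R (Rel n q r δ) (freeE R n)

/-- The element `g_j` of the q-Brauer algebra. -/
noncomputable def gElt (j : SIndex n) : QBr n q r δ :=
  RingQuot.mkAlgHom R (Rel n q r δ) (freeG R j)

/-- The element `g_j⁻¹` of the q-Brauer algebra. -/
noncomputable def gInvElt (j : SIndex n) : QBr n q r δ :=
  RingQuot.mkAlgHom R (Rel n q r δ) (freeGInv q j)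

theorem gElt_sq (j : SIndex n) :
    gElt n q r δ j * gElt n q r δ j = ((q : R) - 1) • gElt n q r δ j + (q : R) • 1 := by
  have h := RingQuot.mkAlgHom_rel R (Rel.quadratic (n := n) (q := q) (r := r) (δ := δ) j)
  simpa [gElt] using h

theorem gElt_mul_gInvElt (j : SIndex n) : gElt n q r δ j * gInvElt n q r δ j = 1 := by
  have h : gInvElt n q r δ j = (↑q⁻¹ : R) • gElt n q r δ j + ((↑q⁻¹ : R) - 1) • 1 := by
    simp [gInvElt, gElt, freeGInv]
  have hq : (↑q⁻¹ : R) * (q : R) = 1 := q.inv_mul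
  rw [h, mul_add, mul_smul_comm, mul_smul_comm, mul_one, gElt_sq, smul_add, smul_smul, smul_smul,
    add_right_comm, ← add_smul]
  have h0 : (↑q⁻¹ : R) * ((q : R) - 1) + ((↑q⁻¹ : R) - 1) = 0 := by linear_combination hq
  rw [h0, hq]; simp

theorem gInvElt_mul_gElt (j : SIndex n) : gInvElt n q r δ j * gElt n q r δ j = 1 := by
  have h : gInvElt n q r δ j = (↑q⁻¹ : R) • gElt n q r δ j + ((↑q⁻¹ : R) - 1) • 1 := by
    simp [gInvElt, gElt, freeGInv]
  have hq : (↑q⁻¹ : R) * (q : R) = 1 := q.inv_mul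
  rw [h, add_mul, smul_mul_assoc, smul_mul_assoc, one_mul, gElt_sq, smul_add, smul_smul, smul_smul,
    add_right_comm, ← add_smul]
  have h0 : (↑q⁻¹ : R) * ((q : R) - 1) + ((↑q⁻¹ : R) - 1) = 0 := by linear_combination hq
  rw [h0, hq]; simp

/-- `g_j` with a plain natural number as index (and `1` when `j` is out of range, which does not
happen for `e_{(k)}` with `2k ≤ n`). -/
noncomputable def gNat (j : ℕ) : QBr n q r δ :=
  if h : 1 ≤ j ∧ j < n then gElt n q r δ ⟨j, h⟩ else 1

/-- `g_j⁻¹` with a plain natural number as index. -/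
noncomputable def gInvNat (j : ℕ) : QBr n q r δ :=
  if h : 1 ≤ j ∧ j < n then gInvElt n q r δ ⟨j, h⟩ else 1

/-- `g⁺_{a,b} = g_a g_{a+1} ⋯ g_b`, for `a ≤ b`. -/
noncomputable def gPlus (a b : ℕ) : QBr n q r δ := ((ascList a b).map (gNat n q r δ)).prod

/-- `g⁻_{a,b} = g_a⁻¹ g_{a+1}⁻¹ ⋯ g_b⁻¹`, for `a ≤ b`. -/
noncomputable def gMinus (a b : ℕ) : QBr n q r δ := ((ascList a b).map (gInvNat n q r δ)).prod

/-- The elements `e_{(k)}`: `e_{(0)} = 1`, `e_{(1)} = e` and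
`e_{(k+1)} = e g⁺_{2,2k+1} g⁻_{1,2k} e_{(k)}` for `k ≥ 1`. -/
noncomputable def eK : ℕ → QBr n q r δ
  | 0 => 1
  | 1 => eElt n q r δ
  | k + 2 =>
      eElt n q r δ * gPlus n q r δ 2 (2 * (k + 1) + 1) * gMinus n q r δ 1 (2 * (k + 1)) * eK (k + 1)

/-- The product of the `g_j` along a word. -/
noncomputable def gWord (l : List (SIndex n)) : QBr n q r δ := (l.map (gElt n q r δ)).prod

end Algebra

theorem exists_word {n : ℕ} (ω : Equiv.Perm (Fin n)) :
    ∃ l : List (SIndex n), (l.map sgen).prod = ω := by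
  rcases n with _ | n
  · exact ⟨[], Subsingleton.elim _ _⟩
  · have h : ω ∈ Submonoid.closure
        (Set.range fun i : Fin n => Equiv.swap i.castSucc i.succ) := by
      rw [Equiv.Perm.mclosure_swap_castSucc_succ]; trivial
    induction h using Submonoid.closure_induction with
    | mem x hx =>
      obtain ⟨i, rfl⟩ := hx
      refine ⟨[⟨i.1 + 1, by omega⟩], ?_⟩
      simp only [List.map_cons, List.map_nil, List.prod_cons, List.prod_nil, mul_one, sgen]
      congr 1
    | one => exact ⟨[], rfl⟩
    | mul x y _ _ hx hy =>
      obtain ⟨l, rfl⟩ := hx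
      obtain ⟨m, rfl⟩ := hy
      exact ⟨l ++ m, by simp⟩

theorem exists_reducedWord {n : ℕ} (ω : Equiv.Perm (Fin n)) :
    ∃ l : List (SIndex n), IsReducedWord l ω := by
  classical
  have h : ∃ m, ∃ l : List (SIndex n), (l.map sgen).prod = ω ∧ l.length = m :=
    (exists_word ω).elim fun l hl => ⟨_, l, hl, rfl⟩
  obtain ⟨l, hl, hm⟩ := Nat.find_spec h
  exact ⟨l, hl, fun l' hl' => hm.trans_le (Nat.find_min' h ⟨l', hl', rfl⟩)⟩

/-- `g_ω = g_{j_1} ⋯ g_{j_m}` for a reduced expression `ω = s_{j_1} ⋯ s_{j_m}`. -/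
noncomputable def gPerm {R : Type*} [CommRing R] (n : ℕ) (q r δ : Rˣ) (ω : Equiv.Perm (Fin n)) :
    QBr n q r δ :=
  gWord n q r δ (exists_reducedWord ω).choose

end QBrauer

/-! Write H_n for the span of the g_ω. Matsumoto's theorem (`prod_eq_of_reduced`) makes g_ω well
defined; what remains is the combinatorics of reduced expressions, a spanning argument and linear
independence.

Diagrams. A diagram is determined by the involutions that it induces on its two rows (fixing the
ends of vertical edges) and by its vertical edges. A permutation satisfying `IsSorted` lists the
2-cycles of an involution in the order of their larger ends, followed by the fixed points in
increasing order; every involution has exactly one such listing (`exists_isSorted`,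
`IsSorted.unique`). The set B*_k consists of the permutations with the right order on the first 2k
positions (`mem_BStar_iff`), and the absence of crossings is the order condition on the other
positions. The length conditions then hold automatically (`diagramLength_mul`), so reduced
expressions are exactly the expressions through sorted permutations (`isReducedExpression_iff`).

Spanning. Three rules govern e_(k): g_{2i+1} e_(k) = q e_(k) for i < k, letters with index above 2k
commute with e_(k), and g_{2l+1} g_{2l} e_(k) = g_{2l-1} g_{2l} e_(k) for 1 ≤ l < k. With them the
sum of the H_n e_(k) H_n is seen to be stable under left multiplication by e (`e_mul_word_mem`); as
it contains 1, it is the whole algebra. The same rules straighten g_ω e_(k) until ω is sorted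
(`gT_mul_eK_mem`). Reversal of products preserves the relations and fixes every e_(k) (`QSystem.op`,
`unop_eK_op`), so the right-hand versions follow from the left-hand ones.

Independence. For q = s², r = q^N and δ = 1 + q + ⋯ + q^(N-1) the algebra acts on the n-th tensor
power of a free module of rank N: g_j by exchange operators, e by a weighted contraction
(`tensorSystem`). At s = 1 this becomes the classical action of diagrams, in which a matrix entry of
g_d is 1 or 0 according to whether a colouring of the 2n vertices is constant on the edges of d. If
N ≥ n, every d has a colouring with distinct colours on distinct edges. The matrix of the g_d at
these colourings is the identity at s = 1, hence invertible over ℚ⟦t⟧ with s = 1 + t.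

These specializations suffice for generic parameters: a polynomial in δ that vanishes at δ = 1 + q +
⋯ + q^(N-1) for all N ≥ n has infinitely many roots and is zero. Finally the basis over the generic
ring is transported to an arbitrary R by base change (`linearIndependent_baseChange`). -/

namespace QBrauer

/-! ### Lengths of permutations and reduced words -/

section Length

variable {n : ℕ}

/-- The smaller of the two elements exchanged by `s_j`. -/
def SIndex.lo (j : SIndex n) : Fin n := ⟨j.1 - 1, by have := j.2; omega⟩

/-- The larger of the two elements exchanged by `s_j`. -/
def SIndex.hi (j : SIndex n) : Fin n := ⟨j.1, j.2.2⟩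

theorem SIndex.lo_lt_hi (j : SIndex n) : j.lo < j.hi := by
  have := j.2
  simp only [SIndex.lo, SIndex.hi, Fin.lt_def]; omega

theorem sgen_eq_swap (j : SIndex n) : sgen j = Equiv.swap j.lo j.hi := rfl

@[simp] theorem sgen_lo (j : SIndex n) : sgen j j.lo = j.hi := Equiv.swap_apply_left _ _

@[simp] theorem sgen_hi (j : SIndex n) : sgen j j.hi = j.lo := Equiv.swap_apply_right _ _

@[simp] theorem sgen_mul_self (j : SIndex n) : sgen j * sgen j = 1 := Equiv.swap_mul_self _ _

@[simp] theorem sgen_inv (j : SIndex n) : (sgen j)⁻¹ = sgen j := Equiv.swap_inv _ _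

@[simp] theorem sgen_mul_sgen_mul (j : SIndex n) (ω : Equiv.Perm (Fin n)) :
    sgen j * (sgen j * ω) = ω := by rw [← mul_assoc, sgen_mul_self, one_mul]

@[simp] theorem mul_sgen_mul_sgen (j : SIndex n) (ω : Equiv.Perm (Fin n)) :
    ω * sgen j * sgen j = ω := by rw [mul_assoc, sgen_mul_self, mul_one]

theorem sgen_apply_val (j : SIndex n) (x : Fin n) :
    (sgen j x : ℕ) = if x.1 = j.1 - 1 then j.1 else if x.1 = j.1 then j.1 - 1 else x.1 := by
  rw [sgen_eq_swap, Equiv.swap_apply_def]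
  simp only [Fin.ext_iff, SIndex.lo, SIndex.hi]
  split_ifs <;> rfl

theorem sgen_apply_of_ne (j : SIndex n) {x : Fin n} (h1 : x ≠ j.lo) (h2 : x ≠ j.hi) :
    sgen j x = x := Equiv.swap_apply_of_ne_of_ne h1 h2

theorem sgen_lt_sgen (j : SIndex n) {x y : Fin n} (h : x < y) (hne : ¬(x = j.lo ∧ y = j.hi)) :
    sgen j x < sgen j y := by
  have := j.2
  simp only [Fin.ext_iff, Fin.lt_def, SIndex.lo, SIndex.hi] at *
  rw [sgen_apply_val, sgen_apply_val]
  split_ifs <;> omega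

theorem sgen_comm (i j : SIndex n) (h : i.1 + 1 < j.1 ∨ j.1 + 1 < i.1) :
    sgen i * sgen j = sgen j * sgen i := by
  have := i.2; have := j.2
  ext x
  simp only [Equiv.Perm.mul_apply, sgen_apply_val]
  split_ifs <;> omega

/-- Both sides are the transposition of the outer two of the three vertices involved. -/
theorem sgen_braid (i j : SIndex n) (h : j.1 = i.1 + 1) :
    sgen i * sgen j * sgen i = sgen j * sgen i * sgen j := by
  have hi := i.2
  have e1 : j.lo = i.hi := by ext; simp [SIndex.lo, SIndex.hi, h]
  have h1 : i.lo ≠ i.hi := i.lo_lt_hi.ne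
  have h2 : j.hi ≠ i.hi := by simp [Fin.ext_iff, SIndex.hi, h]
  have h3 : i.lo ≠ j.hi := by simp [Fin.ext_iff, SIndex.hi, SIndex.lo]; omega
  have h4 := Equiv.swap_mul_swap_mul_swap h2 h3.symm
  rw [Equiv.swap_comm i.hi i.lo, Equiv.swap_comm j.hi i.hi] at h4
  rw [sgen_eq_swap, sgen_eq_swap, e1, Equiv.swap_mul_swap_mul_swap h1 h3, h4, Equiv.swap_comm]

theorem permLength_one : permLength (1 : Equiv.Perm (Fin n)) = 0 := by
  simp only [permLength, Finset.card_eq_zero, Finset.filter_eq_empty_iff]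
  rintro x - ⟨h1, h2⟩
  exact lt_asymm h1 h2

theorem permLength_inv (ω : Equiv.Perm (Fin n)) : permLength ω⁻¹ = permLength ω := by
  unfold permLength
  refine Finset.card_bij' (fun x _ => (ω⁻¹ x.2, ω⁻¹ x.1)) (fun x _ => (ω x.2, ω x.1)) ?_ ?_ ?_ ?_ <;>
    simp +contextual

/-- Applying s_j to both positions carries the inversions of ω injectively to inversions of ω s_j,
because s_j preserves the order of every pair but one. That one pair, `(j.lo, j.hi)`, is the
additional inversion. -/
theorem permLength_mul_sgen (ω : Equiv.Perm (Fin n)) (j : SIndex n) (h : ω j.lo < ω j.hi) :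
    permLength (ω * sgen j) = permLength ω + 1 := by
  have key : (Finset.univ.filter fun x : Fin n × Fin n =>
      x.1 < x.2 ∧ (ω * sgen j) x.2 < (ω * sgen j) x.1) =
      Finset.cons (j.lo, j.hi) ((Finset.univ.filter fun x : Fin n × Fin n =>
        x.1 < x.2 ∧ ω x.2 < ω x.1).map (Equiv.prodCongr (sgen j) (sgen j)).toEmbedding) (by
          simp only [Finset.mem_map_equiv, Finset.mem_filter]
          rintro ⟨-, h1, -⟩
          simp only [Equiv.prodCongr_symm, Equiv.prodCongr_apply, Prod.map_fst, Prod.map_snd] at h1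
          rw [← Equiv.Perm.inv_def, sgen_inv, sgen_lo, sgen_hi] at h1
          exact lt_asymm h1 j.lo_lt_hi) := by
    ext ⟨x, y⟩
    rw [Finset.mem_filter, Finset.mem_cons, Finset.mem_map_equiv, Finset.mem_filter]
    simp only [Finset.mem_univ, true_and, Equiv.Perm.mul_apply, Prod.mk.injEq]
    constructor
    · rintro ⟨h1, h2⟩
      by_cases hxy : x = j.lo ∧ y = j.hi
      · exact Or.inl hxy
      · exact Or.inr ⟨sgen_lt_sgen j h1 hxy, h2⟩
    · rintro (⟨rfl, rfl⟩ | ⟨h1, h2⟩)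
      · simpa using ⟨j.lo_lt_hi, h⟩
      · refine ⟨?_, h2⟩
        have := sgen_lt_sgen j h1 (by
          rintro ⟨h3, h4⟩
          rw [h3, h4] at h2
          exact lt_asymm h h2)
        simpa using this
  unfold permLength
  rw [key, Finset.card_cons, Finset.card_map]

theorem permLength_mul_sgen_of_gt (ω : Equiv.Perm (Fin n)) (j : SIndex n) (h : ω j.hi < ω j.lo) :
    permLength ω = permLength (ω * sgen j) + 1 := by
  have := permLength_mul_sgen (ω * sgen j) j (by simpa using h)
  simpa using this

theorem lo_lt_or (ω : Equiv.Perm (Fin n)) (j : SIndex n) : ω j.lo < ω j.hi ∨ ω j.hi < ω j.lo :=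
  lt_or_gt_of_ne fun h => j.lo_lt_hi.ne (ω.injective h)

theorem permLength_mul_sgen_le (ω : Equiv.Perm (Fin n)) (j : SIndex n) :
    permLength (ω * sgen j) ≤ permLength ω + 1 := by
  rcases lo_lt_or ω j with h | h
  · exact (permLength_mul_sgen ω j h).le
  · have := permLength_mul_sgen_of_gt ω j h; omega

theorem permLength_sgen_mul (ω : Equiv.Perm (Fin n)) (j : SIndex n) :
    permLength (sgen j * ω) = permLength (ω⁻¹ * sgen j) := by
  rw [← permLength_inv, mul_inv_rev, sgen_inv]

theorem permLength_sgen_mul_of_gt (ω : Equiv.Perm (Fin n)) (j : SIndex n)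
    (h : ω⁻¹ j.hi < ω⁻¹ j.lo) : permLength ω = permLength (sgen j * ω) + 1 := by
  rw [permLength_sgen_mul, ← permLength_mul_sgen_of_gt _ _ h, permLength_inv]

theorem permLength_sgen_mul_le (ω : Equiv.Perm (Fin n)) (j : SIndex n) :
    permLength (sgen j * ω) ≤ permLength ω + 1 := by
  rw [permLength_sgen_mul, ← permLength_inv ω]; exact permLength_mul_sgen_le _ _

theorem gt_of_permLength_sgen_mul_lt (ω : Equiv.Perm (Fin n)) (j : SIndex n)
    (h : permLength (sgen j * ω) < permLength ω) : ω⁻¹ j.hi < ω⁻¹ j.lo := by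
  rcases lo_lt_or ω⁻¹ j with h1 | h1
  · have := permLength_mul_sgen _ _ h1
    rw [permLength_sgen_mul, this, permLength_inv] at h
    omega
  · exact h1

theorem permLength_prod_le (l : List (SIndex n)) : permLength (l.map sgen).prod ≤ l.length := by
  induction l with
  | nil => simp [permLength_one]
  | cons j l ih =>
    have := permLength_sgen_mul_le (l.map sgen).prod j
    simp only [List.map_cons, List.prod_cons, List.length_cons]; omega

theorem eq_one_of_no_descent (ω : Equiv.Perm (Fin n)) (h : ∀ j : SIndex n, ω j.lo < ω j.hi) :
    ω = 1 := by
  rcases n with _ | n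
  · exact Subsingleton.elim _ _
  have hm : StrictMono ω := by
    rw [Fin.strictMono_iff_lt_succ]
    intro i
    have := h ⟨i.1 + 1, by omega⟩
    exact this
  ext x
  have : (hm.orderIsoOfSurjective ω ω.surjective) = OrderIso.refl _ := Subsingleton.elim _ _
  have := congrArg (fun f => f x) this
  simpa using congrArg Fin.val this

theorem exists_descent {ω : Equiv.Perm (Fin n)} (h : ω ≠ 1) : ∃ j : SIndex n, ω j.hi < ω j.lo := by
  by_contra! hc
  exact h (eq_one_of_no_descent ω fun j => (lo_lt_or ω j).resolve_right (hc j).not_gt)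

theorem exists_word_length (ω : Equiv.Perm (Fin n)) :
    ∃ l : List (SIndex n), (l.map sgen).prod = ω ∧ l.length = permLength ω := by
  induction hm : permLength ω using Nat.strong_induction_on generalizing ω with
  | _ m ih =>
    by_cases h1 : ω = 1
    · subst h1
      exact ⟨[], by simp, by simp [← hm, permLength_one]⟩
    · obtain ⟨j, hj⟩ := exists_descent h1
      have hl := permLength_mul_sgen_of_gt ω j hj
      obtain ⟨l, h2, h3⟩ := ih _ (by omega) (ω * sgen j) rfl
      exact ⟨l ++ [j], by simp [h2], by simp; omega⟩

theorem permLength_mul_le (α β : Equiv.Perm (Fin n)) :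
    permLength (α * β) ≤ permLength α + permLength β := by
  have key : ∀ l : List (SIndex n), permLength ((l.map sgen).prod * β) ≤ l.length + permLength β := by
    intro l
    induction l with
    | nil => simp
    | cons j l ih =>
      have := permLength_sgen_mul_le ((l.map sgen).prod * β) j
      simp only [List.map_cons, List.prod_cons, List.length_cons, mul_assoc]; omega
  obtain ⟨l, rfl, h⟩ := exists_word_length α
  rw [← h]; exact key l

/-- Minimality is replaced by a count of inversions, the form in which reduced words enter all
inductions. -/
theorem isReducedWord_iff (l : List (SIndex n)) (ω : Equiv.Perm (Fin n)) :
    IsReducedWord l ω ↔ (l.map sgen).prod = ω ∧ l.length = permLength ω := by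
  constructor
  · rintro ⟨h1, h2⟩
    obtain ⟨l', h3, h4⟩ := exists_word_length ω
    have := h2 l' h3
    have := permLength_prod_le l
    rw [h1] at this
    exact ⟨h1, by omega⟩
  · rintro ⟨h1, h2⟩
    refine ⟨h1, fun l' h => ?_⟩
    rw [h2, ← h]
    exact permLength_prod_le l'

/-- Matsumoto's theorem for the symmetric group. -/
theorem prod_eq_of_reduced {M : Type*} [Monoid M] (f : SIndex n → M)
    (braid : ∀ i j : SIndex n, j.1 = i.1 + 1 → f i * f j * f i = f j * f i * f j)
    (comm : ∀ i j : SIndex n, i.1 + 1 < j.1 ∨ j.1 + 1 < i.1 → f i * f j = f j * f i)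
    (l l' : List (SIndex n)) (h : (l.map sgen).prod = (l'.map sgen).prod)
    (hl : l.length = permLength (l.map sgen).prod) (hl' : l'.length = permLength (l.map sgen).prod) :
    (l.map f).prod = (l'.map f).prod := by
  induction hm : l.length using Nat.strong_induction_on generalizing l l' with
  | _ m ih =>
  -- The induction hypothesis applied to tails: a reduced word may be exchanged for any word of the
  -- same length and product with the same first letter.
  have cons_ih : ∀ (i : SIndex n) (t t' : List (SIndex n)), (i :: t).length = m →
      (i :: t).length = permLength ((i :: t).map sgen).prod → t.length = t'.length →
      (t'.map sgen).prod = sgen i * ((i :: t).map sgen).prod →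
      (t.map f).prod = (t'.map f).prod := by
    intro i t t' h1 h2 h3 h4
    have h5 : (t.map sgen).prod = (t'.map sgen).prod := by simp [h4]
    have h6 := permLength_prod_le t
    have h7 := permLength_sgen_mul_le (t.map sgen).prod i
    simp only [List.map_cons, List.prod_cons, List.length_cons] at h2 h1
    exact ih t.length (by omega) t t' h5 (by omega) (by omega) rfl
  rcases l with _ | ⟨i, t⟩
  · have : l' = [] := List.eq_nil_of_length_eq_zero (by rw [hl', ← hl]; rfl)
    rw [this]
  rcases l' with _ | ⟨j, t'⟩
  · rw [← hl] at hl'; simp at hl'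
  set ω := ((i :: t).map sgen).prod with hω
  have hi : ω⁻¹ i.hi < ω⁻¹ i.lo := by
    refine gt_of_permLength_sgen_mul_lt ω i ?_
    rw [← hl, hω]
    simpa using permLength_prod_le t
  have hj : ω⁻¹ j.hi < ω⁻¹ j.lo := by
    refine gt_of_permLength_sgen_mul_lt ω j ?_
    rw [← hl', h]
    simpa using permLength_prod_le t'
  have hlen : t.length = t'.length := by
    have := hl.trans hl'.symm
    simpa using this
  have hli := permLength_sgen_mul_of_gt ω i hi
  have hlj := permLength_sgen_mul_of_gt ω j hj
  have hm' : (j :: t').length = m := by rw [hl', ← hl, hm]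
  simp only [List.map_cons, List.prod_cons]
  -- the two cases with a common reduced word
  have caseBraid : ∀ i j : SIndex n, j.1 = i.1 + 1 → ω⁻¹ i.hi < ω⁻¹ i.lo → ω⁻¹ j.hi < ω⁻¹ j.lo →
      ∃ u : List (SIndex n), (u.map sgen).prod = sgen i * (sgen j * (sgen i * ω)) ∧
        permLength ω = u.length + 3 := by
    intro i j hij hi hj
    obtain ⟨u, hu, hu'⟩ := exists_word_length (sgen i * (sgen j * (sgen i * ω)))
    refine ⟨u, hu, ?_⟩
    have e1 : j.lo = i.hi := by ext; simp [SIndex.lo, SIndex.hi, hij]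
    have e2 : sgen i j.hi = j.hi := sgen_apply_of_ne _
      (by simp [Fin.ext_iff, SIndex.lo, SIndex.hi]; omega)
      (by simp [Fin.ext_iff, SIndex.hi]; omega)
    have e3 : sgen j i.lo = i.lo := sgen_apply_of_ne _
      (by have := i.2; simp [Fin.ext_iff, SIndex.lo]; omega)
      (by simp [Fin.ext_iff, SIndex.lo, SIndex.hi]; omega)
    have h1 := permLength_sgen_mul_of_gt ω i hi
    have h2 := permLength_sgen_mul_of_gt (sgen i * ω) j (by
      simp only [mul_inv_rev, sgen_inv, Equiv.Perm.mul_apply, e1, e2, sgen_hi]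
      rw [e1] at hj
      exact hj.trans hi)
    have h3 := permLength_sgen_mul_of_gt (sgen j * (sgen i * ω)) i (by
      simp only [mul_inv_rev, sgen_inv, Equiv.Perm.mul_apply, e3, sgen_lo]
      rw [← e1, sgen_lo, e2, e1]
      rwa [← e1])
    omega
  -- Both s_i and s_j shorten ω from the left, so ω has reduced words that start with either side of
  -- the commutation or braid relation between them. Each given word is compared with the one that
  -- shares its first letter.
  rcases lt_trichotomy i.1 j.1 with hlt | heq | hgt
  · rcases Nat.lt_or_ge (i.1 + 1) j.1 with h2 | h2
    · obtain ⟨u, hu, hu'⟩ := exists_word_length (sgen j * (sgen i * ω))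
      have e1 : sgen i j.hi = j.hi := sgen_apply_of_ne _
        (by simp [Fin.ext_iff, SIndex.lo, SIndex.hi]; omega)
        (by simp [Fin.ext_iff, SIndex.hi]; omega)
      have e2 : sgen i j.lo = j.lo := sgen_apply_of_ne _
        (by have := i.2; simp [Fin.ext_iff, SIndex.lo]; omega)
        (by simp [Fin.ext_iff, SIndex.hi, SIndex.lo]; omega)
      have h3 := permLength_sgen_mul_of_gt (sgen i * ω) j (by
        simpa only [mul_inv_rev, sgen_inv, Equiv.Perm.mul_apply, e1, e2])
      simp only [List.length_cons] at hl hl'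
      rw [cons_ih i t (j :: u) hm hl (by simp only [List.length_cons]; omega) (by simp [hu, hω]),
        cons_ih j t' (i :: u) hm' (by rw [← h]; exact hl') (by simp only [List.length_cons]; omega)
          (by
            rw [← h]
            simp only [List.map_cons, List.prod_cons, hu]
            rw [← mul_assoc (sgen j), ← sgen_comm i j (Or.inl h2), mul_assoc, sgen_mul_sgen_mul])]
      simp only [List.map_cons, List.prod_cons, ← mul_assoc, comm i j (Or.inl h2)]
    · obtain ⟨u, hu, hu'⟩ := caseBraid i j (by omega) hi hj
      simp only [List.length_cons] at hl hl'
      have hb := sgen_braid i j (by omega)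
      rw [cons_ih i t (j :: i :: u) hm hl (by simp only [List.length_cons]; omega)
          (by simp [hu, hω]),
        cons_ih j t' (i :: j :: u) hm' (by rw [← h]; exact hl')
          (by simp only [List.length_cons]; omega)
          (by
            rw [← h]
            simp only [List.map_cons, List.prod_cons, hu]
            have : sgen i * (sgen j * (sgen i * ω)) = sgen j * (sgen i * (sgen j * ω)) := by
              simp only [← mul_assoc, hb]
            rw [this]
            simp)]
      simp only [List.map_cons, List.prod_cons, ← mul_assoc, braid i j (by omega)]
  · have hij : i = j := Subtype.ext heq
    subst hij
    rw [cons_ih i t t' hm hl hlen (by rw [← hω, h]; simp)]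
  · rcases Nat.lt_or_ge (j.1 + 1) i.1 with h2 | h2
    · obtain ⟨u, hu, hu'⟩ := exists_word_length (sgen j * (sgen i * ω))
      have e1 : sgen i j.hi = j.hi := sgen_apply_of_ne _
        (by simp [Fin.ext_iff, SIndex.lo, SIndex.hi]; omega)
        (by simp [Fin.ext_iff, SIndex.hi]; omega)
      have e2 : sgen i j.lo = j.lo := sgen_apply_of_ne _
        (by have := j.2; simp [Fin.ext_iff, SIndex.lo]; omega)
        (by simp [Fin.ext_iff, SIndex.hi, SIndex.lo]; omega)
      have h3 := permLength_sgen_mul_of_gt (sgen i * ω) j (by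
        simpa only [mul_inv_rev, sgen_inv, Equiv.Perm.mul_apply, e1, e2])
      simp only [List.length_cons] at hl hl'
      rw [cons_ih i t (j :: u) hm hl (by simp only [List.length_cons]; omega) (by simp [hu, hω]),
        cons_ih j t' (i :: u) hm' (by rw [← h]; exact hl') (by simp only [List.length_cons]; omega)
          (by
            rw [← h]
            simp only [List.map_cons, List.prod_cons, hu]
            rw [← mul_assoc (sgen j), ← sgen_comm i j (Or.inr h2), mul_assoc, sgen_mul_sgen_mul])]
      simp only [List.map_cons, List.prod_cons, ← mul_assoc, comm i j (Or.inr h2)]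
    · obtain ⟨u, hu, hu'⟩ := caseBraid j i (by omega) hj hi
      simp only [List.length_cons] at hl hl'
      have hb := sgen_braid j i (by omega)
      rw [cons_ih i t (j :: i :: u) hm hl (by simp only [List.length_cons]; omega)
          (by
            simp only [List.map_cons, List.prod_cons, hu]
            have : sgen j * (sgen i * (sgen j * ω)) = sgen i * (sgen j * (sgen i * ω)) := by
              simp only [← mul_assoc, hb]
            rw [this]
            simp [hω]),
        cons_ih j t' (i :: j :: u) hm' (by rw [← h]; exact hl')
          (by simp only [List.length_cons]; omega) (by rw [← h]; simp [hu])]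
      simp only [List.map_cons, List.prod_cons, ← mul_assoc, braid j i (by omega)]

end Length

/-! ### Products over intervals -/

section Interval

variable {M : Type*} [Monoid M]

/-- `f a * f (a+1) * ⋯ * f b`. -/
def ascProd (f : ℕ → M) (a b : ℕ) : M := ((ascList a b).map f).prod

theorem ascProd_of_lt (f : ℕ → M) {a b : ℕ} (h : b < a) : ascProd f a b = 1 := by
  have : b + 1 - a = 0 := by omega
  simp [ascProd, ascList, this]

theorem ascProd_left (f : ℕ → M) {a b : ℕ} (h : a ≤ b) :
    ascProd f a b = f a * ascProd f (a + 1) b := by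
  have : b + 1 - a = (b + 1 - (a + 1)) + 1 := by omega
  rw [ascProd, ascList, this, List.range'_succ]
  simp [ascProd, ascList]

theorem ascProd_right (f : ℕ → M) {a b : ℕ} (h : a ≤ b + 1) :
    ascProd f a (b + 1) = ascProd f a b * f (b + 1) := by
  have h1 : b + 1 + 1 - a = (b + 1 - a) + 1 := by omega
  have h2 : a + (b + 1 - a) = b + 1 := by omega
  rw [ascProd, ascList, h1, List.range'_concat]
  simp [ascProd, ascList, h2]

theorem ascProd_split (f : ℕ → M) {a b c : ℕ} (h : a ≤ b + 1) (h' : b ≤ c) :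
    ascProd f a c = ascProd f a b * ascProd f (b + 1) c := by
  induction c, h' using Nat.le_induction with
  | base => rw [ascProd_of_lt f (Nat.lt_succ_self b), mul_one]
  | succ c hc ih => rw [ascProd_right f (by omega), ih, ascProd_right f (by omega), mul_assoc]

theorem commute_ascProd (f : ℕ → M) {a b : ℕ} {x : M}
    (h : ∀ i, a ≤ i → i ≤ b → Commute x (f i)) : Commute x (ascProd f a b) := by
  refine Commute.list_prod_right _ _ fun y hy => ?_
  obtain ⟨i, hi, rfl⟩ := List.mem_map.1 hy
  rw [ascList, List.mem_range'_1] at hi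
  exact h i (by omega) (by omega)

theorem ascProd_congr {f f' : ℕ → M} {a b : ℕ} (h : ∀ i, a ≤ i → i ≤ b → f i = f' i) :
    ascProd f a b = ascProd f' a b := by
  unfold ascProd
  refine congrArg List.prod (List.map_congr_left fun i hi => ?_)
  rw [ascList, List.mem_range'_1] at hi
  exact h i (by omega) (by omega)

/-- Braid-like letters move through an increasing product, with their index lowered by one. -/
theorem mul_ascProd_shift (f c : ℕ → M) {a b i : ℕ} (ha : 1 ≤ a) (hi : a ≤ i) (hb : i < b)
    (hc : c (i + 1) * (f i * f (i + 1)) = f i * f (i + 1) * c i)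
    (hl : ∀ j, a ≤ j → j < i → Commute (c (i + 1)) (f j))
    (hr : ∀ j, i + 1 < j → j ≤ b → Commute (c i) (f j)) :
    c (i + 1) * ascProd f a b = ascProd f a b * c i := by
  have e1 : ascProd f a b =
      ascProd f a (i - 1) * (f i * f (i + 1) * ascProd f (i + 2) b) := by
    rw [ascProd_split f (b := i - 1) (by omega) (by omega), Nat.sub_add_cancel (by omega),
      ascProd_left f (a := i) (by omega), ascProd_left f (a := i + 1) (by omega)]
    simp only [mul_assoc]
  have c1 : Commute (c (i + 1)) (ascProd f a (i - 1)) :=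
    commute_ascProd f fun j h1 h2 => hl j h1 (by omega)
  have c2 : Commute (c i) (ascProd f (i + 2) b) :=
    commute_ascProd f fun j h1 h2 => hr j (by omega) h2
  rw [e1, ← mul_assoc, c1.eq, mul_assoc, ← mul_assoc (c (i + 1)), hc, mul_assoc _ (c i), c2.eq]
  simp only [mul_assoc]

end Interval

/-! ### Systems of elements that satisfy the relations of the q-Brauer algebra -/

/-- Elements `g_j` and `e` of an algebra that satisfy the defining relations of the q-Brauer
algebra; the values `g_j` for `j = 0` and `j ≥ n` play no role. -/
structure QSystem (n : ℕ) {R : Type*} [CommRing R] (q r δ : Rˣ) (T : Type*) [Ring T]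
    [Algebra R T] where
  g : ℕ → T
  e : T
  sq : ∀ j, 1 ≤ j → j < n → g j * g j = ((q : R) - 1) • g j + (q : R) • (1 : T)
  braid : ∀ j, 1 ≤ j → j + 1 < n → g j * g (j + 1) * g j = g (j + 1) * g j * g (j + 1)
  comm : ∀ i j, 1 ≤ i → i + 1 < j → j < n → g i * g j = g j * g i
  e_sq : e * e = (δ : R) • e
  e_comm : ∀ i, 2 < i → i < n → e * g i = g i * e
  e_g_one : 1 < n → e * g 1 = (q : R) • e
  g_one_e : 1 < n → g 1 * e = (q : R) • e
  -- The relation for e g_2⁻¹ e is left out: it follows from this one and `e_sq` when r - 1 = δ(q -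
  -- 1), see `e_h_two_e`. Inverses are written out below because `QSystem.h` can only be defined
  -- afterwards.
  e_g_two_e : 2 < n → e * g 2 * e = (r : R) • e
  e_two_left : 3 < n →
    e * (g 2 * g 3 * ((↑q⁻¹ : R) • g 1 + ((↑q⁻¹ : R) - 1) • (1 : T)) *
      ((↑q⁻¹ : R) • g 2 + ((↑q⁻¹ : R) - 1) • (1 : T))) * e =
    g 2 * g 3 * ((↑q⁻¹ : R) • g 1 + ((↑q⁻¹ : R) - 1) • (1 : T)) *
      ((↑q⁻¹ : R) • g 2 + ((↑q⁻¹ : R) - 1) • (1 : T)) *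
    (e * (g 2 * g 3 * ((↑q⁻¹ : R) • g 1 + ((↑q⁻¹ : R) - 1) • (1 : T)) *
      ((↑q⁻¹ : R) • g 2 + ((↑q⁻¹ : R) - 1) • (1 : T))) * e)
  e_two_right : 3 < n →
    e * (g 2 * g 3 * ((↑q⁻¹ : R) • g 1 + ((↑q⁻¹ : R) - 1) • (1 : T)) *
      ((↑q⁻¹ : R) • g 2 + ((↑q⁻¹ : R) - 1) • (1 : T))) * e =
    e * (g 2 * g 3 * ((↑q⁻¹ : R) • g 1 + ((↑q⁻¹ : R) - 1) • (1 : T)) *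
      ((↑q⁻¹ : R) • g 2 + ((↑q⁻¹ : R) - 1) • (1 : T))) * e *
    (g 2 * g 3 * ((↑q⁻¹ : R) • g 1 + ((↑q⁻¹ : R) - 1) • (1 : T)) *
      ((↑q⁻¹ : R) • g 2 + ((↑q⁻¹ : R) - 1) • (1 : T)))

namespace QSystem

variable {n : ℕ} {R : Type*} [CommRing R] {q r δ : Rˣ} {T : Type*} [Ring T] [Algebra R T]
  (D : QSystem n q r δ T)

/-- The inverse of `g_j`. -/
def h (j : ℕ) : T := (↑q⁻¹ : R) • D.g j + ((↑q⁻¹ : R) - 1) • (1 : T)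

theorem h_def (j : ℕ) : D.h j = (↑q⁻¹ : R) • D.g j + ((↑q⁻¹ : R) - 1) • (1 : T) := rfl

theorem h_mul_g {j : ℕ} (h1 : 1 ≤ j) (h2 : j < n) : D.h j * D.g j = 1 := by
  have hq : (↑q⁻¹ : R) * (q : R) = 1 := q.inv_mul
  rw [h, add_mul, smul_mul_assoc, smul_mul_assoc, one_mul, D.sq j h1 h2, smul_add, smul_smul,
    smul_smul, add_right_comm, ← add_smul]
  have h0 : (↑q⁻¹ : R) * ((q : R) - 1) + ((↑q⁻¹ : R) - 1) = 0 := by linear_combination hq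
  rw [h0, hq]; simp

theorem h_comm_g (j : ℕ) : D.h j * D.g j = D.g j * D.h j := by
  simp [h, add_mul, mul_add]

theorem g_mul_h {j : ℕ} (h1 : 1 ≤ j) (h2 : j < n) : D.g j * D.h j = 1 := by
  rw [← h_comm_g, D.h_mul_g h1 h2]

theorem g_mul_h_mul {j : ℕ} (h1 : 1 ≤ j) (h2 : j < n) (x : T) : D.g j * (D.h j * x) = x := by
  rw [← mul_assoc, D.g_mul_h h1 h2, one_mul]

theorem h_mul_g_mul {j : ℕ} (h1 : 1 ≤ j) (h2 : j < n) (x : T) : D.h j * (D.g j * x) = x := by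
  rw [← mul_assoc, D.h_mul_g h1 h2, one_mul]

theorem g_eq (j : ℕ) : D.g j = (q : R) • D.h j + ((q : R) - 1) • (1 : T) := by
  have hq : (q : R) * (↑q⁻¹ : R) = 1 := q.mul_inv
  rw [h, smul_add, smul_smul, smul_smul, hq, one_smul, add_assoc, ← add_smul]
  have : (q : R) * ((↑q⁻¹ : R) - 1) + ((q : R) - 1) = 0 := by linear_combination hq
  rw [this, zero_smul, add_zero]

theorem h_mul_eq {i j : ℕ} {x : T} (hx : D.g i * x = x * D.g j) : D.h i * x = x * D.h j := by
  simp only [h, add_mul, mul_add, smul_mul_assoc, mul_smul_comm, one_mul, mul_one, hx]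

theorem h_mul_eq_left {i j : ℕ} {x : T} (hx : D.g i * x = D.g j * x) :
    D.h i * x = D.h j * x := by
  simp only [h, add_mul, smul_mul_assoc, hx]

theorem mul_h_eq {i j : ℕ} {x : T} (hx : x * D.g i = x * D.g j) : x * D.h i = x * D.h j := by
  simp only [h, mul_add, mul_smul_comm, hx]

theorem h_mul_eq_smul {i : ℕ} {x : T} (hx : D.g i * x = (q : R) • x) :
    D.h i * x = (↑q⁻¹ : R) • x := by
  have hq : (↑q⁻¹ : R) * (q : R) = 1 := q.inv_mul
  rw [h, add_mul, smul_mul_assoc, hx, smul_smul, hq, smul_mul_assoc, one_mul, ← add_smul]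
  congr 1; ring

theorem mul_h_eq_smul {i : ℕ} {x : T} (hx : x * D.g i = (q : R) • x) :
    x * D.h i = (↑q⁻¹ : R) • x := by
  have hq : (↑q⁻¹ : R) * (q : R) = 1 := q.inv_mul
  rw [h, mul_add, mul_smul_comm, hx, smul_smul, hq, mul_smul_comm, mul_one, ← add_smul]
  congr 1; ring

theorem commute_g {i j : ℕ} (hi : 1 ≤ i) (hj : 1 ≤ j) (hi' : i < n) (hj' : j < n)
    (hij : i + 1 < j ∨ j + 1 < i) : Commute (D.g i) (D.g j) := by
  rcases hij with h | h
  · exact D.comm i j hi h hj'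
  · exact (D.comm j i hj h hi').symm

theorem commute_h_of_commute {i : ℕ} {x : T} (hx : Commute (D.g i) x) : Commute (D.h i) x :=
  D.h_mul_eq hx

theorem commute_g_h {i j : ℕ} (hi : 1 ≤ i) (hj : 1 ≤ j) (hi' : i < n) (hj' : j < n)
    (hij : i + 1 < j ∨ j + 1 < i) : Commute (D.g i) (D.h j) :=
  (D.commute_h_of_commute (D.commute_g hi hj hi' hj' hij).symm).symm

theorem commute_h_h {i j : ℕ} (hi : 1 ≤ i) (hj : 1 ≤ j) (hi' : i < n) (hj' : j < n)
    (hij : i + 1 < j ∨ j + 1 < i) : Commute (D.h i) (D.h j) :=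
  D.commute_h_of_commute (D.commute_g_h hi hj hi' hj' hij)

theorem g_braid_shift {j : ℕ} (h1 : 1 ≤ j) (h2 : j + 1 < n) :
    D.g (j + 1) * (D.g j * D.g (j + 1)) = D.g j * D.g (j + 1) * D.g j := by
  rw [D.braid j h1 h2, mul_assoc]

/-- This is the braid relation g_j g_{j+1} g_j = g_{j+1} g_j g_{j+1}, multiplied by inverses on both
sides. -/
theorem h_braid_shift {j : ℕ} (h1 : 1 ≤ j) (h2 : j + 1 < n) :
    D.g (j + 1) * (D.h j * D.h (j + 1)) = D.h j * D.h (j + 1) * D.g j := by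
  have e1 : D.g j * (D.g (j + 1) * (D.g j * (D.h j * D.h (j + 1)))) = D.g j := by
    rw [D.g_mul_h_mul h1 (by omega), D.g_mul_h (by omega) h2, mul_one]
  have e2 : D.g (j + 1) * (D.g j * (D.g (j + 1) * (D.h j * D.h (j + 1)))) = D.g j := by
    simpa only [mul_assoc, e1] using
      (congrArg (· * (D.h j * D.h (j + 1))) (D.braid j h1 h2)).symm
  have e3 := congrArg (fun x => D.h j * (D.h (j + 1) * x)) e2
  simp only [D.h_mul_g_mul (Nat.le_add_left 1 j) h2, D.h_mul_g_mul h1 (Nat.lt_of_succ_lt h2)] at e3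
  rw [e3, mul_assoc]

/-- `W_k = g_2 g_3 ⋯ g_{2k+1} g_1⁻¹ g_2⁻¹ ⋯ g_{2k}⁻¹`. -/
def W (k : ℕ) : T := ascProd D.g 2 (2 * k + 1) * ascProd D.h 1 (2 * k)

/-- The elements `e_{(k)}`. -/
def eK : ℕ → T
  | 0 => 1
  | k + 1 => D.e * D.W k * eK k

theorem W_zero : D.W 0 = 1 := by
  rw [W, ascProd_of_lt _ (by omega), ascProd_of_lt _ (by omega), one_mul]

theorem eK_one : D.eK 1 = D.e := by simp [eK, W_zero]

theorem eK_succ (k : ℕ) : D.eK (k + 1) = D.e * D.W k * D.eK k := rfl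

theorem g_mul_up {a b i : ℕ} (ha : 1 ≤ a) (hi : a ≤ i) (hb : i < b) (hn : b < n) :
    D.g (i + 1) * ascProd D.g a b = ascProd D.g a b * D.g i :=
  mul_ascProd_shift D.g D.g ha hi hb (D.g_braid_shift (by omega) (by omega))
    (fun j h1 h2 => D.commute_g (by omega) (by omega) (by omega) (by omega) (by omega))
    (fun j h1 h2 => D.commute_g (by omega) (by omega) (by omega) (by omega) (by omega))

theorem g_mul_down {a b i : ℕ} (ha : 1 ≤ a) (hi : a ≤ i) (hb : i < b) (hn : b < n) :
    D.g (i + 1) * ascProd D.h a b = ascProd D.h a b * D.g i :=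
  mul_ascProd_shift D.h D.g ha hi hb (D.h_braid_shift (by omega) (by omega))
    (fun j h1 h2 => D.commute_g_h (by omega) (by omega) (by omega) (by omega) (by omega))
    (fun j h1 h2 => D.commute_g_h (by omega) (by omega) (by omega) (by omega) (by omega))

theorem h_mul_up {a b i : ℕ} (ha : 1 ≤ a) (hi : a ≤ i) (hb : i < b) (hn : b < n) :
    D.h (i + 1) * ascProd D.g a b = ascProd D.g a b * D.h i :=
  D.h_mul_eq (D.g_mul_up ha hi hb hn)

theorem commute_up {a b i : ℕ} (ha : 1 ≤ a) (h1 : 1 ≤ i) (hi : i < n) (hb : b < n)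
    (h : i + 1 < a ∨ b + 1 < i) : Commute (D.g i) (ascProd D.g a b) :=
  commute_ascProd _ fun _ _ _ => D.commute_g (by omega) (by omega) (by omega) (by omega) (by omega)

theorem commute_down {a b i : ℕ} (ha : 1 ≤ a) (h1 : 1 ≤ i) (hi : i < n) (hb : b < n)
    (h : i + 1 < a ∨ b + 1 < i) : Commute (D.g i) (ascProd D.h a b) :=
  commute_ascProd _ fun _ _ _ => D.commute_g_h (by omega) (by omega) (by omega) (by omega) (by omega)

/-- As a permutation, W_k moves the first 2k positions two steps further, hence this shift by two.
It is what reduces statements on e_(k+1) = e W_k e_(k) to statements on e_(k). -/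
theorem g_mul_W {j k : ℕ} (h1 : 1 ≤ j) (h2 : j + 1 ≤ 2 * k) (hn : 2 * k + 1 < n) :
    D.g (j + 2) * D.W k = D.W k * D.g j := by
  rw [W, ← mul_assoc, D.g_mul_up (by omega) (by omega) (by omega) hn, mul_assoc,
    D.g_mul_down le_rfl h1 (by omega) (by omega), mul_assoc]

theorem commute_W {j k : ℕ} (h2 : 2 * k + 2 < j) (hn : j < n) : Commute (D.g j) (D.W k) :=
  (D.commute_up (by omega) (by omega) hn (by omega) (by omega)).mul_right
    (D.commute_down (by omega) (by omega) hn (by omega) (by omega))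

theorem commute_e {j : ℕ} (h2 : 2 < j) (hn : j < n) : Commute (D.g j) D.e :=
  (D.e_comm j h2 hn).symm

theorem commute_e_h {j : ℕ} (h2 : 2 < j) (hn : j < n) : Commute (D.h j) D.e :=
  D.commute_h_of_commute (D.commute_e h2 hn)

theorem W_one : D.W 1 = D.g 2 * D.g 3 * (D.h 1 * D.h 2) := by
  rw [W, ascProd_left _ (by omega), ascProd_left _ (by omega), ascProd_left D.h (by omega),
    ascProd_left D.h (by omega), ascProd_of_lt _ (by omega), ascProd_of_lt _ (by omega)]
  simp only [mul_one]

theorem eK_two_eq_W_mul (hn : 3 < n) : D.e * D.W 1 * D.e = D.W 1 * (D.e * D.W 1 * D.e) := by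
  have := D.e_two_left hn
  rw [W_one, ← mul_assoc (D.g 2 * D.g 3)]
  exact this

theorem eK_two_eq_mul_W (hn : 3 < n) : D.e * D.W 1 * D.e = D.e * D.W 1 * D.e * D.W 1 := by
  have := D.e_two_right hn
  rw [W_one, ← mul_assoc (D.g 2 * D.g 3)]
  exact this

/-- The word `g_2⁻¹ g_1⁻¹ g_3 g_2`, the reverse of `W_1`. -/
def W' : T := D.h 2 * D.h 1 * (D.g 3 * D.g 2)

/-- Expand the factor g_2⁻¹ on both sides. The leading terms agree because g_3 and g_1⁻¹ commute;
the remaining terms are both multiples of q⁻¹ r g_3 e, by e g_2 e = r e. -/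
theorem e_W_e (hn : 3 < n) : D.e * D.W 1 * D.e = D.e * D.W' * D.e := by
  have c13 : D.g 3 * D.h 1 = D.h 1 * D.g 3 :=
    D.commute_g_h (by omega) (by omega) (by omega) (by omega) (by omega)
  have ce := D.e_comm 3 (by omega) hn
  have e1 := D.h_mul_eq_smul (D.g_one_e (by omega))
  have e2 := D.mul_h_eq_smul (D.e_g_one (by omega))
  have e3 := D.e_g_two_e (by omega)
  rw [W_one, W']
  have l1 : D.e * (D.g 2 * D.g 3 * (D.h 1 * D.h 2)) * D.e =
      (↑q⁻¹ : R) • (D.e * D.g 2 * D.g 3 * D.h 1 * D.g 2 * D.e) +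
        ((↑q⁻¹ : R) - 1) • (D.e * D.g 2 * D.g 3 * (D.h 1 * D.e)) := by
    rw [D.h_def 2]
    simp only [mul_add, add_mul, mul_smul_comm, smul_mul_assoc, mul_one, mul_assoc]
  have l2 : D.e * (D.h 2 * D.h 1 * (D.g 3 * D.g 2)) * D.e =
      (↑q⁻¹ : R) • (D.e * D.g 2 * D.g 3 * D.h 1 * D.g 2 * D.e) +
        ((↑q⁻¹ : R) - 1) • (D.e * D.h 1 * D.g 3 * D.g 2 * D.e) := by
    rw [D.h_def 2, mul_assoc (D.e * D.g 2), c13]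
    simp only [mul_add, add_mul, mul_smul_comm, smul_mul_assoc, one_mul, mul_assoc]
  have l3 : D.e * D.g 2 * D.g 3 * (D.h 1 * D.e) = (↑q⁻¹ : R) • (r : R) • (D.g 3 * D.e) := by
    rw [e1, mul_smul_comm, mul_assoc, ← ce, ← mul_assoc, e3, smul_mul_assoc, ce]
  have l4 : D.e * D.h 1 * D.g 3 * D.g 2 * D.e = (↑q⁻¹ : R) • (r : R) • (D.g 3 * D.e) := by
    rw [e2, smul_mul_assoc, smul_mul_assoc, smul_mul_assoc, ce, mul_assoc (D.g 3), mul_assoc (D.g 3),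
      e3, mul_smul_comm]
  rw [l1, l2, l3, l4]

theorem g_three_mul_eK_two (hn : 3 < n) :
    D.g 3 * (D.e * D.W 1 * D.e) = (q : R) • (D.e * D.W 1 * D.e) := by
  have h1 := D.g_mul_W (j := 1) (k := 1) (by omega) (by omega) (by omega)
  rw [← mul_assoc, ← mul_assoc, ← D.e_comm 3 (by omega) hn, mul_assoc D.e, h1]
  rw [mul_assoc, mul_assoc, mul_assoc, D.g_one_e (by omega)]
  simp

/-- In the form e W' e, a g_3 on the right passes e, becomes g_1 in front of W', and is absorbed by
the first e. -/
theorem eK_two_mul_g_three (hn : 3 < n) :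
    D.e * D.W 1 * D.e * D.g 3 = (q : R) • (D.e * D.W 1 * D.e) := by
  have e1 : D.h 2 * D.h 1 * D.g 2 = D.g 1 * (D.h 2 * D.h 1) := by
    have e2 := D.h_mul_eq (D.h_braid_shift (j := 1) le_rfl (by omega))
    have e3 := congrArg (fun x => D.g 1 * x * D.g 2) e2
    have e4 : D.g 1 * (D.h 1 * D.h (1 + 1) * D.h 1) * D.g 2 = D.h 2 * D.h 1 * D.g 2 := by
      simp only [mul_assoc, D.g_mul_h_mul le_rfl (show 1 < n by omega)]
    have e5 : D.g 1 * (D.h (1 + 1) * (D.h 1 * D.h (1 + 1))) * D.g 2 =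
        D.g 1 * (D.h 2 * D.h 1) := by
      simp only [mul_assoc, D.h_mul_g (show 1 ≤ 2 by omega) (show 2 < n by omega), mul_one]
    rw [← e4, ← e5]
    exact e3.symm
  have h1 : D.W' * D.g 3 = D.g 1 * D.W' := by
    have := D.braid 2 (by omega) hn
    rw [W', mul_assoc, ← this, ← mul_assoc, ← mul_assoc, e1]
    simp only [mul_assoc]
  rw [D.e_W_e hn, mul_assoc, D.e_comm 3 (by omega) hn, mul_assoc, ← mul_assoc D.W', h1,
    mul_assoc (D.g 1), ← mul_assoc D.e (D.g 1), D.e_g_one (by omega)]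
  simp [mul_assoc]

theorem g_one_mul_eK_two (hn : 3 < n) :
    D.g 1 * (D.e * D.W 1 * D.e) = (q : R) • (D.e * D.W 1 * D.e) := by
  rw [← mul_assoc, ← mul_assoc, D.g_one_e (by omega), smul_mul_assoc, smul_mul_assoc]

theorem eK_two_mul_g_one (hn : 3 < n) :
    D.e * D.W 1 * D.e * D.g 1 = (q : R) • (D.e * D.W 1 * D.e) := by
  rw [mul_assoc, D.e_g_one (by omega), mul_smul_comm]

/-- Cancelling letters in x = W_1 x gives the statement with g_2⁻¹ in place of g_2. Since g_2 is a
combination of g_2⁻¹ and 1, and g_1 and g_3 both multiply x by q, the statement for g_2 follows. -/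
theorem g_three_g_two_eK_two (hn : 3 < n) :
    D.g 3 * (D.g 2 * (D.e * D.W 1 * D.e)) = D.g 1 * (D.g 2 * (D.e * D.W 1 * D.e)) := by
  set x := D.e * D.W 1 * D.e with hx
  have c13 : D.g 3 * D.g 1 = D.g 1 * D.g 3 :=
    D.commute_g (by omega) (by omega) (by omega) (by omega) (by omega)
  have h0 : x = D.g 2 * (D.g 3 * (D.h 1 * (D.h 2 * x))) := by
    conv_lhs => rw [hx, D.eK_two_eq_W_mul hn, ← hx, W_one]
    simp only [mul_assoc]
  have h1 : D.h 3 * (D.h 2 * x) = D.h 1 * (D.h 2 * x) := by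
    conv_lhs => rw [h0, D.h_mul_g_mul (by omega) (by omega), D.h_mul_g_mul (by omega) hn]
  have h2 : D.g 1 * (D.h 2 * x) = D.g 3 * (D.h 2 * x) := by
    have := congrArg (fun y => D.g 3 * (D.g 1 * y)) h1
    simp only [D.g_mul_h_mul le_rfl (show 1 < n by omega)] at this
    rwa [← mul_assoc (D.g 3), c13, mul_assoc, D.g_mul_h_mul (by omega) hn] at this
  rw [D.g_eq 2, add_mul, mul_add, mul_add, smul_mul_assoc, smul_mul_assoc, one_mul, mul_smul_comm,
    mul_smul_comm, mul_smul_comm, mul_smul_comm, h2, D.g_three_mul_eK_two hn,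
    D.g_one_mul_eK_two hn]

theorem eK_two_g_two_g_three (hn : 3 < n) :
    D.e * D.W 1 * D.e * D.g 2 * D.g 3 = D.e * D.W 1 * D.e * D.g 2 * D.g 1 := by
  set x := D.e * D.W 1 * D.e with hx
  have h0 : x = x * D.g 2 * D.g 3 * D.h 1 * D.h 2 := by
    conv_lhs => rw [hx, D.eK_two_eq_mul_W hn, ← hx, W_one]
    simp only [mul_assoc]
  conv_rhs => rw [h0]
  simp only [mul_assoc, D.h_mul_g_mul (show 1 ≤ 2 by omega) (show 2 < n by omega)]
  rw [D.h_mul_g le_rfl (by omega), mul_one]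

/-- This and the next lemma are the relations (E₃) for the reversed word; they make the set of
relations symmetric under reversal. -/
theorem W'_mul_eK_two (hn : 3 < n) : D.W' * (D.e * D.W 1 * D.e) = D.e * D.W 1 * D.e := by
  rw [W', mul_assoc, mul_assoc (D.g 3), D.g_three_g_two_eK_two hn, mul_assoc,
    D.h_mul_g_mul le_rfl (by omega), D.h_mul_g_mul (by omega) (by omega)]

theorem eK_two_mul_W' (hn : 3 < n) : D.e * D.W 1 * D.e * D.W' = D.e * D.W 1 * D.e := by
  set x := D.e * D.W 1 * D.e with hx
  have h1 : x * D.h 2 * D.g 1 = x * D.h 2 * D.g 3 := by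
    have e1 : x * D.g 2 * D.g 3 = x * D.g 2 * D.g 1 := D.eK_two_g_two_g_three hn
    have e2 : x * D.g 3 = (q : R) • x := D.eK_two_mul_g_three hn
    have e3 : x * D.g 1 = (q : R) • x := D.eK_two_mul_g_one hn
    simp only [h, mul_add, add_mul, mul_smul_comm, smul_mul_assoc, mul_one, e1, e2, e3]
  have h2 := D.mul_h_eq h1
  rw [W', ← mul_assoc, ← mul_assoc x, h2, mul_assoc, D.h_mul_g_mul (by omega) hn, mul_assoc,
    D.h_mul_g (by omega) (by omega), mul_one]

/-- The defining relations of the q-Brauer algebra are invariant under the reversal of products. -/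
def op : QSystem n q r δ Tᵐᵒᵖ where
  g j := MulOpposite.op (D.g j)
  e := MulOpposite.op D.e
  sq j h1 h2 := by
    rw [← MulOpposite.op_mul, D.sq j h1 h2]; rfl
  braid j h1 h2 := by
    simp only [← MulOpposite.op_mul, ← mul_assoc, D.braid j h1 h2]
  comm i j h1 h2 h3 := by
    simp only [← MulOpposite.op_mul, D.comm i j h1 h2 h3]
  e_sq := by rw [← MulOpposite.op_mul, D.e_sq]; rfl
  e_comm i h1 h2 := by simp only [← MulOpposite.op_mul, D.e_comm i h1 h2]
  e_g_one h1 := by rw [← MulOpposite.op_mul, D.g_one_e h1]; rfl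
  g_one_e h1 := by rw [← MulOpposite.op_mul, D.e_g_one h1]; rfl
  e_g_two_e h1 := by
    rw [← MulOpposite.op_mul, ← MulOpposite.op_mul, ← mul_assoc, D.e_g_two_e h1]; rfl
  -- In the opposite algebra the word W_1 turns into W', and left multiplication into right
  -- multiplication, so the axiom is e W' e W' = e W' e read backwards.
  e_two_left h1 := by
    have e := D.eK_two_mul_W' h1
    rw [D.e_W_e h1] at e
    have := congrArg MulOpposite.op e
    simp only [W', h] at this
    simpa [mul_assoc] using this.symm
  e_two_right h1 := by
    have e := D.W'_mul_eK_two h1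
    rw [D.e_W_e h1] at e
    have := congrArg MulOpposite.op e
    simp only [W', h] at this
    simpa [mul_assoc] using this.symm

end QSystem

/-! ### Absorption rules for e_(k) and its invariance under reversal -/

namespace QSystem

variable {n : ℕ} {R : Type*} [CommRing R] {q r δ : Rˣ} {T : Type*} [Ring T] [Algebra R T]
  (D : QSystem n q r δ T)

theorem e_mul_eK {k : ℕ} (hk : 1 ≤ k) : D.e * D.eK k = (δ : R) • D.eK k := by
  obtain ⟨k, rfl⟩ := Nat.exists_eq_add_of_le' hk
  rw [eK_succ, ← mul_assoc, ← mul_assoc, D.e_sq, smul_mul_assoc, smul_mul_assoc]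

/-- The invertibility of δ enters here: a factor e can be created in front of e_(k). -/
theorem eK_eq_smul {k : ℕ} (hk : 1 ≤ k) : D.eK k = (↑δ⁻¹ : R) • (D.e * D.eK k) := by
  rw [D.e_mul_eK hk, smul_smul, δ.inv_mul, one_smul]

theorem commute_eK {k j : ℕ} (hj : 2 * k < j) (hn : j < n) : Commute (D.g j) (D.eK k) := by
  induction k with
  | zero => exact Commute.one_right _
  | succ k ih =>
    rw [eK_succ]
    exact ((D.commute_e (by omega) hn).mul_right (D.commute_W (by omega) hn)).mul_right
      (ih (by omega))

theorem g_mul_eK_succ {k j : ℕ} (h1 : 1 ≤ j) (h2 : j + 1 ≤ 2 * k) (hn : 2 * k + 1 < n) (x : T) :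
    D.g (j + 2) * (D.e * D.W k * x) = D.e * D.W k * (D.g j * x) := by
  rw [← mul_assoc, ← mul_assoc, ← D.e_comm _ (by omega) (by omega), mul_assoc D.e,
    D.g_mul_W h1 h2 hn]
  simp only [mul_assoc]

/-- For i = 0 this is g_1 e = q e. Otherwise g_{2i+1} passes through e W_k, becomes g_{2i-1}, and
meets the preceding e_(k). -/
theorem g_odd_mul_eK {k i : ℕ} (hi : i < k) (hk : 2 * k ≤ n) :
    D.g (2 * i + 1) * D.eK k = (q : R) • D.eK k := by
  induction k generalizing i with
  | zero => omega
  | succ k ih =>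
    rw [eK_succ]
    rcases i with _ | i
    · rw [mul_zero, zero_add, ← mul_assoc, ← mul_assoc, D.g_one_e (by omega), smul_mul_assoc,
        smul_mul_assoc]
    · rw [show 2 * (i + 1) + 1 = 2 * i + 1 + 2 by ring,
        D.g_mul_eK_succ (by omega) (by omega) (by omega), ih (by omega) (by omega), mul_smul_comm]

theorem W_succ_eq {k : ℕ} (hk : 1 ≤ k) (hn : 2 * k + 1 < n) :
    D.W k = D.W 1 * (ascProd D.g 4 (2 * k + 1) * ascProd D.h 3 (2 * k)) := by
  have c : Commute (D.h 1 * D.h 2) (ascProd D.g 4 (2 * k + 1)) := by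
    refine commute_ascProd _ fun i h1 h2 => ?_
    exact (D.commute_g_h (by omega) (by omega) (by omega) (by omega) (by omega)).symm.mul_left
      (D.commute_g_h (by omega) (by omega) (by omega) (by omega) (by omega)).symm
  rw [W_one, W, ascProd_left D.g (by omega), ascProd_left D.g (by omega),
    ascProd_left D.h (by omega), ascProd_left D.h (by omega), ← mul_assoc (D.h 1)]
  simp only [Nat.reduceAdd]
  rw [mul_assoc (D.g 2 * D.g 3), ← mul_assoc (D.h 1 * D.h 2), c.eq]
  simp only [mul_assoc]

/-- `e_{(k+1)}` is a right multiple of `e W_1 e`. -/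
theorem eK_succ_eq {k : ℕ} (hk : 1 ≤ k) (hn : 2 * k + 1 < n) :
    ∃ y, D.eK (k + 1) = D.e * D.W 1 * D.e * y := by
  -- The second e is inserted: e commutes with the letters of index at least 3 that remain of W_k,
  -- and it multiplies e_(k) by δ, which the factor δ⁻¹ compensates.
  refine ⟨(↑δ⁻¹ : R) • (ascProd D.g 4 (2 * k + 1) * ascProd D.h 3 (2 * k) * D.eK k), ?_⟩
  have c : Commute D.e (ascProd D.g 4 (2 * k + 1) * ascProd D.h 3 (2 * k)) :=
    (commute_ascProd _ fun i h1 h2 => (D.commute_e (by omega) (by omega)).symm).mul_right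
      (commute_ascProd _ fun i h1 h2 => (D.commute_e_h (by omega) (by omega)).symm)
  rw [eK_succ, D.W_succ_eq hk hn]
  generalize ascProd D.g 4 (2 * k + 1) * ascProd D.h 3 (2 * k) = P at c ⊢
  have h : D.e * (P * D.eK k) = (δ : R) • (P * D.eK k) := by
    rw [← mul_assoc, c.eq, mul_assoc, D.e_mul_eK hk, mul_smul_comm]
  simp only [mul_smul_comm, mul_assoc, h, smul_smul, δ.inv_mul, one_smul]

/-- For l = 1 the rule comes from (E₃), since e W_1 e is a left factor of e_(k). For larger l all
three letters pass through e W_k with indices lowered by two. -/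
theorem g_even_mul_eK {k l : ℕ} (h1 : 1 ≤ l) (hl : l < k) (hk : 2 * k ≤ n) :
    D.g (2 * l + 1) * (D.g (2 * l) * D.eK k) = D.g (2 * l - 1) * (D.g (2 * l) * D.eK k) := by
  induction k generalizing l with
  | zero => omega
  | succ k ih =>
    rcases (show l = 1 ∨ 2 ≤ l by omega) with rfl | h2
    · obtain ⟨y, hy⟩ := D.eK_succ_eq (k := k) (by omega) (by omega)
      have := congrArg (· * y) (D.g_three_g_two_eK_two (by omega))
      rw [hy]
      simpa only [mul_assoc] using this
    · obtain ⟨m, rfl⟩ := Nat.exists_eq_add_of_le h2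
      rw [eK_succ, show 2 * (2 + m) = 2 * (m + 1) + 2 by ring,
        D.g_mul_eK_succ (by omega) (by omega) (by omega),
        show 2 * (m + 1) + 2 + 1 = 2 * (m + 1) + 1 + 2 by ring,
        show 2 * (m + 1) + 2 - 1 = 2 * (m + 1) - 1 + 2 by omega,
        D.g_mul_eK_succ (by omega) (by omega) (by omega),
        D.g_mul_eK_succ (by omega) (by omega) (by omega),
        ih (by omega) (by omega) (by omega)]

/-- The inverse of g_{2l} is a combination of g_{2l} and 1, and on e_(k) itself both odd letters act
as q. -/
theorem h_even_mul_eK {k l : ℕ} (h1 : 1 ≤ l) (hl : l < k) (hk : 2 * k ≤ n) :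
    D.h (2 * l + 1) * (D.h (2 * l) * D.eK k) = D.h (2 * l - 1) * (D.h (2 * l) * D.eK k) := by
  refine D.h_mul_eq_left ?_
  have e1 := D.g_odd_mul_eK (i := l) hl hk
  have e2 := D.g_odd_mul_eK (i := l - 1) (k := k) (by omega) hk
  rw [show 2 * (l - 1) + 1 = 2 * l - 1 by omega] at e2
  rw [D.h_def (2 * l)]
  simp only [mul_add, add_mul, mul_smul_comm, smul_mul_assoc, one_mul, e1, e2,
    D.g_even_mul_eK h1 hl hk]

/-- With a second e created in front of e_(k) and moved left past g_3 ⋯ g_b, the relation e g_2 e =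
r e applies. -/
theorem e_up_eK {k b : ℕ} (hk : 1 ≤ k) (h2 : 2 ≤ b) (hb : b < n) :
    D.e * (ascProd D.g 2 b * D.eK k) = (r : R) • (ascProd D.g 3 b * D.eK k) := by
  have c : Commute D.e (ascProd D.g 3 b) :=
    commute_ascProd _ fun i h1 h2 => (D.commute_e (by omega) (by omega)).symm
  conv_lhs => rw [D.eK_eq_smul hk, mul_smul_comm, mul_smul_comm, ascProd_left D.g h2,
    ← mul_assoc _ D.e, mul_assoc (D.g 2), ← c.eq, ← mul_assoc, ← mul_assoc, ← mul_assoc,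
    D.e_g_two_e (by omega), smul_mul_assoc, smul_mul_assoc, c.eq, mul_assoc, D.e_mul_eK hk,
    mul_smul_comm, smul_comm (r : R), smul_smul, δ.inv_mul, one_smul]

/-- Increasing l adds g_{2l+1}⁻¹ g_{2l+2}⁻¹ in front of e_(k), which equals g_{2l+3}⁻¹ g_{2l+2}⁻¹
there. These two letters pass to the left of e with indices raised by one and cancel the first two
factors of g_{2l+3} ⋯ g_{2k}. -/
theorem e_up_down_eK {k l : ℕ} (hk : 1 ≤ k) (hl : l < k) (hn : 2 * k < n) :
    D.e * (ascProd D.g 2 (2 * k) * (ascProd D.h 1 (2 * l) * D.eK k)) =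
      (r : R) • (ascProd D.g (2 * l + 3) (2 * k) * D.eK k) := by
  induction l with
  | zero =>
    rw [ascProd_of_lt D.h (by omega), one_mul, D.e_up_eK hk (by omega) hn]
  | succ l ih =>
    have e1 := D.h_even_mul_eK (k := k) (l := l + 1) (by omega) hl hn.le
    rw [show 2 * (l + 1) - 1 = 2 * l + 1 by omega, show 2 * (l + 1) = 2 * l + 2 by ring] at e1
    have c1 : Commute (D.h (2 * l + 3)) (ascProd D.h 1 (2 * l)) :=
      commute_ascProd _ fun i h1 h2 =>
        D.commute_h_h (by omega) (by omega) (by omega) (by omega) (by omega)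
    have c2 : Commute (D.h (2 * l + 2)) (ascProd D.h 1 (2 * l)) :=
      commute_ascProd _ fun i h1 h2 =>
        D.commute_h_h (by omega) (by omega) (by omega) (by omega) (by omega)
    have s1 : ascProd D.h 1 (2 * (l + 1)) * D.eK k =
        D.h (2 * l + 3) * (D.h (2 * l + 2) * (ascProd D.h 1 (2 * l) * D.eK k)) := by
      rw [show 2 * (l + 1) = 2 * l + 1 + 1 by ring, ascProd_right D.h (by omega),
        ascProd_right D.h (by omega), mul_assoc, mul_assoc, ← e1, c1.symm.left_comm, c2.symm.left_comm]
    have s2 : ∀ i, 2 ≤ i → i < 2 * k → ∀ x, D.e * (ascProd D.g 2 (2 * k) * (D.h i * x)) =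
        D.h (i + 1) * (D.e * (ascProd D.g 2 (2 * k) * x)) := by
      intro i h1 h2 x
      rw [← mul_assoc (ascProd _ _ _), ← D.h_mul_up (by omega) h1 h2 hn, mul_assoc, ← mul_assoc D.e,
        ← (D.commute_e_h (show 2 < i + 1 by omega) (by omega)).eq]
      simp only [mul_assoc]
    rw [s1, s2 _ (by omega) (by omega), s2 _ (by omega) (by omega), ih (by omega),
      ascProd_left D.g (by omega), ascProd_left D.g (by omega)]
    simp only [mul_smul_comm, mul_assoc]
    rw [D.h_mul_g_mul (by omega) (by omega), D.h_mul_g_mul (by omega) (by omega),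
      show 2 * (l + 1) + 3 = 2 * l + 3 + 1 + 1 by ring]

/-- The analogue of e g_2 e = r e with e W_k for the first e and e_(k+1) for the second; it is the
case of `e_up_down_eK` in which all letters cancel. -/
theorem e_W_g_eK {k : ℕ} (hn : 2 * k + 3 < n) :
    D.e * D.W k * (D.g (2 * k + 2) * D.eK (k + 1)) = (r : R) • D.eK (k + 1) := by
  have := D.e_up_down_eK (k := k + 1) (l := k) (by omega) (by omega) (by omega)
  have c : Commute (D.g (2 * k + 2)) (ascProd D.h 1 (2 * k)) :=
    D.commute_down le_rfl (by omega) (by omega) (by omega) (by omega)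
  rw [ascProd_of_lt D.g (show 2 * (k + 1) < 2 * k + 3 by omega), one_mul] at this
  rw [← this, W, show 2 * (k + 1) = 2 * k + 1 + 1 by ring,
    ascProd_right D.g (a := 2) (b := 2 * k + 1) (by omega), mul_assoc D.e, mul_assoc (ascProd _ _ _),
    c.symm.left_comm]
  simp only [mul_assoc]

/-- The reverse of `W_k`. -/
def revW (k : ℕ) : T := MulOpposite.unop (D.op.W k)

@[simp] theorem op_g (j : ℕ) : D.op.g j = MulOpposite.op (D.g j) := rfl

@[simp] theorem op_e : D.op.e = MulOpposite.op D.e := rfl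

@[simp] theorem op_h (j : ℕ) : D.op.h j = MulOpposite.op (D.h j) := by
  simp [h]

/-- The factor by which `W_{k+1}` exceeds `W_k`. -/
def wFactor (k : ℕ) : T :=
  D.g (2 * k + 2) * D.g (2 * k + 3) * (D.h (2 * k + 1) * D.h (2 * k + 2))

theorem W_succ {k : ℕ} (hn : 2 * k + 3 < n) : D.W (k + 1) = D.W k * D.wFactor k := by
  have c1 : Commute (D.g (2 * k + 2)) (ascProd D.h 1 (2 * k)) :=
    D.commute_down le_rfl (by omega) (by omega) (by omega) (by omega)
  have c2 : Commute (D.g (2 * k + 3)) (ascProd D.h 1 (2 * k)) :=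
    D.commute_down le_rfl (by omega) (by omega) (by omega) (by omega)
  rw [W, W, wFactor, show 2 * (k + 1) + 1 = 2 * k + 1 + 1 + 1 by ring,
    show 2 * (k + 1) = 2 * k + 1 + 1 by ring, ascProd_right D.g (by omega),
    ascProd_right D.g (by omega), ascProd_right D.h (by omega), ascProd_right D.h (by omega)]
  have := (c1.mul_left c2).eq
  simp only [mul_assoc] at this ⊢
  rw [← mul_assoc (D.g (2 * k + 1 + 1)), ← mul_assoc (_ * D.g (2 * k + 1 + 1 + 1)),
    (c1.mul_left c2).eq]
  simp only [mul_assoc]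

/-- The reverse of `wFactor k`. -/
def revFactor (k : ℕ) : T :=
  D.h (2 * k + 2) * D.h (2 * k + 1) * (D.g (2 * k + 3) * D.g (2 * k + 2))

theorem revW_succ {k : ℕ} (hn : 2 * k + 3 < n) :
    D.revW (k + 1) = D.revFactor k * D.revW k := by
  rw [revW, D.op.W_succ hn, MulOpposite.unop_mul, revW, wFactor, revFactor]
  simp

theorem unop_eK_op_succ (k : ℕ) : MulOpposite.unop (D.op.eK (k + 1)) =
    MulOpposite.unop (D.op.eK k) * (D.revW k * D.e) := by
  rw [eK_succ]; simp [revW]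

theorem commute_eK_h {k j : ℕ} (hj : 2 * k < j) (hn : j < n) : Commute (D.h j) (D.eK k) :=
  D.commute_h_of_commute (D.commute_eK hj hn)

/-- By induction e_(k+1) begins with e W_k and ends with its reverse. This brings both e_(k+2) and
its reverse to the form e W_k x e_(k+1), with x equal to `wFactor k` and `revFactor k` respectively.
These two agree by the computation of `e_W_e`, with `e_W_g_eK` in the role of e g_2 e = r e. -/
theorem unop_eK_op {k : ℕ} (hk : 2 * k ≤ n) : MulOpposite.unop (D.op.eK k) = D.eK k := by
  induction k using Nat.strong_induction_on with
  | _ k ih =>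
  rcases k with _ | _ | k
  · rfl
  · rw [eK_one, eK_one]; rfl
  have ih1 := ih (k + 1) (by omega) (by omega)
  have ih0 := ih k (by omega) (by omega)
  have e0 : D.eK (k + 1) = D.eK k * (D.revW k * D.e) := by rw [← ih1, unop_eK_op_succ, ih0]
  have right_odd : D.eK (k + 1) * D.g (2 * k + 1) = (q : R) • D.eK (k + 1) := by
    have := congrArg MulOpposite.unop
      (D.op.g_odd_mul_eK (k := k + 1) (i := k) (by omega) (by omega))
    simpa [ih1] using this
  -- An element that commutes with e_(k) can be moved between the two factorizations e W_k e_(k) and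
  -- e_(k) (reverse of W_k) e of e_(k+1).
  have hc : ∀ x : T, Commute x (D.eK k) → D.eK (k + 1) * x * (D.revW k * D.e) =
      D.e * D.W k * x * D.eK (k + 1) := by
    intro x hx
    conv_rhs => rw [e0, ← mul_assoc, mul_assoc _ x, hx.eq]
    rw [eK_succ]
    simp only [mul_assoc]
  have cg : ∀ j, 2 * k < j → j < n → Commute (D.g j) (D.eK k) := fun j h1 h2 => D.commute_eK h1 h2
  have ch : ∀ j, 2 * k < j → j < n → Commute (D.h j) (D.eK k) := fun j h1 h2 =>
    D.commute_eK_h h1 h2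
  set g1 := D.h (2 * k + 1) with hg1
  set g2 := D.g (2 * k + 2) with hg2
  set g3 := D.g (2 * k + 3) with hg3
  have c13 : Commute g3 g1 := D.commute_g_h (by omega) (by omega) (by omega) (by omega) (by omega)
  have c3 : Commute g3 (D.eK (k + 1)) := D.commute_eK (by omega) (by omega)
  have c3W : Commute g3 (D.e * D.W k) :=
    (D.commute_e (by omega) (by omega)).mul_right (D.commute_W (by omega) (by omega))
  have eZ : D.e * D.W k * (g2 * D.eK (k + 1)) = (r : R) • D.eK (k + 1) := D.e_W_g_eK (by omega)
  have e1 : g1 * D.eK (k + 1) = (↑q⁻¹ : R) • D.eK (k + 1) :=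
    D.h_mul_eq_smul (D.g_odd_mul_eK (by omega) (by omega))
  have e2 : D.eK (k + 1) * g1 = (↑q⁻¹ : R) • D.eK (k + 1) := D.mul_h_eq_smul right_odd
  -- the two terms of lower length
  have t1 : D.e * D.W k * (g2 * (g3 * (g1 * D.eK (k + 1)))) =
      (↑q⁻¹ : R) • (r : R) • (D.eK (k + 1) * g3) := by
    rw [e1, mul_smul_comm, mul_smul_comm, mul_smul_comm, c3.eq, ← mul_assoc g2, ← mul_assoc, eZ,
      smul_mul_assoc]
  have t2 : D.e * D.W k * (g1 * (g3 * (g2 * D.eK (k + 1)))) =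
      (↑q⁻¹ : R) • (r : R) • (D.eK (k + 1) * g3) := by
    have h1 := hc (g1 * (g3 * g2)) ((ch _ (by omega) (by omega)).mul_left
      ((cg _ (by omega) (by omega)).mul_left (cg _ (by omega) (by omega))))
    have h2 := hc (g3 * g2) ((cg _ (by omega) (by omega)).mul_left (cg _ (by omega) (by omega)))
    have h3 : D.e * D.W k * (g1 * (g3 * (g2 * D.eK (k + 1)))) =
        (↑q⁻¹ : R) • (D.eK (k + 1) * (g3 * g2) * (D.revW k * D.e)) := by
      rw [← smul_mul_assoc, ← smul_mul_assoc, ← e2]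
      simp only [mul_assoc] at h1 ⊢
      exact h1.symm
    rw [h3, h2, mul_assoc, mul_assoc g3, ← mul_assoc _ g3, ← c3W.eq, mul_assoc, eZ, mul_smul_comm,
      c3.eq]
  rw [unop_eK_op_succ, ih1, D.revW_succ (by omega), ← mul_assoc, ← mul_assoc, mul_assoc _ (D.revW k),
    hc (D.revFactor k), D.eK_succ (k + 1), D.W_succ (by omega), wFactor, revFactor,
    D.h_def (2 * k + 2), ← hg1, ← hg2, ← hg3]
  · simp only [mul_add, add_mul, mul_smul_comm, smul_mul_assoc, one_mul, mul_one]
    congr 1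
    · simp only [mul_assoc]
      rw [c13.left_comm]
    · simp only [mul_assoc] at t1 t2 ⊢
      rw [t1, t2]
  · exact ((ch _ (by omega) (by omega)).mul_left (ch _ (by omega) (by omega))).mul_left
      ((cg _ (by omega) (by omega)).mul_left (cg _ (by omega) (by omega)))

end QSystem

namespace QSystem

variable {n : ℕ} {R : Type*} [CommRing R] {q r δ : Rˣ} {T : Type*} [Ring T] [Algebra R T]
  (D : QSystem n q r δ T)

/-! ### The elements `g_ω` -/

/-- The product of the `g_j` along a word. -/
def gw (l : List (SIndex n)) : T := (l.map fun j => D.g j.1).prod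

/-- The element `g_ω`. -/
noncomputable def gT (ω : Equiv.Perm (Fin n)) : T := D.gw (exists_reducedWord ω).choose

theorem gw_eq_gT {l : List (SIndex n)} {ω : Equiv.Perm (Fin n)} (hl : IsReducedWord l ω) :
    D.gw l = D.gT ω := by
  have h1 := (isReducedWord_iff _ _).1 hl
  have h2 := (isReducedWord_iff _ _).1 (exists_reducedWord ω).choose_spec
  refine prod_eq_of_reduced (fun j : SIndex n => D.g j.1) (fun i j hij => ?_) (fun i j hij => ?_) _ _
    (h1.1.trans h2.1.symm) (by rw [h1.1]; exact h1.2) (by rw [h1.1]; exact h2.2)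
  · have := i.2; have := j.2
    simp only [hij]
    exact D.braid i.1 (by omega) (by omega)
  · have := i.2; have := j.2
    exact D.commute_g (by omega) (by omega) (by omega) (by omega) hij

theorem gT_one : D.gT 1 = 1 := by
  rw [← D.gw_eq_gT (l := []) ((isReducedWord_iff _ _).2 ⟨by simp, by simp [permLength_one]⟩)]
  simp [gw]

theorem gT_mul {α β : Equiv.Perm (Fin n)} (h : permLength (α * β) = permLength α + permLength β) :
    D.gT (α * β) = D.gT α * D.gT β := by
  obtain ⟨l, h1, h2⟩ := exists_word_length α
  obtain ⟨l', h3, h4⟩ := exists_word_length β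
  rw [← D.gw_eq_gT ((isReducedWord_iff l _).2 ⟨h1, h2⟩),
    ← D.gw_eq_gT ((isReducedWord_iff l' _).2 ⟨h3, h4⟩),
    ← D.gw_eq_gT ((isReducedWord_iff (l ++ l') _).2 ⟨by simp [h1, h3], by simp [h, h2, h4]⟩)]
  simp [gw]

theorem permLength_sgen (j : SIndex n) : permLength (sgen j) = 1 := by
  have := permLength_mul_sgen 1 j (by simpa using j.lo_lt_hi)
  simpa [permLength_one] using this

theorem gT_sgen (j : SIndex n) : D.gT (sgen j) = D.g j.1 := by
  rw [← D.gw_eq_gT (l := [j]) ((isReducedWord_iff _ _).2 ⟨by simp, by simp [permLength_sgen]⟩)]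
  simp [gw]

theorem gT_mul_sgen {ω : Equiv.Perm (Fin n)} {j : SIndex n} (h : ω j.lo < ω j.hi) :
    D.gT (ω * sgen j) = D.gT ω * D.g j.1 := by
  rw [D.gT_mul (by rw [permLength_mul_sgen ω j h, permLength_sgen]), gT_sgen]

theorem gT_eq_mul {ω : Equiv.Perm (Fin n)} {j : SIndex n} (h : ω j.hi < ω j.lo) :
    D.gT ω = D.gT (ω * sgen j) * D.g j.1 := by
  have := D.gT_mul_sgen (ω := ω * sgen j) (j := j) (by simpa using h)
  simpa using this

theorem gT_mul_g_of_gt {ω : Equiv.Perm (Fin n)} {j : SIndex n} (h : ω j.hi < ω j.lo) :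
    D.gT ω * D.g j.1 = ((q : R) - 1) • D.gT ω + (q : R) • D.gT (ω * sgen j) := by
  conv_lhs => rw [D.gT_eq_mul h, mul_assoc, D.sq j.1 j.2.1 j.2.2, mul_add, mul_smul_comm,
    mul_smul_comm, mul_one, ← D.gT_eq_mul h]

theorem op_gw (l : List (SIndex n)) : MulOpposite.unop (D.op.gw l) = D.gw l.reverse := by
  induction l with
  | nil => simp [gw]
  | cons j l ih =>
    simp only [gw, List.map_cons, List.prod_cons, MulOpposite.unop_mul, List.reverse_cons,
      List.map_append, List.prod_append] at ih ⊢
    rw [ih]; simp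

theorem op_gT (ω : Equiv.Perm (Fin n)) : MulOpposite.unop (D.op.gT ω) = D.gT ω⁻¹ := by
  obtain ⟨l, h1, h2⟩ := exists_word_length ω
  rw [← D.op.gw_eq_gT ((isReducedWord_iff l _).2 ⟨h1, h2⟩), op_gw]
  refine D.gw_eq_gT ((isReducedWord_iff _ _).2 ⟨?_, by rw [List.length_reverse, h2, permLength_inv]⟩)
  rw [← h1, List.prod_inv_reverse, List.map_map, List.map_reverse]
  congr 3

/-- `x * g_j` is a combination of the `g_ω`. -/
theorem gT_mul_g_mem (S : Submodule R T) (f : T →ₗ[R] T) (ω : Equiv.Perm (Fin n)) (j : SIndex n)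
    (h1 : f (D.gT (ω * sgen j)) ∈ S)
    (h2 : ω j.hi < ω j.lo → f (D.gT ω) ∈ S) : f (D.gT ω * D.g j.1) ∈ S := by
  rcases lo_lt_or ω j with h | h
  · rwa [← D.gT_mul_sgen h]
  · rw [D.gT_mul_g_of_gt h, map_add, map_smul, map_smul]
    exact S.add_mem (S.smul_mem _ (h2 h)) (S.smul_mem _ h1)

/-! ### Straightening -/

end QSystem

/-- The permutations `ω` such that `ω(2i-1) < ω(2i)` for `1 ≤ i ≤ k`, `ω(2i) < ω(2i+2)` for
`1 ≤ i < k`, and `ω` is increasing on `{2k+1, …, n}` (in terms of vertices `1, …, n`). -/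
structure IsSorted {n : ℕ} (k : ℕ) (ω : Equiv.Perm (Fin n)) : Prop where
  pair : ∀ x y : Fin n, x.1 % 2 = 0 → y.1 = x.1 + 1 → y.1 < 2 * k → ω x < ω y
  max : ∀ x y : Fin n, x.1 % 2 = 1 → y.1 = x.1 + 2 → y.1 < 2 * k → ω x < ω y
  rest : ∀ x y : Fin n, 2 * k ≤ x.1 → x < y → ω x < ω y

theorem lt_of_adjacent_lt {n m : ℕ} {f : Fin n → Fin n}
    (h : ∀ j : SIndex n, m < j.1 → f j.lo < f j.hi) (x y : Fin n) (hx : m ≤ x.1) (hxy : x < y) :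
    f x < f y := by
  obtain ⟨y, hy⟩ := y
  induction y with
  | zero => simp [Fin.lt_def] at hxy
  | succ y ih =>
    have h1 := h ⟨y + 1, by omega, hy⟩ (by simp only [Fin.lt_def] at hxy; dsimp only; omega)
    have h2 : f ⟨y, by omega⟩ < f ⟨y + 1, hy⟩ := h1
    rcases (show x.1 = y ∨ x.1 < y by simp only [Fin.lt_def] at hxy; omega) with h3 | h3
    · rwa [show x = ⟨y, by omega⟩ from Fin.ext h3]
    · exact (ih (by omega) h3).trans h2

namespace QSystem

variable {n : ℕ} {R : Type*} [CommRing R] {q r δ : Rˣ} {T : Type*} [Ring T] [Algebra R T]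
  (D : QSystem n q r δ T)

/-- The span of the elements `g_ω e_{(k)} g_σ` with `ω` sorted and `σ ∈ S_{2k+1,n}`. -/
def leftSpan (k : ℕ) : Submodule R T :=
  Submodule.span R {x | ∃ ω σ : Equiv.Perm (Fin n), IsSorted k ω ∧ σ ∈ permsFrom (2 * k + 1) n ∧
    x = D.gT ω * D.eK k * D.gT σ}

theorem leftSpan_mul_g {k : ℕ} {j : SIndex n} (hj : 2 * k < j.1) {x : T} (hx : x ∈ D.leftSpan k) :
    x * D.g j.1 ∈ D.leftSpan k := by
  have hs : sgen j ∈ permsFrom (2 * k + 1) n := Subgroup.subset_closure ⟨j, hj, rfl⟩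
  refine Submodule.span_induction (p := fun x _ => x * D.g j.1 ∈ D.leftSpan k) ?_ ?_ ?_ ?_ hx
  · rintro _ ⟨ω, σ, h1, h2, rfl⟩
    rw [mul_assoc]
    refine D.gT_mul_g_mem (D.leftSpan k) (LinearMap.mulLeft R (D.gT ω * D.eK k)) σ j ?_ fun _ => ?_
    · exact Submodule.subset_span ⟨ω, _, h1, mul_mem h2 hs, rfl⟩
    · exact Submodule.subset_span ⟨ω, _, h1, h2, rfl⟩
  · simp
  · intro x y _ _ hx hy
    rw [add_mul]; exact add_mem hx hy
  · intro a x _ hx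
    rw [smul_mul_assoc]; exact Submodule.smul_mem _ _ hx

/-- A violated order condition on ω is repaired by one of the three rules for e_(k). A descent
inside a pair is absorbed with a factor q, a descent beyond position 2k moves to the right of e_(k),
and a wrong order of two neighbouring pairs is changed by g_{2l+1} g_{2l} e_(k) = g_{2l-1} g_{2l}
e_(k). -/
theorem gT_mul_eK_mem (k : ℕ) (hk : 2 * k ≤ n) (ω : Equiv.Perm (Fin n)) :
    D.gT ω * D.eK k ∈ D.leftSpan k := by
  induction hm : permLength ω using Nat.strong_induction_on generalizing ω with
  | _ m ihm =>
  -- The third rule may preserve the length. Among permutations of equal length the induction goes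
  -- downwards in the lexicographic order of the value sequence.
  induction hω : toLex (ω : Fin n → Fin n) using WellFoundedGT.induction generalizing ω with
  | _ w ihw =>
  by_cases hA : ∃ j : SIndex n, j.1 % 2 = 1 ∧ j.1 < 2 * k ∧ ω j.hi < ω j.lo
  · obtain ⟨j, h1, h2, h3⟩ := hA
    obtain ⟨i, hi⟩ : ∃ i, j.1 = 2 * i + 1 := ⟨j.1 / 2, by omega⟩
    have := permLength_mul_sgen_of_gt ω j h3
    rw [D.gT_eq_mul h3, mul_assoc, hi, D.g_odd_mul_eK (by omega) hk, mul_smul_comm]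
    exact Submodule.smul_mem _ _ (ihm _ (by omega) _ rfl)
  by_cases hB : ∃ j : SIndex n, 2 * k < j.1 ∧ ω j.hi < ω j.lo
  · obtain ⟨j, h2, h3⟩ := hB
    have := permLength_mul_sgen_of_gt ω j h3
    rw [D.gT_eq_mul h3, mul_assoc, (D.commute_eK h2 j.2.2).eq, ← mul_assoc]
    exact D.leftSpan_mul_g h2 (ihm _ (by omega) _ rfl)
  push Not at hA hB
  have pair : ∀ x y : Fin n, x.1 % 2 = 0 → y.1 = x.1 + 1 → y.1 < 2 * k → ω x < ω y := by
    intro x y h1 h2 h3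
    have h4 := hA ⟨y.1, by omega, y.2⟩ (by dsimp only; omega) h3
    have e1 : SIndex.lo ⟨y.1, by omega, y.2⟩ = x := by ext; simp [SIndex.lo, h2]
    rw [e1] at h4
    exact lt_of_le_of_ne h4 fun h => by
      have := ω.injective h; rw [this] at h2; simp at h2
  by_cases hC : ∃ x y : Fin n, x.1 % 2 = 1 ∧ y.1 = x.1 + 2 ∧ y.1 < 2 * k ∧ ω y < ω x
  · obtain ⟨p1, p3, h1, h2, h3, hlt⟩ := hC
    obtain ⟨l, hl⟩ : ∃ l, p1.1 = 2 * l + 1 := ⟨p1.1 / 2, by omega⟩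
    let jA : SIndex n := ⟨2 * l + 1, by omega⟩
    let jB : SIndex n := ⟨2 * l + 2, by omega⟩
    let jC : SIndex n := ⟨2 * l + 3, by omega⟩
    have a1 : jA.hi = p1 := by ext; simp [jA, SIndex.hi, hl]
    have b0 : jB.lo = p1 := by ext; simp [jB, SIndex.lo, hl]
    have c0 : jC.lo = jB.hi := by ext; simp [jB, jC, SIndex.lo, SIndex.hi]
    have c1 : jC.hi = p3 := by ext; simp [jC, SIndex.hi, h2, hl]
    have hab : ω jA.lo < ω p1 := pair _ _ (by simp [jA, SIndex.lo]) (by simp [jA, SIndex.lo, hl])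
      (by omega)
    have hcd : ω jB.hi < ω p3 := pair _ _ (by simp [jB, SIndex.hi])
      (by simp [jB, SIndex.hi, h2, hl]) (by omega)
    have n01 : jA.lo ≠ p1 := fun h => hab.ne (congrArg ω h)
    have n02 : jA.lo ≠ jB.hi := by simp [jA, jB, SIndex.hi, SIndex.lo, Fin.ext_iff]
    have n03 : jA.lo ≠ p3 := by simp [jA, SIndex.lo, Fin.ext_iff]; omega
    have n12 : p1 ≠ jB.hi := by simp [jB, SIndex.hi, Fin.ext_iff]; omega
    have n13 : p1 ≠ p3 := fun h => hlt.ne' (congrArg ω h)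
    have n23 : jB.hi ≠ p3 := fun h => hcd.ne (congrArg ω h)
    have sA0 : sgen jA jA.lo = p1 := by rw [sgen_lo, a1]
    have sA1 : sgen jA p1 = jA.lo := by rw [← a1, sgen_hi]
    have sA2 : sgen jA jB.hi = jB.hi := sgen_apply_of_ne _ n02.symm (by rw [a1]; exact n12.symm)
    have sB0 : sgen jB jA.lo = jA.lo := sgen_apply_of_ne _ (by rw [b0]; exact n01) n02
    have sB1 : sgen jB p1 = jB.hi := by rw [← b0, sgen_lo]
    have sB2 : sgen jB jB.hi = p1 := by rw [sgen_hi, b0]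
    have sB3 : sgen jB p3 = p3 := sgen_apply_of_ne _ (by rw [b0]; exact n13.symm) n23.symm
    have sC0 : sgen jC jA.lo = jA.lo := sgen_apply_of_ne _ (by rw [c0]; exact n02)
      (by rw [c1]; exact n03)
    have sC1 : sgen jC p1 = p1 := sgen_apply_of_ne _ (by rw [c0]; exact n12) (by rw [c1]; exact n13)
    have sC2 : sgen jC jB.hi = p3 := by rw [← c0, sgen_lo, c1]
    have dB : ω jB.hi < ω jB.lo := by rw [b0]; exact hcd.trans hlt
    have dC : (ω * sgen jB) jC.hi < (ω * sgen jB) jC.lo := by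
      simpa only [Equiv.Perm.mul_apply, c1, c0, sB3, sB2]
    have lB := permLength_mul_sgen_of_gt _ _ dB
    have lC := permLength_mul_sgen_of_gt _ _ dC
    -- Four consecutive positions carry values a < b and c < d with d < b. So ω has a reduced word
    -- ending in s_C s_B, and in front of e_(k) this ending turns into s_A s_B.
    have e1 : D.gT ω * D.eK k =
        D.gT (ω * sgen jB * sgen jC) * D.g jA.1 * (D.g jB.1 * D.eK k) := by
      rw [D.gT_eq_mul dB, D.gT_eq_mul dC]
      have := D.g_even_mul_eK (k := k) (l := l + 1) (by omega) (by omega) hk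
      rw [show 2 * (l + 1) + 1 = jC.1 from by simp only [jC]; ring,
        show 2 * (l + 1) - 1 = jA.1 from by simp only [jA]; omega,
        show 2 * (l + 1) = jB.1 from by simp only [jB]; ring] at this
      simp only [mul_assoc, this]
    set ω'' := ω * sgen jB * sgen jC with hω''
    have v0 : ω'' jA.lo = ω jA.lo := by simp only [hω'', Equiv.Perm.mul_apply, sC0, sB0]
    have v1 : ω'' p1 = ω jB.hi := by simp only [hω'', Equiv.Perm.mul_apply, sC1, sB1]
    have v2 : ω'' jB.hi = ω p3 := by simp only [hω'', Equiv.Perm.mul_apply, sC2, sB3]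
    -- If a < c, both new letters lengthen: the result has the length of ω but value c instead of a
    -- at the first of the four positions, so it is lexicographically larger. If c < a, the letter
    -- s_A shortens and all terms are shorter than ω.
    rcases lt_or_gt_of_ne (fun h => n02 (ω.injective h)) with hac | hca
    · have aA : ω'' jA.lo < ω'' jA.hi := by rw [a1, v0, v1]; exact hac
      have aB : (ω'' * sgen jA) jB.lo < (ω'' * sgen jA) jB.hi := by
        simp only [b0, Equiv.Perm.mul_apply, sA1, sA2, v0, v2]
        exact hac.trans hcd
      have lA' := permLength_mul_sgen _ _ aA
      have lB' := permLength_mul_sgen _ _ aB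
      rw [e1, ← D.gT_mul_sgen aA, ← mul_assoc, ← D.gT_mul_sgen aB]
      refine ihw _ ?_ _ (by omega) rfl
      rw [← hω]
      refine ⟨jA.lo, fun x hx => ?_, ?_⟩
      · have fixed : ∀ j : SIndex n, 2 * l + 1 ≤ j.1 → sgen j x = x := by
          intro j hj
          have : x.1 < 2 * l := by simpa [jA, SIndex.lo, Fin.lt_def] using hx
          refine sgen_apply_of_ne _ ?_ ?_ <;> simp only [SIndex.lo, SIndex.hi, ne_eq, Fin.ext_iff] <;>
            omega
        have fA := fixed jA le_rfl
        have fB := fixed jB (by simp [jB])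
        have fC := fixed jC (by simp [jC])
        simp only [Pi.toLex_apply, hω'', Equiv.Perm.mul_apply, fA, fB, fC]
      · simp only [Pi.toLex_apply, Equiv.Perm.mul_apply, sB0, sA0, v1]
        exact hac
    · have dA : ω'' jA.hi < ω'' jA.lo := by rw [a1, v0, v1]; exact hca
      have lA' := permLength_mul_sgen_of_gt _ _ dA
      have low : ∀ α : Equiv.Perm (Fin n), permLength α ≤ permLength ω'' →
          D.gT α * (D.g jB.1 * D.eK k) ∈ D.leftSpan k := by
        intro α hα
        have := permLength_mul_sgen_le α jB
        rw [← mul_assoc]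
        exact D.gT_mul_g_mem (D.leftSpan k) (LinearMap.mulRight R (D.eK k)) α jB
          (ihm _ (by omega) _ rfl) fun _ => ihm _ (by omega) _ rfl
      rw [e1, D.gT_mul_g_of_gt dA, add_mul, smul_mul_assoc, smul_mul_assoc]
      exact add_mem (Submodule.smul_mem _ _ (low _ le_rfl))
        (Submodule.smul_mem _ _ (low _ (by omega)))
  push Not at hC
  refine Submodule.subset_span ⟨ω, 1, ⟨pair, fun x y h1 h2 h3 => ?_, fun x y h1 h2 => ?_⟩,
    one_mem _, by rw [D.gT_one, mul_one]⟩
  · refine lt_of_le_of_ne (hC x y h1 h2 h3) fun h => ?_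
    have := ω.injective h; rw [this] at h2; omega
  · exact lt_of_adjacent_lt (fun j hj => (lo_lt_or ω j).resolve_right (hB j hj).not_gt) x y h1 h2

end QSystem

/-! ### The subgroups `S_{m,n}` -/

/-- Vertices are numbered from 0, so s_j with j ≥ m moves no vertex below m - 1. -/
theorem fixed_of_mem_permsFrom {n m : ℕ} {σ : Equiv.Perm (Fin n)} (h : σ ∈ permsFrom m n)
    {x : Fin n} (hx : x.1 + 1 < m) : σ x = x := by
  induction h using Subgroup.closure_induction with
  | mem σ hσ =>
    obtain ⟨j, hj, rfl⟩ := hσ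
    refine sgen_apply_of_ne _ ?_ ?_ <;> simp only [ne_eq, Fin.ext_iff, SIndex.lo, SIndex.hi] <;> omega
  | one => rfl
  | mul α β _ _ hα hβ => rw [Equiv.Perm.mul_apply, hβ, hα]
  | inv α _ hα => rw [Equiv.Perm.inv_eq_iff_eq, hα]

theorem exists_descent_of_fixed {n m : ℕ} {σ : Equiv.Perm (Fin n)} (h1 : σ ≠ 1)
    (h : ∀ {x : Fin n}, x.1 + 1 < m → σ x = x) :
    ∃ j : SIndex n, m ≤ j.1 ∧ σ j.hi < σ j.lo := by
  obtain ⟨j, hj⟩ := exists_descent h1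
  refine ⟨j, ?_, hj⟩
  by_contra hlt
  have h2 : σ j.lo = j.lo := h (by have := j.2; simp only [SIndex.lo]; omega)
  rw [h2] at hj
  have h3 : σ (σ j.hi) = σ j.hi := h (by
    have := j.2; simp only [SIndex.lo, Fin.lt_def] at hj; omega)
  rw [σ.injective h3] at hj
  exact lt_asymm hj j.lo_lt_hi

/-- A permutation that fixes the first vertices has descents only at indices at least m, so removing
descents one at a time stays inside the subgroup. -/
theorem mem_permsFrom {n m : ℕ} {σ : Equiv.Perm (Fin n)}
    (h : ∀ {x : Fin n}, x.1 + 1 < m → σ x = x) : σ ∈ permsFrom m n := by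
  induction hl : permLength σ using Nat.strong_induction_on generalizing σ with
  | _ l ih =>
  by_cases h1 : σ = 1
  · rw [h1]; exact one_mem _
  · obtain ⟨j, hj, hj'⟩ := exists_descent_of_fixed h1 h
    have hs : sgen j ∈ permsFrom m n := Subgroup.subset_closure ⟨j, hj, rfl⟩
    have := permLength_mul_sgen_of_gt σ j hj'
    have h2 := ih _ (by omega) (σ := σ * sgen j) (fun {x} hx => by
      rw [Equiv.Perm.mul_apply, fixed_of_mem_permsFrom hs hx, h hx]) rfl
    simpa using mul_mem h2 hs

/-! ### The sum of the H_n e_(k) H_n -/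

namespace QSystem

variable {n : ℕ} {R : Type*} [CommRing R] {q r δ : Rˣ} {T : Type*} [Ring T] [Algebra R T]
  (D : QSystem n q r δ T)

/-- Straightening on the right is straightening on the left in the opposite algebra, where e_(k) is
unchanged and ω is inverted. -/
theorem eK_mul_gT_mem (k : ℕ) (hk : 2 * k ≤ n) (ω : Equiv.Perm (Fin n)) :
    D.eK k * D.gT ω ∈ Submodule.span R {x | ∃ α σ : Equiv.Perm (Fin n), IsSorted k α⁻¹ ∧
      σ ∈ permsFrom (2 * k + 1) n ∧ x = D.gT σ * D.eK k * D.gT α} := by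
  have h := Submodule.mem_map_of_mem (f := (MulOpposite.opLinearEquiv R (M := T)).symm.toLinearMap)
    (D.op.gT_mul_eK_mem k hk ω⁻¹)
  rw [leftSpan, Submodule.map_span] at h
  have e : (MulOpposite.opLinearEquiv R (M := T)).symm.toLinearMap
      (D.op.gT ω⁻¹ * D.op.eK k) = D.eK k * D.gT ω := by
    have h1 := D.op_gT ω⁻¹
    have h2 := D.unop_eK_op hk
    rw [inv_inv] at h1
    rw [← h1, ← h2]
    rfl
  rw [e] at h
  refine Submodule.span_mono ?_ h
  rintro _ ⟨_, ⟨α, σ, h1, h2, rfl⟩, rfl⟩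
  refine ⟨α⁻¹, σ⁻¹, by rwa [inv_inv], inv_mem h2, ?_⟩
  rw [← D.op_gT, ← D.op_gT, ← D.unop_eK_op hk, mul_assoc]
  rfl

/-- The sum of the `H_n e_{(k)} H_n`. -/
def twoSided : Submodule R T :=
  Submodule.span R {x | ∃ (k : ℕ) (α β : Equiv.Perm (Fin n)), 2 * k ≤ n ∧
    x = D.gT α * D.eK k * D.gT β}

theorem twoSided_mul_g {j : ℕ} (h1 : 1 ≤ j) (h2 : j < n) {x : T} (hx : x ∈ D.twoSided) :
    x * D.g j ∈ D.twoSided := by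
  refine Submodule.span_induction (p := fun x _ => x * D.g j ∈ D.twoSided) ?_ ?_ ?_ ?_ hx
  · rintro _ ⟨k, α, β, hk, rfl⟩
    rw [mul_assoc]
    refine D.gT_mul_g_mem D.twoSided (LinearMap.mulLeft R (D.gT α * D.eK k)) β ⟨j, h1, h2⟩ ?_
      fun _ => ?_
    · exact Submodule.subset_span ⟨k, α, _, hk, rfl⟩
    · exact Submodule.subset_span ⟨k, α, _, hk, rfl⟩
  · simp
  · intro x y _ _ hx hy
    rw [add_mul]; exact add_mem hx hy
  · intro a x _ hx
    rw [smul_mul_assoc]; exact Submodule.smul_mem _ _ hx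

theorem twoSided_op {x : T} (hx : x ∈ D.twoSided) : MulOpposite.op x ∈ D.op.twoSided := by
  refine Submodule.span_induction (p := fun x _ => MulOpposite.op x ∈ D.op.twoSided) ?_ ?_ ?_ ?_ hx
  · rintro _ ⟨k, α, β, hk, rfl⟩
    refine Submodule.subset_span ⟨k, β⁻¹, α⁻¹, hk, ?_⟩
    apply MulOpposite.unop_injective
    simp [op_gT, D.unop_eK_op hk, mul_assoc]
  · simp
  · intro x y _ _ hx hy
    rw [MulOpposite.op_add]; exact add_mem hx hy
  · intro a x _ hx
    rw [MulOpposite.op_smul]; exact Submodule.smul_mem _ _ hx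

theorem twoSided_unop {x : Tᵐᵒᵖ} (hx : x ∈ D.op.twoSided) : MulOpposite.unop x ∈ D.twoSided := by
  refine Submodule.span_induction (p := fun x _ => MulOpposite.unop x ∈ D.twoSided) ?_ ?_ ?_ ?_ hx
  · rintro _ ⟨k, α, β, hk, rfl⟩
    refine Submodule.subset_span ⟨k, β⁻¹, α⁻¹, hk, ?_⟩
    simp [op_gT, D.unop_eK_op hk, mul_assoc]
  · simp
  · intro x y _ _ hx hy
    rw [MulOpposite.unop_add]; exact add_mem hx hy
  · intro a x _ hx
    rw [MulOpposite.unop_smul]; exact Submodule.smul_mem _ _ hx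

theorem g_mul_twoSided {j : ℕ} (h1 : 1 ≤ j) (h2 : j < n) {x : T} (hx : x ∈ D.twoSided) :
    D.g j * x ∈ D.twoSided :=
  D.twoSided_unop (D.op.twoSided_mul_g h1 h2 (D.twoSided_op hx))

theorem eK_mem_twoSided {k : ℕ} (hk : 2 * k ≤ n) : D.eK k ∈ D.twoSided :=
  Submodule.subset_span ⟨k, 1, 1, hk, by simp [gT_one]⟩

/-! ### Words -/

/-- `x` is the product of at most `m` letters `g_j` with `a ≤ j < n`. -/
def IsWord (a m : ℕ) (x : T) : Prop :=
  ∃ l : List ℕ, l.length ≤ m ∧ (∀ j ∈ l, a ≤ j ∧ j < n) ∧ x = (l.map D.g).prod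

variable {D}

theorem IsWord.one (a m : ℕ) : D.IsWord a m 1 := ⟨[], by simp, by simp, by simp⟩

theorem IsWord.mul {a m m' : ℕ} {x y : T} (hx : D.IsWord a m x) (hy : D.IsWord a m' y) :
    D.IsWord a (m + m') (x * y) := by
  obtain ⟨l, h1, h2, rfl⟩ := hx
  obtain ⟨l', h1', h2', rfl⟩ := hy
  refine ⟨l ++ l', by rw [List.length_append]; omega, fun j hj => ?_, by simp⟩
  rcases List.mem_append.1 hj with h | h
  · exact h2 j h
  · exact h2' j h

theorem IsWord.mono {a a' m m' : ℕ} {x : T} (hx : D.IsWord a m x) (ha : a' ≤ a) (hm : m ≤ m') :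
    D.IsWord a' m' x := by
  obtain ⟨l, h1, h2, rfl⟩ := hx
  exact ⟨l, by omega, fun j hj => ⟨ha.trans (h2 j hj).1, (h2 j hj).2⟩, rfl⟩

theorem IsWord.g {a j : ℕ} (h1 : a ≤ j) (h2 : j < n) : D.IsWord a 1 (D.g j) :=
  ⟨[j], by simp, by simpa using ⟨h1, h2⟩, by simp⟩

theorem IsWord.ascProd {a b c : ℕ} (h : a ≤ b) (hc : c < n) :
    D.IsWord a (c + 1 - b) (QBrauer.ascProd D.g b c) := by
  refine ⟨ascList b c, by simp [ascList], fun j hj => ?_, rfl⟩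
  rw [ascList, List.mem_range'_1] at hj
  omega

variable (D)

/-- Words in letters `≥ a` are combinations of words `u g_a g_{a+1} ⋯ g_b`, with `u` a word in
letters `> a`. -/
theorem isWord_mem_span {a m : ℕ} (ha : 1 ≤ a) {x : T} (hx : D.IsWord a m x) :
    x ∈ Submodule.span R {y | ∃ u b m', D.IsWord (a + 1) m' u ∧ a ≤ b + 1 ∧ (a ≤ b → b < n) ∧
      m' + (b + 1 - a) ≤ m ∧ y = u * ascProd D.g a b} := by
  obtain ⟨l, h1, h2, rfl⟩ := hx
  induction l using List.reverseRecOn generalizing m with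
  | nil =>
    -- The value b = a - 1 encodes the empty product.
    refine Submodule.subset_span ⟨1, a - 1, 0, IsWord.one _ _, by omega, by omega, by omega, ?_⟩
    rw [ascProd_of_lt _ (by omega)]; simp
  | append_singleton l j ih =>
    rw [List.length_append, List.length_singleton] at h1
    obtain ⟨m, rfl⟩ : ∃ m', m = m' + 1 := ⟨m - 1, by omega⟩
    obtain ⟨hj1, hj2⟩ := h2 j (by simp)
    have hl := ih (m := m) (by omega) fun i hi => h2 i (by simp [hi])
    rw [List.map_append, List.prod_append, List.map_singleton, List.prod_singleton]
    set S := Submodule.span R {y | ∃ u b m', D.IsWord (a + 1) m' u ∧ a ≤ b + 1 ∧ (a ≤ b → b < n) ∧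
      m' + (b + 1 - a) ≤ m + 1 ∧ y = u * ascProd D.g a b} with hS
    refine Submodule.span_induction (p := fun x _ => x * D.g j ∈ S) ?_ ?_ ?_ ?_ hl
    · rintro _ ⟨u, b, m', hu, hab, hbn, hm, rfl⟩
      -- A further letter j below b passes through as j + 1, j = b is resolved by the quadratic
      -- relation, j = b + 1 extends the product, and a larger j commutes with it.
      rcases lt_trichotomy j (b + 1) with hlt | rfl | hgt
      · rcases Nat.lt_succ_iff_lt_or_eq.1 hlt with hlt' | rfl
        · rw [mul_assoc, ← D.g_mul_up ha hj1 hlt' (hbn (by omega)), ← mul_assoc]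
          exact Submodule.subset_span ⟨_, b, m' + 1,
            hu.mul (IsWord.g (by omega) (by omega)), hab, hbn, by omega, rfl⟩
        · obtain ⟨i, rfl⟩ : ∃ i, j = i + 1 := ⟨j - 1, by omega⟩
          rw [ascProd_right _ hj1, mul_assoc, mul_assoc, D.sq _ (by omega) hj2, mul_add, mul_add,
            mul_smul_comm, mul_smul_comm, mul_smul_comm, mul_smul_comm, mul_one,
            ← ascProd_right _ hj1]
          refine add_mem (Submodule.smul_mem _ _ (Submodule.subset_span
            ⟨u, i + 1, m', hu, hab, hbn, by omega, rfl⟩)) (Submodule.smul_mem _ _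
              (Submodule.subset_span ⟨u, i, m', hu, hj1, by omega, by omega, rfl⟩))
      · rw [mul_assoc, ← ascProd_right _ hab]
        exact Submodule.subset_span ⟨u, b + 1, m', hu, by omega, fun _ => hj2, by omega, rfl⟩
      · have c : Commute (D.g j) (ascProd D.g a b) := by
          rcases Nat.lt_or_ge b a with h | h
          · rw [ascProd_of_lt _ h]; exact Commute.one_right _
          · exact D.commute_up ha (by omega) hj2 (hbn h) (by omega)
        rw [mul_assoc, ← c.eq, ← mul_assoc]
        exact Submodule.subset_span ⟨_, b, m' + 1, hu.mul (IsWord.g (by omega) hj2), hab, hbn,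
          by omega, rfl⟩
    · simp
    · intro x y _ _ hx hy
      rw [add_mul]; exact add_mem hx hy
    · intro a x _ hx
      rw [smul_mul_assoc]; exact Submodule.smul_mem _ _ hx

/-- Each letter of the first product slides through the second one and loses one from its index. -/
theorem up_mul_up {a b c : ℕ} (ha : 1 ≤ a) (hab : a ≤ b + 1) (hb : b < c) (hc : c < n) :
    ascProd D.g (a + 1) (b + 1) * ascProd D.g a c = ascProd D.g a c * ascProd D.g a b := by
  induction b with
  | zero =>
    obtain rfl : a = 1 := by omega
    rw [ascProd_of_lt D.g (a := 1 + 1) (by omega), ascProd_of_lt D.g (a := 1) (b := 0) (by omega),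
      one_mul, mul_one]
  | succ b ih =>
    rcases (show a = b + 1 + 1 ∨ a ≤ b + 1 by omega) with h | h
    · rw [ascProd_of_lt _ (by omega), ascProd_of_lt D.g (b := b + 1) (by omega), one_mul, mul_one]
    · rw [ascProd_right _ (by omega), mul_assoc, D.g_mul_up ha h hb hc, ← mul_assoc,
        ih h (by omega), mul_assoc, ← ascProd_right _ h]

/-- `g_1⁻¹ ⋯ g_c⁻¹` is a multiple of `g_1 ⋯ g_c`, up to shorter words. -/
theorem down_eq (c : ℕ) (hc : c < n) : ∃ y ∈ Submodule.span R {y | ∃ m, m < c ∧ D.IsWord 1 m y},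
    ascProd D.h 1 c = ((↑q⁻¹ : R) ^ c) • ascProd D.g 1 c + y := by
  induction c with
  | zero => exact ⟨0, zero_mem _, by rw [ascProd_of_lt _ (by omega), ascProd_of_lt _ (by omega)]; simp⟩
  | succ c ih =>
    obtain ⟨y, hy, h⟩ := ih (by omega)
    refine ⟨((↑q⁻¹ : R) ^ c * ((↑q⁻¹ : R) - 1)) • ascProd D.g 1 c +
      ((↑q⁻¹ : R) • (y * D.g (c + 1)) + ((↑q⁻¹ : R) - 1) • y), ?_, ?_⟩
    · have hy' : y * D.g (c + 1) ∈ Submodule.span R {y | ∃ m, m < c + 1 ∧ D.IsWord 1 m y} := by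
        refine Submodule.span_induction (p := fun y _ => y * D.g (c + 1) ∈
          Submodule.span R {y | ∃ m, m < c + 1 ∧ D.IsWord 1 m y}) ?_ ?_ ?_ ?_ hy
        · rintro x ⟨m, hm, hx⟩
          exact Submodule.subset_span ⟨m + 1, by omega, hx.mul (IsWord.g (by omega) hc)⟩
        · simp
        · intro x y _ _ hx hy
          rw [add_mul]; exact add_mem hx hy
        · intro a x _ hx
          rw [smul_mul_assoc]; exact Submodule.smul_mem _ _ hx
      refine add_mem (Submodule.smul_mem _ _ (Submodule.subset_span
        ⟨c, by omega, (IsWord.ascProd le_rfl (by omega)).mono le_rfl (by omega)⟩))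
        (add_mem (Submodule.smul_mem _ _ hy') (Submodule.smul_mem _ _ ?_))
      refine Submodule.span_mono ?_ hy
      rintro x ⟨m, hm, hx⟩
      exact ⟨m, by omega, hx⟩
    · rw [ascProd_right D.h (by omega), h, ascProd_right D.g (by omega), D.h_def (c + 1)]
      simp only [mul_add, add_mul, mul_smul_comm, smul_mul_assoc, mul_one, smul_smul, smul_add,
        pow_succ]
      rw [mul_comm (↑q⁻¹ : R) (_ ^ c), mul_comm ((↑q⁻¹ : R) - 1)]
      abel

theorem word_mul_twoSided {a m : ℕ} (ha : 1 ≤ a) {u x : T} (hu : D.IsWord a m u)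
    (hx : x ∈ D.twoSided) : u * x ∈ D.twoSided := by
  obtain ⟨l, -, h2, rfl⟩ := hu
  induction l with
  | nil => simpa
  | cons j l ih =>
    rw [List.map_cons, List.prod_cons, mul_assoc]
    exact D.g_mul_twoSided (by have := (h2 j (by simp)).1; omega) (h2 j (by simp)).2
      (ih fun i hi => h2 i (by simp [hi]))

/-- The product of `e`, a word of the form `g_2 ⋯ g_b g_1 ⋯ g_c` and `e_{(k)}`. -/
theorem e_mul_up_mul_up_mem {k b c : ℕ} (hk : 2 * k ≤ n) (hb : 1 ≤ b) (hbn : b < n) (hcn : c < n)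
    (ih : ∀ m x, m < b - 1 + c → D.IsWord 1 m x → D.e * (x * D.eK k) ∈ D.twoSided) :
    D.e * (ascProd D.g 2 b * ascProd D.g 1 c * D.eK k) ∈ D.twoSided := by
  -- A last letter that e_(k) absorbs, or that commutes with e_(k), leaves a shorter word to be
  -- treated.
  have absorb : ∀ m x j, m + 1 ≤ b - 1 + c → D.IsWord 1 m x → 1 ≤ j → j < n →
      (j % 2 = 1 ∧ j < 2 * k ∨ 2 * k < j) → D.e * (x * D.g j * D.eK k) ∈ D.twoSided := by
    rintro m x j h1 h2 h3 h3' (⟨h4, h5⟩ | h4)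
    · obtain ⟨i, rfl⟩ : ∃ i, j = 2 * i + 1 := ⟨j / 2, by omega⟩
      rw [mul_assoc x, D.g_odd_mul_eK (by omega) hk, mul_smul_comm, mul_smul_comm]
      exact Submodule.smul_mem _ _ (ih m x (by omega) h2)
    · rw [mul_assoc x, (D.commute_eK h4 h3').eq, ← mul_assoc x, ← mul_assoc]
      exact D.twoSided_mul_g h3 h3' (ih m x (by omega) h2)
  rcases Nat.lt_or_ge c b with hcb | hbc
  swap
  · -- the product starts with `g_1`
    obtain ⟨b', rfl⟩ : ∃ b', b = b' + 1 := ⟨b - 1, by omega⟩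
    rw [D.up_mul_up le_rfl (by omega) (by omega) hcn, ascProd_left D.g (a := 1) (b := c) (by omega),
      mul_assoc, mul_assoc, ← mul_assoc, D.e_g_one (by omega), smul_mul_assoc]
    refine Submodule.smul_mem _ _ ?_
    rw [← mul_assoc (ascProd _ _ _)]
    exact ih (c - 1 + b') _ (by omega) (((IsWord.ascProd (b := 1 + 1) (by omega) hcn).mul
      (IsWord.ascProd le_rfl (by omega))).mono le_rfl (by omega))
  by_cases h1 : 0 < c ∧ (c % 2 = 1 ∧ c < 2 * k ∨ 2 * k < c)
  · obtain ⟨c', rfl⟩ : ∃ c', c = c' + 1 := ⟨c - 1, by omega⟩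
    rw [ascProd_right D.g (a := 1) (by omega), ← mul_assoc (ascProd _ _ _)]
    exact absorb (b - 1 + c') _ _ (by omega) (((IsWord.ascProd (b := 2) (by omega) hbn).mul
      (IsWord.ascProd le_rfl (by omega))).mono le_rfl (by omega)) (by omega) hcn h1.2
  -- When b > c + 1, the letter g_b commutes with g_1 ⋯ g_c and can be brought next to e_(k).
  by_cases h2 : c + 1 < b ∧ (b % 2 = 1 ∧ b < 2 * k ∨ 2 * k < b)
  · obtain ⟨b', rfl⟩ : ∃ b', b = b' + 1 := ⟨b - 1, by omega⟩
    have cm := D.commute_up (i := b' + 1) (a := 1) (b := c) le_rfl (by omega) hbn hcn (by omega)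
    rw [ascProd_right D.g (a := 2) (by omega), mul_assoc (ascProd _ _ _), cm.eq,
      ← mul_assoc (ascProd D.g 2 b')]
    have w : D.IsWord 1 (b' + 1 - 2 + (c + 1 - 1)) (ascProd D.g 2 b' * ascProd D.g 1 c) :=
      (IsWord.ascProd (by omega) (by omega)).mul (IsWord.ascProd le_rfl hcn)
    exact absorb _ _ _ (by omega) w (by omega) hbn h2.2
  by_cases h3 : c = 2 * k ∧ b = 2 * k + 1
  · -- the element `e_{(k+1)}` appears
    obtain ⟨rfl, rfl⟩ := h3
    obtain ⟨y, hy, e1⟩ := D.down_eq (2 * k) (by omega)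
    have e2 : ascProd D.g 1 (2 * k) = ((q : R) ^ (2 * k)) • (ascProd D.h 1 (2 * k) - y) := by
      rw [e1, add_sub_cancel_right, smul_smul, ← mul_pow, q.mul_inv, one_pow, one_smul]
    have e3 : D.e * (ascProd D.g 2 (2 * k + 1) * y * D.eK k) ∈ D.twoSided := by
      refine Submodule.span_induction (p := fun y _ =>
        D.e * (ascProd D.g 2 (2 * k + 1) * y * D.eK k) ∈ D.twoSided) ?_ ?_ ?_ ?_ hy
      · rintro x ⟨m, hm, hx⟩
        exact ih (2 * k + m) _ (by omega)
          (((IsWord.ascProd (b := 2) (by omega) hbn).mul hx).mono le_rfl (by omega))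
      · simp
      · intro x y _ _ hx hy
        rw [mul_add, add_mul, mul_add]; exact add_mem hx hy
      · intro a x _ hx
        rw [mul_smul_comm, smul_mul_assoc, mul_smul_comm]; exact Submodule.smul_mem _ _ hx
    have e4 : D.e * (ascProd D.g 2 (2 * k + 1) * ascProd D.h 1 (2 * k) * D.eK k) =
        D.eK (k + 1) := by
      rw [eK_succ, W]; simp only [mul_assoc]
    rw [e2, mul_smul_comm, smul_mul_assoc, mul_smul_comm, mul_sub, sub_mul, mul_sub, e4]
    exact Submodule.smul_mem _ _ (sub_mem (D.eK_mem_twoSided (by omega)) e3)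
  -- From here on k ≥ 1: for k = 0 the cases already excluded cover everything.
  rcases Nat.eq_zero_or_pos c with h4 | h4
  · subst h4
    rw [ascProd_of_lt D.g (b := 0) (by omega), mul_one]
    rcases (show b = 1 ∨ 2 ≤ b by omega) with rfl | h5
    · rw [ascProd_of_lt D.g (by omega), one_mul, D.e_mul_eK (by omega)]
      exact Submodule.smul_mem _ _ (D.eK_mem_twoSided hk)
    · rw [D.e_up_eK (by omega) h5 hbn]
      exact Submodule.smul_mem _ _ (D.word_mul_twoSided (a := 3) (by omega)
        (IsWord.ascProd le_rfl hbn) (D.eK_mem_twoSided hk))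
  -- Only even c with 0 < c < 2k and c < b remain: the value c = 2k would force b = 2k + 1 or a
  -- letter g_b that commutes with e_(k).
  obtain ⟨l, rfl⟩ : ∃ l, c = 2 * l + 1 + 1 := ⟨c / 2 - 1, by omega⟩
  have cl : Commute (D.g (2 * l + 3)) (ascProd D.g 1 (2 * l)) :=
    D.commute_up le_rfl (by omega) (by omega) (by omega) (by omega)
  have e1 := D.g_even_mul_eK (k := k) (l := l + 1) (by omega) (by omega) hk
  rw [show 2 * (l + 1) + 1 = 2 * l + 3 by ring, show 2 * (l + 1) - 1 = 2 * l + 1 by omega,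
    show 2 * (l + 1) = 2 * l + 2 by ring] at e1
  -- For b = c + 1 the last letter g_{2l+3} of the first product reaches g_{2l+1} g_{2l+2} e_(k);
  -- there it acts as g_{2l+1}, and the quadratic relation shortens the word.
  rcases (show b = 2 * l + 2 + 1 ∨ 2 * l + 3 < b by omega) with rfl | h5
  · have e2 : D.g (2 * l + 3) * (D.g (2 * l + 1) * (D.g (2 * l + 2) * D.eK k)) =
        ((q : R) - 1) • (D.g (2 * l + 1) * (D.g (2 * l + 2) * D.eK k)) +
          (q : R) • (D.g (2 * l + 2) * D.eK k) := by
      rw [← mul_assoc, (D.commute_g (by omega) (by omega) hbn (by omega) (by omega)).eq, mul_assoc,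
        e1, ← mul_assoc, D.sq _ (by omega) (by omega), add_mul, smul_mul_assoc, smul_mul_assoc,
        one_mul]
    have e3 : ascProd D.g 2 (2 * l + 2 + 1) * ascProd D.g 1 (2 * l + 1 + 1) * D.eK k =
        ((q : R) - 1) • (ascProd D.g 2 (2 * l + 2) * ascProd D.g 1 (2 * l) *
          (D.g (2 * l + 1) * D.g (2 * l + 2)) * D.eK k) +
        (q : R) • (ascProd D.g 2 (2 * l + 2) * ascProd D.g 1 (2 * l) *
          D.g (2 * l + 2) * D.eK k) := by
      rw [ascProd_right D.g (a := 2) (by omega), ascProd_right D.g (a := 1) (by omega),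
        ascProd_right D.g (a := 1) (by omega)]
      simp only [mul_assoc]
      rw [cl.left_comm, e2]
      simp only [mul_add, mul_smul_comm]
    rw [e3, mul_add, mul_smul_comm, mul_smul_comm]
    have w0 : D.IsWord 1 (2 * l + 1 + 2 * l) (ascProd D.g 2 (2 * l + 2) * ascProd D.g 1 (2 * l)) :=
      ((IsWord.ascProd (b := 2) (by omega) (by omega)).mul
        (IsWord.ascProd le_rfl (by omega))).mono le_rfl (by omega)
    have w1 : D.IsWord 1 1 (D.g (2 * l + 1)) := IsWord.g (by omega) (by omega)
    have w2 : D.IsWord 1 1 (D.g (2 * l + 2)) := IsWord.g (by omega) (by omega)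
    exact add_mem (Submodule.smul_mem _ _ (ih _ _ (by omega) (w0.mul (w1.mul w2))))
      (Submodule.smul_mem _ _ (ih _ _ (by omega) (w0.mul w2)))
  -- For b > c + 1, g_{2l+1} is replaced by g_{2l+3}, which passes through g_2 ⋯ g_b as g_{2l+4} and
  -- then commutes with e.
  · have e3 : D.e * (ascProd D.g 2 b * ascProd D.g 1 (2 * l + 1 + 1) * D.eK k) =
        D.g (2 * l + 4) * (D.e * (ascProd D.g 2 b * ascProd D.g 1 (2 * l) * D.g (2 * l + 2) *
          D.eK k)) := by
      rw [ascProd_right D.g (a := 1) (by omega), ascProd_right D.g (a := 1) (by omega)]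
      simp only [mul_assoc]
      rw [← e1, ← cl.left_comm, ← mul_assoc (ascProd D.g 2 b), ← D.g_mul_up (by omega) (by omega) h5 hbn,
        mul_assoc, ← mul_assoc D.e, D.e_comm _ (by omega) (by omega)]
      simp only [mul_assoc]
    rw [e3]
    refine D.g_mul_twoSided (by omega) (by omega) (ih (b - 1 + (2 * l) + 1) _ (by omega) ?_)
    exact ((((IsWord.ascProd (b := 2) (by omega) hbn).mul
        (IsWord.ascProd le_rfl (by omega))).mul (IsWord.g (by omega) (by omega)))).mono le_rfl
          (by omega)

/-- Two applications of `isWord_mem_span` write x through products v (g_2 ⋯ g_b)(g_1 ⋯ g_c) with v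
in letters of index at least 3. Such v commutes with e, so only the case of `e_mul_up_mul_up_mem` is
left. -/
theorem e_mul_word_mem {k m : ℕ} (hk : 2 * k ≤ n) (hn : 2 ≤ n) {x : T} (hx : D.IsWord 1 m x) :
    D.e * (x * D.eK k) ∈ D.twoSided := by
  induction m using Nat.strong_induction_on generalizing x with
  | _ m ih =>
  refine Submodule.span_induction (p := fun x _ => D.e * (x * D.eK k) ∈ D.twoSided) ?_ ?_ ?_ ?_
    (D.isWord_mem_span le_rfl hx)
  · rintro _ ⟨u, c, m', hu, -, hc, hm, rfl⟩
    refine Submodule.span_induction (p := fun u _ =>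
      D.e * (u * ascProd D.g 1 c * D.eK k) ∈ D.twoSided) ?_ ?_ ?_ ?_
      (D.isWord_mem_span (by omega) hu)
    · rintro _ ⟨v, b, m'', hv, hb1, hb, hm', rfl⟩
      have cv : D.e * v = v * D.e := by
        obtain ⟨l, -, h2, rfl⟩ := hv
        refine Commute.list_prod_right _ _ fun y hy => ?_
        obtain ⟨j, hj, rfl⟩ := List.mem_map.1 hy
        exact (D.commute_e (by have := (h2 j hj).1; omega) (h2 j hj).2).symm
      rw [mul_assoc v, mul_assoc v, ← mul_assoc, cv, mul_assoc]
      refine D.word_mul_twoSided (by omega) hv ?_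
      refine D.e_mul_up_mul_up_mem hk (by omega) ?_ ?_ fun m x h hx => ih m (by omega) hx
      · by_cases h : 2 ≤ b
        · exact hb h
        · omega
      · by_cases h : 1 ≤ c
        · exact hc h
        · omega
    · simp
    · intro x y _ _ hx hy
      rw [add_mul, add_mul, mul_add]; exact add_mem hx hy
    · intro a x _ hx
      rw [smul_mul_assoc, smul_mul_assoc, mul_smul_comm]; exact Submodule.smul_mem _ _ hx
  · simp
  · intro x y _ _ hx hy
    rw [add_mul, mul_add]; exact add_mem hx hy
  · intro a x _ hx
    rw [smul_mul_assoc, mul_smul_comm]; exact Submodule.smul_mem _ _ hx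

theorem isWord_gT (ω : Equiv.Perm (Fin n)) : ∃ m, D.IsWord 1 m (D.gT ω) := by
  refine ⟨_, (exists_reducedWord ω).choose.map Subtype.val, le_rfl, fun j hj => ?_, ?_⟩
  · obtain ⟨i, -, rfl⟩ := List.mem_map.1 hj
    exact i.2
  · rw [gT, gw, List.map_map]; rfl

theorem gT_mul_gT_mem (α β : Equiv.Perm (Fin n)) :
    D.gT α * D.gT β ∈ Submodule.span R (Set.range D.gT) := by
  obtain ⟨_, l, -, h2, hβ⟩ := D.isWord_gT β
  rw [hβ]
  clear hβ
  induction l using List.reverseRecOn with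
  | nil => simpa using Submodule.subset_span (Set.mem_range_self α)
  | append_singleton l j ih =>
    rw [List.map_append, List.prod_append, List.map_singleton, List.prod_singleton, ← mul_assoc]
    refine Submodule.span_induction
      (p := fun y _ => y * D.g j ∈ Submodule.span R (Set.range D.gT)) ?_ ?_ ?_ ?_
      (ih fun i hi => h2 i (by simp [hi]))
    · rintro _ ⟨ω, rfl⟩
      exact D.gT_mul_g_mem (Submodule.span R (Set.range D.gT)) LinearMap.id ω ⟨j, h2 j (by simp)⟩
        (Submodule.subset_span ⟨_, rfl⟩) fun _ => Submodule.subset_span ⟨_, rfl⟩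
    · simp
    · intro x y _ _ hx hy
      rw [add_mul]; exact add_mem hx hy
    · intro a x _ hx
      rw [smul_mul_assoc]; exact Submodule.smul_mem _ _ hx

theorem gT_commute {m : ℕ} {x : T}
    (hx : ∀ j, m ≤ j → j < n → Commute (D.g j) x) {σ : Equiv.Perm (Fin n)}
    (hσ : σ ∈ permsFrom m n) : Commute (D.gT σ) x := by
  induction hl : permLength σ using Nat.strong_induction_on generalizing σ with
  | _ l ih =>
  by_cases h1 : σ = 1
  · rw [h1, gT_one]; exact Commute.one_left x
  · obtain ⟨j, hj, hj'⟩ := exists_descent_of_fixed h1 (fixed_of_mem_permsFrom hσ)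
    have := permLength_mul_sgen_of_gt σ j hj'
    rw [D.gT_eq_mul hj']
    exact (ih _ (by omega) (mul_mem hσ (Subgroup.subset_closure ⟨j, by omega, rfl⟩)) rfl).mul_left
      (hx _ (by omega) j.2.2)

/-- The elements `g_{ω₁} e_{(k)} g_σ g_{ω₂}` span the sum of the `H_n e_{(k)} H_n`. -/
theorem twoSided_le : D.twoSided ≤ Submodule.span R {x | ∃ (k : ℕ) (ω₁ σ ω₂ : Equiv.Perm (Fin n)),
    2 * k ≤ n ∧ IsSorted k ω₁ ∧ σ ∈ permsFrom (2 * k + 1) n ∧ IsSorted k ω₂⁻¹ ∧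
    x = D.gT ω₁ * D.eK k * D.gT σ * D.gT ω₂} := by
  refine Submodule.span_le.2 ?_
  rintro _ ⟨k, α, β, hk, rfl⟩
  set S := Submodule.span R {x | ∃ (k : ℕ) (ω₁ σ ω₂ : Equiv.Perm (Fin n)),
    2 * k ≤ n ∧ IsSorted k ω₁ ∧ σ ∈ permsFrom (2 * k + 1) n ∧ IsSorted k ω₂⁻¹ ∧
    x = D.gT ω₁ * D.eK k * D.gT σ * D.gT ω₂} with hS
  refine Submodule.span_induction (p := fun x _ => x * D.gT β ∈ S) ?_ ?_ ?_ ?_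
    (D.gT_mul_eK_mem k hk α)
  -- The σ from straightening on the left is multiplied into β; straightening on the right then
  -- produces the σ that is kept.
  · rintro _ ⟨ω, σ, h1, -, rfl⟩
    rw [mul_assoc]
    refine Submodule.span_induction (p := fun y _ => D.gT ω * D.eK k * y ∈ S) ?_ ?_ ?_ ?_
      (D.gT_mul_gT_mem σ β)
    · rintro _ ⟨β, rfl⟩
      rw [mul_assoc]
      refine Submodule.span_induction (p := fun y _ => D.gT ω * y ∈ S) ?_ ?_ ?_ ?_
        (D.eK_mul_gT_mem k hk β)
      · rintro _ ⟨ω₂, σ, h2, h3, rfl⟩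
        refine Submodule.subset_span ⟨k, ω, σ, ω₂, hk, h1, h3, h2, ?_⟩
        rw [(D.gT_commute (fun j h4 h5 => D.commute_eK (by omega) h5) h3).eq]
        simp only [mul_assoc]
      · simp
      · intro x y _ _ hx hy
        rw [mul_add]; exact add_mem hx hy
      · intro a x _ hx
        rw [mul_smul_comm]; exact Submodule.smul_mem _ _ hx
    · simp
    · intro x y _ _ hx hy
      rw [mul_add]; exact add_mem hx hy
    · intro a x _ hx
      rw [mul_smul_comm]; exact Submodule.smul_mem _ _ hx
  · simp
  · intro x y _ _ hx hy
    rw [add_mul]; exact add_mem hx hy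
  · intro a x _ hx
    rw [smul_mul_assoc]; exact Submodule.smul_mem _ _ hx

theorem e_mul_twoSided (hn : 2 ≤ n) {x : T} (hx : x ∈ D.twoSided) : D.e * x ∈ D.twoSided := by
  refine Submodule.span_induction (p := fun x _ => D.e * x ∈ D.twoSided) ?_ ?_ ?_ ?_ hx
  · rintro _ ⟨k, α, β, hk, rfl⟩
    obtain ⟨m, hm⟩ := D.isWord_gT α
    obtain ⟨m', l, -, h2, hβ⟩ := D.isWord_gT β
    rw [hβ, ← mul_assoc]
    have h0 := D.e_mul_word_mem hk hn hm
    clear hβ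
    induction l using List.reverseRecOn with
    | nil => simpa using h0
    | append_singleton l j ih =>
      rw [List.map_append, List.prod_append, List.map_singleton, List.prod_singleton, ← mul_assoc]
      exact D.twoSided_mul_g (h2 j (by simp)).1 (h2 j (by simp)).2
        (ih fun i hi => h2 i (by simp [hi]))
  · simp
  · intro x y _ _ hx hy
    rw [mul_add]; exact add_mem hx hy
  · intro a x _ hx
    rw [mul_smul_comm]; exact Submodule.smul_mem _ _ hx

/-- A submodule that contains 1 = e_(0) and is stable under left multiplication by the generators
contains the algebra that they generate. -/
theorem adjoin_le_twoSided (hn : 2 ≤ n) {x : T}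
    (hx : x ∈ Algebra.adjoin R ({D.e} ∪ D.g '' {j | 1 ≤ j ∧ j < n})) : x ∈ D.twoSided := by
  suffices h : ∀ y ∈ D.twoSided, x * y ∈ D.twoSided by
    simpa using h 1 (by simpa [eK] using D.eK_mem_twoSided (k := 0) (by omega))
  induction hx using Algebra.adjoin_induction with
  | mem x hx =>
    rintro y hy
    rcases hx with hx | ⟨j, ⟨h1, h2⟩, rfl⟩
    · rw [Set.mem_singleton_iff.1 hx]; exact D.e_mul_twoSided hn hy
    · exact D.g_mul_twoSided h1 h2 hy
  | algebraMap a =>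
    intro y hy
    rw [← Algebra.smul_def]; exact Submodule.smul_mem _ _ hy
  | add x x' _ _ hx hx' =>
    intro y hy
    rw [add_mul]; exact add_mem (hx y hy) (hx' y hy)
  | mul x x' _ _ hx hx' =>
    intro y hy
    rw [mul_assoc]; exact hx _ (hx' y hy)

end QSystem

/-! ### The sets `B*_k` -/

section BStar

variable {n : ℕ}

/-- With vertices numbered from 0, s_i ⋯ s_j is the cycle on i - 1, …, j that sends j to i - 1 and
raises the others by one. The empty product i = j + 1 is admitted as the start of the induction. -/
theorem sAsc_apply {i j : ℕ} (hi : 1 ≤ i) (hj : j < n) (x : Fin n) (hij : i ≤ j + 1) :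
    (sAsc n i j x : ℕ) =
      if x.1 = j ∧ i ≤ j then i - 1 else if i ≤ x.1 + 1 ∧ x.1 < j then x.1 + 1 else x.1 := by
  induction j generalizing x with
  | zero =>
    have : sAsc n i 0 = 1 := ascProd_of_lt (sNat n) (by omega)
    rw [this]
    split_ifs <;> first | omega | rfl
  | succ j ih =>
    rcases (show i = j + 1 + 1 ∨ i ≤ j + 1 by omega) with rfl | h
    · have : sAsc n (j + 1 + 1) (j + 1) = 1 := ascProd_of_lt (sNat n) (by omega)
      rw [this]
      split_ifs <;> first | omega | rfl
    · have e : sAsc n i (j + 1) = sAsc n i j * sgen ⟨j + 1, by omega, hj⟩ := by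
        have e1 : sAsc n i (j + 1) = sAsc n i j * sNat n (j + 1) := ascProd_right (sNat n) h
        rw [e1, sNat, dif_pos]
      rw [e, Equiv.Perm.mul_apply, ih (by omega) _ h, sgen_apply_val]
      simp only
      split_ifs <;> omega

/-- The factors that may occur at `j` in a product that defines an element of `B*_k`. -/
def IsFactor (n j : ℕ) (t : Equiv.Perm (Fin n)) : Prop :=
  t = 1 ∨ ∃ i, 1 ≤ i ∧ i ≤ j ∧ t = sAsc n i j

/-- The products of factors along a list of indices. -/
def factorProducts (n : ℕ) (L : List ℕ) : Set (Equiv.Perm (Fin n)) :=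
  {ω | ∃ t : ℕ → Equiv.Perm (Fin n), (∀ j, IsFactor n j (t j)) ∧ ω = (L.map t).prod}

theorem factorProducts_nil : factorProducts n [] = {1} := by
  ext ω
  constructor
  · rintro ⟨t, -, rfl⟩; rfl
  · rintro rfl
    exact ⟨fun _ => 1, fun _ => Or.inl rfl, rfl⟩

/-- The factors are chosen as a function of the index; the first factor can be chosen independently
because j does not recur in L. -/
theorem mem_factorProducts_cons {j : ℕ} {L : List ℕ} (h : j ∉ L) (ω : Equiv.Perm (Fin n)) :
    ω ∈ factorProducts n (j :: L) ↔
      ∃ t α, IsFactor n j t ∧ α ∈ factorProducts n L ∧ ω = t * α := by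
  constructor
  · rintro ⟨t, h1, rfl⟩
    exact ⟨t j, _, h1 j, ⟨t, h1, rfl⟩, by simp⟩
  · rintro ⟨t, _, h1, ⟨t', h2, rfl⟩, rfl⟩
    refine ⟨Function.update t' j t, fun i => ?_, ?_⟩
    · rcases eq_or_ne i j with rfl | hij
      · rwa [Function.update_self]
      · rw [Function.update_of_ne hij]; exact h2 i
    · rw [List.map_cons, List.prod_cons, Function.update_self]
      congr 2
      refine List.map_congr_left fun i hi => ?_
      rw [Function.update_of_ne]
      rintro rfl
      exact h hi

theorem lt_of_fixed {ω : Equiv.Perm (Fin n)} {m : ℕ} (h : ∀ x : Fin n, m ≤ x.1 → ω x = x) {x : Fin n}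
    (hx : x.1 < m) : (ω x).1 < m := by
  by_contra hc
  have := ω.injective (h (ω x) (by omega))
  rw [this] at hc
  omega

/-- The factor at m only decides the image of m; it preserves the relative order of the images of
the positions before m. -/
theorem factor_mul {m : ℕ} (hm : m < n) {t ω : Equiv.Perm (Fin n)} (ht : IsFactor n m t)
    (h : ∀ x : Fin n, m ≤ x.1 → ω x = x) :
    (∀ x : Fin n, m + 1 ≤ x.1 → (t * ω) x = x) ∧
      ∀ x y : Fin n, x.1 < m → y.1 < m → ((t * ω) x < (t * ω) y ↔ ω x < ω y) := by
  rcases ht with rfl | ⟨i, h1, h2, rfl⟩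
  · exact ⟨fun x hx => by rw [one_mul, h x (by omega)], fun x y _ _ => by rw [one_mul]⟩
  · refine ⟨fun x hx => ?_, fun x y hx hy => ?_⟩
    · ext
      rw [Equiv.Perm.mul_apply, h x (by omega), sAsc_apply h1 hm x (by omega)]
      split_ifs <;> omega
    · have hx' := lt_of_fixed h hx
      have hy' := lt_of_fixed h hy
      rw [Equiv.Perm.mul_apply, Equiv.Perm.mul_apply, Fin.lt_def, sAsc_apply h1 hm _ (by omega),
        sAsc_apply h1 hm _ (by omega), Fin.lt_def]
      split_ifs <;> omega

/-- The factors at m send m to each of 0, …, m exactly once. Dividing ω by the one that agrees with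
it at m gives a permutation that also fixes m. -/
theorem exists_factor {m : ℕ} (hm : m < n) {ω : Equiv.Perm (Fin n)}
    (h : ∀ x : Fin n, m + 1 ≤ x.1 → ω x = x) :
    ∃ t α, IsFactor n m t ∧ ω = t * α ∧ ∀ x : Fin n, m ≤ x.1 → α x = x := by
  have h1 : (ω ⟨m, hm⟩).1 < m + 1 := lt_of_fixed h (by simp)
  have key : ∀ t : Equiv.Perm (Fin n), t ⟨m, hm⟩ = ω ⟨m, hm⟩ → (∀ x : Fin n, m + 1 ≤ x.1 → t x = x) →
      ∀ x : Fin n, m ≤ x.1 → (t⁻¹ * ω) x = x := by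
    intro t h2 h3 x hx
    rw [Equiv.Perm.mul_apply, Equiv.Perm.inv_eq_iff_eq]
    rcases (show x.1 = m ∨ m + 1 ≤ x.1 by omega) with h4 | h4
    · rw [show x = ⟨m, hm⟩ from Fin.ext h4, h2]
    · rw [h x h4, h3 x h4]
  rcases (show (ω ⟨m, hm⟩).1 = m ∨ (ω ⟨m, hm⟩).1 + 1 ≤ m by omega) with h2 | h2
  · refine ⟨1, ω, Or.inl rfl, by rw [one_mul], ?_⟩
    have := key 1 (by ext; simp [h2]) fun x _ => rfl
    simpa using this
  · refine ⟨sAsc n ((ω ⟨m, hm⟩).1 + 1) m, (sAsc n ((ω ⟨m, hm⟩).1 + 1) m)⁻¹ * ω,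
      Or.inr ⟨_, by omega, h2, rfl⟩, by group, ?_⟩
    refine key _ ?_ fun x hx => ?_ <;> ext <;> rw [sAsc_apply (Nat.le_add_left _ _) hm _ (by omega)]
    · rw [if_pos ⟨rfl, h2⟩]; omega
    · split_ifs <;> omega

/-- The first two conditions of `IsSorted`. -/
structure IsPairSorted (k : ℕ) (ω : Equiv.Perm (Fin n)) : Prop where
  pair : ∀ x y : Fin n, x.1 % 2 = 0 → y.1 = x.1 + 1 → y.1 < 2 * k → ω x < ω y
  max : ∀ x y : Fin n, x.1 % 2 = 1 → y.1 = x.1 + 2 → y.1 < 2 * k → ω x < ω y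

theorem IsPairSorted.congr {k m : ℕ} {ω α : Equiv.Perm (Fin n)} (h : IsPairSorted k ω)
    (hk : 2 * k ≤ m) (hα : ∀ x y : Fin n, x.1 < m → y.1 < m → (ω x < ω y ↔ α x < α y)) :
    IsPairSorted k α :=
  ⟨fun x y h1 h2 h3 => (hα x y (by omega) (by omega)).1 (h.pair x y h1 h2 h3),
    fun x y h1 h2 h3 => (hα x y (by omega) (by omega)).1 (h.max x y h1 h2 h3)⟩

/-- The even part `2k-2, 2k-4, …, 2` of the index list. -/
def evenIndices (k : ℕ) : List ℕ := (List.range' 1 (k - 1)).reverse.map fun m => 2 * m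

theorem evenIndices_succ (k : ℕ) : evenIndices (k + 2) = 2 * (k + 1) :: evenIndices (k + 1) := by
  simp [evenIndices, List.range'_concat, add_comm]

/-- Every one of the first 2k + 2 positions except the last is followed, one or two steps later, by
a larger value, so the largest value stands last. This is why no factor with odd index is needed
below 2k. -/
theorem IsPairSorted.fixed {k : ℕ} {ω : Equiv.Perm (Fin n)} (h : IsPairSorted (k + 1) ω)
    (hf : ∀ x : Fin n, 2 * (k + 1) ≤ x.1 → ω x = x) (x : Fin n) (hx : 2 * k + 1 ≤ x.1) : ω x = x := by
  rcases (show x.1 = 2 * k + 1 ∨ 2 * (k + 1) ≤ x.1 by omega) with hx' | hx'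
  swap
  · exact hf x hx'
  obtain ⟨y, hy⟩ := ω.surjective x
  have hy1 : y.1 < 2 * (k + 1) := by
    by_contra hc
    rw [hf y (by omega)] at hy
    subst hy; omega
  rcases (show y.1 = 2 * k + 1 ∨ y.1 < 2 * k + 1 by omega) with h1 | h1
  · rwa [show y = x from Fin.ext (by omega)] at hy
  · exfalso
    rcases Nat.mod_two_eq_zero_or_one y.1 with h2 | h2
    · have h3 := h.pair y ⟨y.1 + 1, by omega⟩ h2 rfl (by dsimp only; omega)
      have h4 := lt_of_fixed (x := ⟨y.1 + 1, by omega⟩) hf (by dsimp only; omega)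
      rw [hy, Fin.lt_def] at h3
      omega
    · have h3 := h.max y ⟨y.1 + 2, by omega⟩ h2 rfl (by dsimp only; omega)
      have h4 := lt_of_fixed (x := ⟨y.1 + 2, by omega⟩) hf (by dsimp only; omega)
      rw [hy, Fin.lt_def] at h3
      omega

/-- Passing from k + 1 to k + 2 pairs, the new last position is fixed automatically, and the one
before it may have any image, which the even factor provides. -/
theorem mem_factorProducts_even {k : ℕ} (hk : 2 * k ≤ n) (ω : Equiv.Perm (Fin n)) :
    ω ∈ factorProducts n (evenIndices k) ↔
      IsPairSorted k ω ∧ ∀ x : Fin n, 2 * k ≤ x.1 → ω x = x := by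
  rcases k with _ | k
  · have : evenIndices 0 = [] := rfl
    rw [this, factorProducts_nil, Set.mem_singleton_iff]
    constructor
    · rintro rfl
      exact ⟨⟨by simp, by simp⟩, fun _ _ => rfl⟩
    · rintro ⟨-, h⟩
      ext x; rw [h x (by omega)]; rfl
  induction k generalizing ω with
  | zero =>
    have : evenIndices (0 + 1) = [] := rfl
    rw [this, factorProducts_nil, Set.mem_singleton_iff]
    constructor
    · rintro rfl
      refine ⟨⟨fun x y _ h _ => by rw [Fin.lt_def]; simp [h], fun x y h1 h2 h3 => ?_⟩, fun _ _ => rfl⟩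
      omega
    · rintro ⟨h1, h2⟩
      ext x
      rcases Nat.eq_zero_or_pos x.1 with h0 | h0
      · have := lt_of_fixed (x := x) (IsPairSorted.fixed h1 h2) (by omega)
        rw [Equiv.Perm.one_apply]; omega
      · rw [IsPairSorted.fixed h1 h2 x (by omega)]; rfl
  | succ k ih =>
    rw [evenIndices_succ, mem_factorProducts_cons]
    swap
    · simp [evenIndices]; omega
    constructor
    · rintro ⟨t, α, h1, h2, rfl⟩
      obtain ⟨h3, h4⟩ := (ih α (by omega)).1 h2
      obtain ⟨h5, h6⟩ := factor_mul (by omega) h1 h4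
      have h7 : IsPairSorted (k + 1) (t * α) := h3.congr le_rfl fun x y hx hy => (h6 x y hx hy).symm
      have top : ∀ x y : Fin n, x.1 < y.1 → y.1 = 2 * (k + 1) + 1 → (t * α) x < (t * α) y := by
        intro x y hxy hy
        rw [h5 y (by omega), Fin.lt_def, hy]
        exact lt_of_fixed h5 (by omega)
      refine ⟨⟨fun x y e1 e2 e3 => ?_, fun x y e1 e2 e3 => ?_⟩, fun x hx => h5 x (by omega)⟩
      · rcases (show y.1 = 2 * (k + 1) + 1 ∨ y.1 < 2 * (k + 1) by omega) with h | h
        · exact top x y (by omega) h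
        · exact h7.pair x y e1 e2 h
      · rcases (show y.1 = 2 * (k + 1) + 1 ∨ y.1 < 2 * (k + 1) by omega) with h | h
        · exact top x y (by omega) h
        · exact h7.max x y e1 e2 h
    · rintro ⟨h1, h2⟩
      obtain ⟨t, α, h3, rfl, h5⟩ := exists_factor (by omega) (h1.fixed h2)
      refine ⟨t, α, h3, (ih α (by omega)).2 ⟨?_, h5⟩, rfl⟩
      have h7 : IsPairSorted (k + 1) (t * α) :=
        ⟨fun x y e1 e2 e3 => h1.pair x y e1 e2 (by omega),
          fun x y e1 e2 e3 => h1.max x y e1 e2 (by omega)⟩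
      exact h7.congr le_rfl (factor_mul (by omega) h3 h5).2

/-- The factors with index at least 2k give the later positions arbitrary images without changing
the relative order of the first 2k values, so only the condition from the even factors survives. -/
theorem mem_BStar_iff {k : ℕ} (hk : 2 * k ≤ n) (ω : Equiv.Perm (Fin n)) :
    ω ∈ BStar n k ↔ IsPairSorted k ω := by
  have key : ∀ m, 2 * k ≤ m → m ≤ n → ∀ ω : Equiv.Perm (Fin n),
      ω ∈ factorProducts n (bIndices m k) ↔
        IsPairSorted k ω ∧ ∀ x : Fin n, m ≤ x.1 → ω x = x := by
    intro m hm
    induction m, hm using Nat.le_induction with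
    | base =>
      intro _ ω
      have : bIndices (2 * k) k = evenIndices k := by simp [bIndices, evenIndices]
      rw [this, mem_factorProducts_even hk]
    | succ m hm ih =>
      intro hmn ω
      have e : bIndices (m + 1) k = m :: bIndices m k := by
        have e1 : m + 1 - 2 * k = (m - 2 * k) + 1 := by omega
        have e2 : 2 * k + (m - 2 * k) = m := by omega
        rw [bIndices, e1, List.range'_concat, one_mul, e2]
        simp [bIndices]
      rw [e, mem_factorProducts_cons]
      swap
      · simp only [bIndices, List.mem_append, List.mem_reverse, List.mem_range'_1, List.mem_map,
          not_or, not_exists]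
        constructor
        · omega
        · intro i; omega
      constructor
      · rintro ⟨t, α, h1, h2, rfl⟩
        obtain ⟨h3, h4⟩ := (ih (by omega) α).1 h2
        obtain ⟨h5, h6⟩ := factor_mul (by omega) h1 h4
        exact ⟨h3.congr hm fun x y hx hy => (h6 x y hx hy).symm, h5⟩
      · rintro ⟨h1, h2⟩
        obtain ⟨t, α, h3, rfl, h5⟩ := exists_factor (by omega) h2
        exact ⟨t, α, h3, (ih (by omega) α).2 ⟨h1.congr hm (factor_mul (by omega) h3 h5).2, h5⟩, rfl⟩
  have h := key n hk le_rfl ω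
  have e : BStar n k = factorProducts n (bIndices n k) := rfl
  rw [e, h]
  exact and_iff_left fun x hx => absurd x.2 (by omega)

end BStar

/-! ### Sorted permutations and involutions -/

section Involution

variable {n : ℕ}

/-- The pairing `{0,1}, {2,3}, …` of the first `2k` vertices, the identity on the others. -/
def pairing (k : ℕ) (h : 2 * k ≤ n) (x : Fin n) : Fin n :=
  if hx : x.1 < 2 * k then ⟨pairPartner x.1, (pairPartner_lt hx).trans_le h⟩ else x

theorem pairing_val {k : ℕ} (h : 2 * k ≤ n) (x : Fin n) :
    (pairing k h x).1 =
      if x.1 < 2 * k then (if x.1 % 2 = 0 then x.1 + 1 else x.1 - 1) else x.1 := by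
  unfold pairing pairPartner
  split_ifs <;> rfl

theorem pairing_of_le {k : ℕ} (h : 2 * k ≤ n) {x : Fin n} (hx : 2 * k ≤ x.1) :
    pairing k h x = x := dif_neg (by omega)

theorem pairing_lt_iff {k : ℕ} (h : 2 * k ≤ n) (x : Fin n) :
    (pairing k h x).1 < 2 * k ↔ x.1 < 2 * k := by
  rw [pairing_val]; split_ifs <;> omega

theorem pairing_ne_iff {k : ℕ} (h : 2 * k ≤ n) (x : Fin n) :
    pairing k h x ≠ x ↔ x.1 < 2 * k := by
  rw [ne_eq, Fin.ext_iff, pairing_val]; split_ifs <;> omega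

@[simp] theorem pairing_pairing {k : ℕ} (h : 2 * k ≤ n) (x : Fin n) :
    pairing k h (pairing k h x) = x := by
  ext; rw [pairing_val, pairing_val]; split_ifs <;> omega

/-- With numbering from 0, the odd positions below 2k are the second members of the pairs; each
carries the largest value so far. -/
theorem IsSorted.lt_odd {k : ℕ} {ω : Equiv.Perm (Fin n)} (hω : IsSorted k ω) {x y : Fin n}
    (hxy : x < y) (hy : y.1 < 2 * k) (hy' : y.1 % 2 = 1) : ω x < ω y := by
  obtain ⟨y, hyn⟩ := y
  induction y using Nat.strong_induction_on with
  | _ y ih =>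
  simp only [Fin.lt_def] at hxy hy hy'
  rcases (show x.1 + 1 = y ∨ x.1 + 2 = y ∨ x.1 < y - 2 by omega) with h | h | h
  · exact hω.pair _ _ (by omega) h.symm hy
  · exact hω.max _ _ (by omega) h.symm hy
  · exact (ih (y - 2) (by omega) (by omega) h (by simp only; omega) (by simp only; omega)).trans
      (hω.max _ _ (by simp only; omega) (by simp only; omega) hy)

theorem two_mul_card_lt_add (f : Fin n → Fin n) (hf : ∀ x, f (f x) = x) :
    2 * (Finset.univ.filter fun i => f i < i).card +
      (Finset.univ.filter fun i => f i = i).card = n := by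
  have hk' : (Finset.univ.filter fun i => i < f i).card =
      (Finset.univ.filter fun i => f i < i).card := by
    refine Finset.card_bij' (fun i _ => f i) (fun i _ => f i) ?_ ?_ ?_ ?_ <;> simp [hf]
  have h1 := Finset.card_filter_add_card_filter_not (s := (Finset.univ : Finset (Fin n)))
    (fun i => f i < i)
  have h2 := Finset.card_filter_add_card_filter_not
    (s := Finset.univ.filter fun i => ¬ f i < i) (fun i => i < f i)
  rw [Finset.filter_filter, Finset.filter_filter] at h2
  have e1 : (Finset.univ.filter fun i => ¬ f i < i ∧ i < f i) =
      Finset.univ.filter fun i => i < f i := by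
    ext i; simp only [Finset.mem_filter, Finset.mem_univ, true_and]
    exact ⟨fun h => h.2, fun h => ⟨h.not_gt, h⟩⟩
  have e2 : (Finset.univ.filter fun i => ¬ f i < i ∧ ¬ i < f i) =
      Finset.univ.filter fun i => f i = i := by
    ext i; simp only [Finset.mem_filter, Finset.mem_univ, true_and]
    exact ⟨fun h => le_antisymm (not_lt.1 h.2) (not_lt.1 h.1), fun h => by simp [h]⟩
  rw [e1, e2] at h2
  rw [Finset.card_univ, Fintype.card_fin] at h1
  omega

/-- The larger ends of the 2-cycles are listed increasingly at the odd positions, each preceded by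
its partner, and the fixed points follow in increasing order. -/
theorem exists_isSorted (f : Fin n → Fin n) (hf : ∀ x, f (f x) = x) {k : ℕ}
    (hk : (Finset.univ.filter fun i => f i < i).card = k) :
    ∃ h : 2 * k ≤ n, ∃ ω : Equiv.Perm (Fin n), IsSorted k ω ∧ ∀ x, f (ω x) = ω (pairing k h x) := by
  have hsum := two_mul_card_lt_add f hf
  rw [hk] at hsum
  have h : 2 * k ≤ n := by omega
  set o1 := (Finset.univ.filter fun i => f i < i).orderEmbOfFin hk with ho1
  have hcard : (Finset.univ.filter fun i => f i = i).card = n - 2 * k := by omega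
  set o2 := (Finset.univ.filter fun i => f i = i).orderEmbOfFin hcard with ho2
  have m1 : ∀ i, f (o1 i) < o1 i := fun i =>
    (Finset.mem_filter.1 (Finset.orderEmbOfFin_mem _ hk i)).2
  have m2 : ∀ i, f (o2 i) = o2 i := fun i =>
    (Finset.mem_filter.1 (Finset.orderEmbOfFin_mem _ hcard i)).2
  let w : Fin n → Fin n := fun x =>
    if hx : x.1 < 2 * k then
      if x.1 % 2 = 1 then o1 ⟨x.1 / 2, by omega⟩ else f (o1 ⟨x.1 / 2, by omega⟩)
    else o2 ⟨x.1 - 2 * k, by omega⟩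
  have w1 : ∀ x : Fin n, ∀ hx : x.1 < 2 * k, x.1 % 2 = 1 → w x = o1 ⟨x.1 / 2, by omega⟩ :=
    fun x hx h => by simp only [w]; rw [dif_pos hx, if_pos h]
  have w2 : ∀ x : Fin n, ∀ hx : x.1 < 2 * k, x.1 % 2 = 0 → w x = f (o1 ⟨x.1 / 2, by omega⟩) :=
    fun x hx h => by simp only [w]; rw [dif_pos hx, if_neg (by omega)]
  have w3 : ∀ x : Fin n, ∀ hx : 2 * k ≤ x.1, w x = o2 ⟨x.1 - 2 * k, by omega⟩ :=
    fun x hx => by simp only [w]; rw [dif_neg (by omega)]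
  have inj : Function.Injective w := by
    intro x y hxy
    have kind : ∀ x : Fin n, (x.1 < 2 * k ∧ x.1 % 2 = 1 ∧ f (w x) < w x) ∨
        (x.1 < 2 * k ∧ x.1 % 2 = 0 ∧ w x < f (w x)) ∨ (2 * k ≤ x.1 ∧ f (w x) = w x) := by
      intro x
      rcases Nat.lt_or_ge x.1 (2 * k) with hx | hx
      · rcases Nat.mod_two_eq_zero_or_one x.1 with h0 | h0
        · refine Or.inr (Or.inl ⟨hx, h0, ?_⟩)
          rw [w2 x hx h0, hf]; exact m1 _
        · refine Or.inl ⟨hx, h0, ?_⟩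
          rw [w1 x hx h0]; exact m1 _
      · refine Or.inr (Or.inr ⟨hx, ?_⟩)
        rw [w3 x hx]; exact m2 _
    have kx := kind x
    rw [hxy] at kx
    rcases kx with ⟨a1, a2, a3⟩ | ⟨a1, a2, a3⟩ | ⟨a1, a3⟩ <;>
      rcases kind y with ⟨b1, b2, b3⟩ | ⟨b1, b2, b3⟩ | ⟨b1, b3⟩
    · rw [w1 x a1 a2, w1 y b1 b2] at hxy
      have := o1.injective hxy
      rw [Fin.mk.injEq] at this
      exact Fin.ext (by omega)
    · exact absurd a3 b3.not_gt
    · exact absurd b3 a3.ne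
    · exact absurd a3 b3.not_gt
    · rw [w2 x a1 a2, w2 y b1 b2] at hxy
      have := o1.injective ((Function.LeftInverse.injective hf) hxy)
      rw [Fin.mk.injEq] at this
      exact Fin.ext (by omega)
    · exact absurd b3 a3.ne'
    · exact absurd a3 b3.ne
    · exact absurd a3 b3.ne'
    · rw [w3 x a1, w3 y b1] at hxy
      have := o2.injective hxy
      rw [Fin.mk.injEq] at this
      exact Fin.ext (by omega)
  refine ⟨h, Equiv.ofBijective w (Finite.injective_iff_bijective.1 inj), ⟨?_, ?_, ?_⟩, ?_⟩
  · intro x y h1 h2 h3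
    rw [Equiv.ofBijective_apply, Equiv.ofBijective_apply, w2 x (by omega) h1, w1 y h3 (by omega)]
    have : y.1 / 2 = x.1 / 2 := by omega
    simp only [this]
    exact m1 _
  · intro x y h1 h2 h3
    rw [Equiv.ofBijective_apply, Equiv.ofBijective_apply, w1 x (by omega) h1, w1 y h3 (by omega),
      OrderEmbedding.lt_iff_lt, Fin.mk_lt_mk]
    omega
  · intro x y h1 h2
    rw [Fin.lt_def] at h2
    rw [Equiv.ofBijective_apply, Equiv.ofBijective_apply, w3 x h1, w3 y (by omega),
      OrderEmbedding.lt_iff_lt, Fin.mk_lt_mk]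
    omega
  · intro x
    rw [Equiv.ofBijective_apply, Equiv.ofBijective_apply]
    have hv := pairing_val h x
    rcases Nat.lt_or_ge x.1 (2 * k) with hx | hx
    · rw [if_pos hx] at hv
      have hp := (pairing_lt_iff h x).2 hx
      rcases Nat.mod_two_eq_zero_or_one x.1 with h0 | h0
      · rw [if_pos h0] at hv
        rw [w2 x hx h0, hf, w1 _ hp (by omega)]
        congr 2
        omega
      · rw [if_neg (by omega)] at hv
        rw [w1 x hx h0, w2 _ hp (by omega)]
        congr 3
        omega
    · rw [pairing_of_le h hx, w3 x hx, m2]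

/-- The odd positions must enumerate {v | f v < v} increasingly, and the positions from 2k on the
fixed points. A strictly increasing map is determined by its range, and f determines the even
positions. -/
theorem IsSorted.unique {k : ℕ} (h : 2 * k ≤ n) {ω α : Equiv.Perm (Fin n)} (hω : IsSorted k ω)
    (hα : IsSorted k α) {f : Fin n → Fin n} (fω : ∀ x, f (ω x) = ω (pairing k h x))
    (fα : ∀ x, f (α x) = α (pairing k h x)) : ω = α := by
  -- the odd positions and the positions from `2k` on
  have odd_range : ∀ ω : Equiv.Perm (Fin n), IsSorted k ω → (∀ x, f (ω x) = ω (pairing k h x)) →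
      StrictMono (fun i : Fin k => ω ⟨2 * i.1 + 1, by omega⟩) ∧
        Set.range (fun i : Fin k => ω ⟨2 * i.1 + 1, by omega⟩) = {v | f v < v} := by
    intro ω hω fω
    refine ⟨fun i j hij => hω.lt_odd (by simp only [Fin.lt_def] at hij ⊢; omega)
      (by simp only; omega) (by simp only; omega), ?_⟩
    ext v
    simp only [Set.mem_range, Set.mem_ofPred_eq]
    constructor
    · rintro ⟨i, rfl⟩
      rw [fω]
      exact hω.pair _ _ (by rw [pairing_val]; simp only; split_ifs <;> omega)
        (by rw [pairing_val]; simp only; split_ifs <;> omega) (by simp only; omega)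
    · intro hv
      obtain ⟨x, rfl⟩ := ω.surjective v
      rw [fω] at hv
      have hx : x.1 < 2 * k := by
        by_contra hc
        rw [pairing_of_le h (by omega)] at hv
        exact hv.false
      rcases Nat.mod_two_eq_zero_or_one x.1 with h0 | h0
      · exact absurd hv (hω.pair _ _ h0 (by rw [pairing_val, if_pos hx, if_pos h0])
          ((pairing_lt_iff h x).2 hx)).not_gt
      · refine ⟨⟨x.1 / 2, by omega⟩, ?_⟩
        congr 1
        ext; simp only; omega
  have rest_range : ∀ ω : Equiv.Perm (Fin n), IsSorted k ω → (∀ x, f (ω x) = ω (pairing k h x)) →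
      StrictMono (fun i : Fin (n - 2 * k) => ω ⟨2 * k + i.1, by omega⟩) ∧
        Set.range (fun i : Fin (n - 2 * k) => ω ⟨2 * k + i.1, by omega⟩) = {v | f v = v} := by
    intro ω hω fω
    refine ⟨fun i j hij => hω.rest _ _ (by simp only; omega)
      (by simp only [Fin.lt_def] at hij ⊢; omega), ?_⟩
    ext v
    simp only [Set.mem_range, Set.mem_ofPred_eq]
    constructor
    · rintro ⟨i, rfl⟩
      rw [fω, pairing_of_le h (by simp only; omega)]
    · intro hv
      obtain ⟨x, rfl⟩ := ω.surjective v
      rw [fω] at hv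
      have hx : ¬ x.1 < 2 * k := by
        rw [← pairing_ne_iff h, not_not]; exact ω.injective hv
      refine ⟨⟨x.1 - 2 * k, by omega⟩, ?_⟩
      congr 1
      ext; simp only; omega
  obtain ⟨a1, a2⟩ := odd_range ω hω fω
  obtain ⟨b1, b2⟩ := odd_range α hα fα
  obtain ⟨c1, c2⟩ := rest_range ω hω fω
  obtain ⟨d1, d2⟩ := rest_range α hα fα
  have e1 := (a1.range_inj b1).1 (a2.trans b2.symm)
  have e2 := (c1.range_inj d1).1 (c2.trans d2.symm)
  have odd : ∀ x : Fin n, x.1 < 2 * k → x.1 % 2 = 1 → ω x = α x := by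
    intro x hx h0
    have := congrFun e1 ⟨x.1 / 2, by omega⟩
    have e : (⟨2 * (x.1 / 2) + 1, by omega⟩ : Fin n) = x := by ext; simp only; omega
    simpa only [e] using this
  ext1 x
  rcases Nat.lt_or_ge x.1 (2 * k) with hx | hx
  · rcases Nat.mod_two_eq_zero_or_one x.1 with h0 | h0
    · have h1 := odd (pairing k h x) ((pairing_lt_iff h x).2 hx)
        (by rw [pairing_val, if_pos hx, if_pos h0]; omega)
      rw [← pairing_pairing h x, ← fω, ← fα, h1]
    · exact odd x hx h0
  · have := congrFun e2 ⟨x.1 - 2 * k, by omega⟩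
    have e : (⟨2 * k + (x.1 - 2 * k), by omega⟩ : Fin n) = x := by ext; simp only; omega
    simpa only [e] using this

/-- The number of inversions of `g` at positions from `2k` on. -/
def restLength (k : ℕ) (g : Equiv.Perm (Fin n)) : ℕ :=
  (Finset.univ.filter fun x : Fin n × Fin n => 2 * k ≤ x.1.1 ∧ x.1 < x.2 ∧ g x.2 < g x.1).card

/-- Every inversion of ω starts below 2k, and it is sent injectively to an inversion of ωg that
starts below 2k. The inversions counted by `restLength` start later and remain inversions in ωg,
since ω increases there. -/
theorem IsSorted.permLength_mul_ge {k : ℕ} (h : 2 * k ≤ n) {ω g : Equiv.Perm (Fin n)}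
    (hω : IsSorted k ω) (hg : ∀ x, g (pairing k h x) = pairing k h (g x)) :
    permLength ω + restLength k g ≤ permLength (ω * g) := by
  have hg' : ∀ x, g⁻¹ (pairing k h x) = pairing k h (g⁻¹ x) := by
    intro x
    rw [Equiv.Perm.inv_eq_iff_eq, hg]; simp
  have small : ∀ x, (g x).1 < 2 * k ↔ x.1 < 2 * k := by
    intro x
    rw [← pairing_ne_iff h, ← pairing_ne_iff h, ← hg, ne_eq, g.injective.eq_iff]
  have small' : ∀ x, (g⁻¹ x).1 < 2 * k ↔ x.1 < 2 * k := by
    intro x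
    have := small (g⁻¹ x)
    rw [show ∀ z, g (g⁻¹ z) = z from fun z => g.apply_symm_apply z] at this
    exact this.symm
  set A := Finset.univ.filter fun x : Fin n × Fin n => x.1 < x.2 ∧ ω x.2 < ω x.1 with hA
  set B := Finset.univ.filter fun x : Fin n × Fin n =>
    2 * k ≤ x.1.1 ∧ x.1 < x.2 ∧ g x.2 < g x.1 with hB
  set C := Finset.univ.filter fun x : Fin n × Fin n => x.1 < x.2 ∧ (ω * g) x.2 < (ω * g) x.1 with hC
  -- If g⁻¹ reverses the inversion (x, y), then y is the first member of its pair. Its partner comes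
  -- after x and has a larger value than x, while its preimage under g lies before that of x because
  -- preimages of pairs are pairs of neighbours.
  let φ : Fin n × Fin n → Fin n × Fin n := fun x =>
    if g⁻¹ x.1 < g⁻¹ x.2 then (g⁻¹ x.1, g⁻¹ x.2) else (g⁻¹ (pairing k h x.2), g⁻¹ x.1)
  have hA1 : ∀ x ∈ A, x.1.1 < 2 * k := by
    rintro ⟨x, y⟩ hx
    obtain ⟨-, h1, h2⟩ := Finset.mem_filter.1 hx
    by_contra hc
    exact lt_asymm h2 (hω.rest x y (by simpa using hc) h1)
  have hA2 : ∀ x ∈ A, ¬ g⁻¹ x.1 < g⁻¹ x.2 → x.2.1 < 2 * k ∧ x.2.1 % 2 = 0 ∧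
      g⁻¹ x.2 < g⁻¹ x.1 ∧ (pairing k h x.2).1 = x.2.1 + 1 := by
    rintro ⟨x, y⟩ hx hn
    have h0 := hA1 _ hx
    obtain ⟨-, h1, h2⟩ := Finset.mem_filter.1 hx
    simp only at h0 h1 h2 hn ⊢
    have h3 : g⁻¹ y < g⁻¹ x := lt_of_le_of_ne (not_lt.1 hn) fun e => h1.ne' (g⁻¹.injective e)
    have h4 : y.1 < 2 * k := by
      have h5 := (small' x).2 h0
      rw [← small' y]
      rw [Fin.lt_def] at h3
      omega
    have h5 : y.1 % 2 = 0 := by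
      by_contra hc
      exact lt_asymm h2 (hω.lt_odd h1 h4 (by omega))
    exact ⟨h4, h5, h3, by rw [pairing_val, if_pos h4, if_pos h5]⟩
  have maps : ∀ x ∈ A, φ x ∈ C ∧ (φ x).1.1 < 2 * k := by
    rintro ⟨x, y⟩ hx
    have h0 := hA1 _ hx
    have hA2' := hA2 _ hx
    obtain ⟨-, h1, h2⟩ := Finset.mem_filter.1 hx
    simp only at h0 h1 h2 hA2'
    by_cases hlt : g⁻¹ x < g⁻¹ y
    · have e : φ (x, y) = (g⁻¹ x, g⁻¹ y) := if_pos hlt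
      rw [e, hC, Finset.mem_filter]
      exact ⟨⟨Finset.mem_univ _, hlt, by simpa using h2⟩, (small' x).2 h0⟩
    · have e : φ (x, y) = (g⁻¹ (pairing k h y), g⁻¹ x) := if_neg hlt
      obtain ⟨h3, h4, h5, h6⟩ := hA2' hlt
      rw [e, hC, Finset.mem_filter]
      refine ⟨⟨Finset.mem_univ _, ?_, ?_⟩, (small' _).2 (by omega)⟩
      · have h7 : pairing k h (g⁻¹ y) ≠ g⁻¹ x := by
          rw [← hg']
          intro hc
          have := g⁻¹.injective hc
          rw [this] at h6
          rw [Fin.lt_def] at h1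
          omega
        simp only [hg']
        rw [ne_eq, Fin.ext_iff, pairing_val] at h7
        rw [Fin.lt_def] at h5
        rw [Fin.lt_def, pairing_val]
        split_ifs at h7 ⊢ <;> omega
      · rw [Equiv.Perm.mul_apply, Equiv.Perm.mul_apply,
          show ∀ z, g (g⁻¹ z) = z from fun z => g.apply_symm_apply z,
          show ∀ z, g (g⁻¹ z) = z from fun z => g.apply_symm_apply z]
        exact hω.lt_odd (by rw [Fin.lt_def] at h1 ⊢; omega) (by omega) (by omega)
  have inj : Set.InjOn φ A := by
    rintro ⟨x, y⟩ hx ⟨x', y'⟩ hx' hxy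
    have h2 := hA2 _ hx
    have h2' := hA2 _ hx'
    obtain ⟨-, h1, -⟩ := Finset.mem_filter.1 hx
    obtain ⟨-, h1', -⟩ := Finset.mem_filter.1 hx'
    simp only [Fin.lt_def] at h1 h1' h2 h2'
    simp only [φ] at hxy
    -- The two kinds of images are told apart by applying g: the entries are then in increasing
    -- order in the first case and in decreasing order in the second.
    split_ifs at hxy with ha hb hb <;> rw [Prod.mk.injEq, g⁻¹.injective.eq_iff,
      g⁻¹.injective.eq_iff] at hxy
    · rw [hxy.1, hxy.2]
    · exfalso
      have := h2' hb
      have e1 : x.1 = (pairing k h y').1 := congrArg Fin.val hxy.1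
      have e2 : y.1 = x'.1 := congrArg Fin.val hxy.2
      omega
    · exfalso
      have := h2 ha
      have e1 : (pairing k h y).1 = x'.1 := congrArg Fin.val hxy.1
      have e2 : x.1 = y'.1 := congrArg Fin.val hxy.2
      omega
    · have h3 := (h2 ha).2.2.2
      have h3' := (h2' hb).2.2.2
      rw [hxy.1] at h3
      rw [hxy.2, show y = y' from Fin.ext (by omega)]
  have hBC : B ⊆ C := by
    rintro ⟨x, y⟩ hx
    obtain ⟨-, h1, h2, h3⟩ := Finset.mem_filter.1 hx
    simp only at h1 h2 h3
    refine Finset.mem_filter.2 ⟨Finset.mem_univ _, h2, ?_⟩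
    simp only [Equiv.Perm.mul_apply]
    refine hω.rest _ _ ?_ h3
    by_contra hc
    have := (small y).1 (by omega)
    rw [Fin.lt_def] at h2
    omega
  have hdis : Disjoint (A.image φ) B := by
    rw [Finset.disjoint_left]
    intro x hx hx'
    obtain ⟨y, hy, rfl⟩ := Finset.mem_image.1 hx
    have h1 := (maps y hy).2
    have h2 := (Finset.mem_filter.1 hx').2.1
    omega
  have hsub : A.image φ ∪ B ⊆ C := by
    refine Finset.union_subset ?_ hBC
    intro x hx
    obtain ⟨y, hy, rfl⟩ := Finset.mem_image.1 hx
    exact (maps y hy).1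
  have := Finset.card_le_card hsub
  rw [Finset.card_union_of_disjoint hdis, Finset.card_image_of_injOn inj] at this
  exact this

/-- On the positions from 2k on, ω is g g'⁻¹. An inversion of ω, pulled back by g', is an inversion
of g if its order is kept, and gives one of g' if it is reversed. -/
theorem permLength_le_restLength_add {k : ℕ} {ω g g' : Equiv.Perm (Fin n)}
    (hω : ω ∈ permsFrom (2 * k + 1) n) (hg' : ∀ x, (g' x).1 < 2 * k ↔ x.1 < 2 * k)
    (h : ∀ x : Fin n, 2 * k ≤ x.1 → g x = ω (g' x)) :
    permLength ω ≤ restLength k g + restLength k g' := by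
  have fixed : ∀ x : Fin n, x.1 < 2 * k → ω x = x := fun x hx =>
    fixed_of_mem_permsFrom hω (by omega)
  have big : ∀ x y : Fin n, x < y → ω y < ω x → 2 * k ≤ x.1 := by
    intro x y h1 h2
    by_contra hc
    rw [fixed x (by omega)] at h2
    by_cases hy : y.1 < 2 * k
    · rw [fixed y hy] at h2; exact lt_asymm h1 h2
    · have h3 : ω (ω y) = ω y := fixed _ (by rw [Fin.lt_def] at h2; omega)
      rw [ω.injective h3] at h2
      exact lt_asymm h1 h2
  have big' : ∀ x : Fin n, 2 * k ≤ x.1 → 2 * k ≤ (g'⁻¹ x).1 := by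
    intro x hx
    by_contra hc
    have := (hg' (g'⁻¹ x)).2 (by omega)
    rw [show g' (g'⁻¹ x) = x from g'.apply_symm_apply x] at this
    omega
  rw [permLength, ← Finset.card_filter_add_card_filter_not fun x : Fin n × Fin n =>
    g'⁻¹ x.1 < g'⁻¹ x.2]
  refine add_le_add ?_ ?_
  · refine Finset.card_le_card_of_injOn (fun x => (g'⁻¹ x.1, g'⁻¹ x.2)) ?_ ?_
    · rintro ⟨x, y⟩ hx
      simp only [Finset.coe_filter, Finset.mem_filter, Finset.mem_univ, true_and,
        Set.mem_ofPred_eq] at hx ⊢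
      obtain ⟨⟨h1, h2⟩, h3⟩ := hx
      have hx := big x y h1 h2
      have hy : 2 * k ≤ y.1 := by rw [Fin.lt_def] at h1; omega
      refine ⟨big' x hx, h3, ?_⟩
      rw [h _ (big' x hx), h _ (big' y hy)]
      simpa using h2
    · rintro ⟨x, y⟩ _ ⟨x', y'⟩ _ hxy
      simpa using hxy
  · refine Finset.card_le_card_of_injOn (fun x => (g'⁻¹ x.2, g'⁻¹ x.1)) ?_ ?_
    · rintro ⟨x, y⟩ hx
      simp only [Finset.coe_filter, Finset.mem_filter, Finset.mem_univ, true_and,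
        Set.mem_ofPred_eq] at hx ⊢
      obtain ⟨⟨h1, h2⟩, h3⟩ := hx
      have hx := big x y h1 h2
      have hy : 2 * k ≤ y.1 := by rw [Fin.lt_def] at h1; omega
      refine ⟨big' y hy, lt_of_le_of_ne (not_lt.1 h3) fun e => h1.ne' (g'⁻¹.injective e), ?_⟩
      simpa using h1
    · rintro ⟨x, y⟩ _ ⟨x', y'⟩ _ hxy
      simpa [and_comm] using hxy

end Involution

/-! ### Reduced expressions of Brauer diagrams -/

namespace BrauerDiagram

variable {n : ℕ}

theorem relabel_apply (P : Equiv.Perm (Fin n ⊕ Fin n)) (d : BrauerDiagram n)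
    (x : Fin n ⊕ Fin n) : (d.relabel P).1 (P x) = P (d.1 x) := by
  simp [relabel]

theorem relabel_relabel (P Q : Equiv.Perm (Fin n ⊕ Fin n)) (d : BrauerDiagram n) :
    (d.relabel P).relabel Q = d.relabel (Q * P) :=
  Subtype.ext (by simp [relabel, mul_assoc])

theorem relabel_one (d : BrauerDiagram n) : d.relabel 1 = d :=
  Subtype.ext (by simp [relabel])

theorem leftMul_one (d : BrauerDiagram n) : d.leftMul 1 = d := by
  rw [leftMul, show Equiv.sumCongr (1 : Equiv.Perm (Fin n)) (1 : Equiv.Perm (Fin n)) = 1 from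
    Equiv.Perm.sumCongr_one, relabel_one]

theorem rightMul_one (d : BrauerDiagram n) : d.rightMul 1 = d := by
  rw [rightMul, inv_one, show Equiv.sumCongr (1 : Equiv.Perm (Fin n)) (1 : Equiv.Perm (Fin n)) = 1
    from Equiv.Perm.sumCongr_one, relabel_one]

theorem rightMul_rightMul (d : BrauerDiagram n) (α β : Equiv.Perm (Fin n)) :
    (d.rightMul α).rightMul β = d.rightMul (α * β) := by
  rw [rightMul, rightMul, rightMul, relabel_relabel, mul_inv_rev]
  congr 1
  ext x; rcases x with x | x <;> simp

theorem ext_apply {d d' : BrauerDiagram n} (h : ∀ x, d.1 x = d'.1 x) : d = d' :=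
  Subtype.ext (Equiv.ext h)

/-- The diagram upside down. -/
def flip (d : BrauerDiagram n) : BrauerDiagram n := d.relabel (Equiv.sumComm _ _)

theorem flip_apply_inl (d : BrauerDiagram n) (x : Fin n) :
    d.flip.1 (Sum.inl x) = (d.1 (Sum.inr x)).swap :=
  d.relabel_apply (Equiv.sumComm _ _) (Sum.inr x)

/-- The partner of `i` in the top row, `i` itself for an end of a vertical edge. -/
def topInv (d : BrauerDiagram n) (i : Fin n) : Fin n := (d.1 (Sum.inl i)).elim id fun _ => i

/-- The partner of `i` in the bottom row, `i` itself for an end of a vertical edge. -/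
def botInv (d : BrauerDiagram n) (i : Fin n) : Fin n := (d.1 (Sum.inr i)).elim (fun _ => i) id

theorem topInv_flip (d : BrauerDiagram n) : d.flip.topInv = d.botInv := by
  ext1 i
  rw [topInv, botInv, flip_apply_inl]
  rcases d.1 (Sum.inr i) with x | x <;> rfl

theorem topInv_of_inl {d : BrauerDiagram n} {i j : Fin n} (h : d.1 (Sum.inl i) = Sum.inl j) :
    d.topInv i = j := by rw [topInv, h]; rfl

theorem topInv_of_inr {d : BrauerDiagram n} {i j : Fin n} (h : d.1 (Sum.inl i) = Sum.inr j) :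
    d.topInv i = i := by rw [topInv, h]; rfl

theorem botInv_of_inr {d : BrauerDiagram n} {i j : Fin n} (h : d.1 (Sum.inr i) = Sum.inr j) :
    d.botInv i = j := by rw [botInv, h]; rfl

theorem botInv_of_inl {d : BrauerDiagram n} {i j : Fin n} (h : d.1 (Sum.inr i) = Sum.inl j) :
    d.botInv i = i := by rw [botInv, h]; rfl

theorem apply_inl_of_ne {d : BrauerDiagram n} {i : Fin n} (h : d.topInv i ≠ i) :
    d.1 (Sum.inl i) = Sum.inl (d.topInv i) := by
  rcases e : d.1 (Sum.inl i) with j | j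
  · rw [topInv_of_inl e]
  · exact absurd (topInv_of_inr e) h

theorem apply_inl_of_eq {d : BrauerDiagram n} {i : Fin n} (h : d.topInv i = i) :
    ∃ j, d.1 (Sum.inl i) = Sum.inr j := by
  rcases e : d.1 (Sum.inl i) with j | j
  · rw [topInv_of_inl e] at h
    exact absurd (h ▸ e) (d.2.2 _)
  · exact ⟨j, rfl⟩

theorem apply_inr_of_ne {d : BrauerDiagram n} {i : Fin n} (h : d.botInv i ≠ i) :
    d.1 (Sum.inr i) = Sum.inr (d.botInv i) := by
  rcases e : d.1 (Sum.inr i) with j | j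
  · exact absurd (botInv_of_inl e) h
  · rw [botInv_of_inr e]

theorem apply_inr_of_eq {d : BrauerDiagram n} {i : Fin n} (h : d.botInv i = i) :
    ∃ j, d.1 (Sum.inr i) = Sum.inl j := by
  rcases e : d.1 (Sum.inr i) with j | j
  · exact ⟨j, rfl⟩
  · rw [botInv_of_inr e] at h
    exact absurd (h ▸ e) (d.2.2 _)

theorem topInv_topInv (d : BrauerDiagram n) (i : Fin n) : d.topInv (d.topInv i) = i := by
  by_cases h : d.topInv i = i
  · rw [h, h]
  · refine topInv_of_inl ?_
    rw [← apply_inl_of_ne h, d.2.1]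

theorem botInv_botInv (d : BrauerDiagram n) (i : Fin n) : d.botInv (d.botInv i) = i := by
  rw [← topInv_flip]; exact topInv_topInv _ _

/-- The vertical edges match the fixed points of the two involutions. -/
theorem card_botInv_eq (d : BrauerDiagram n) :
    (Finset.univ.filter fun i => d.botInv i = i).card =
      (Finset.univ.filter fun i => d.topInv i = i).card := by
  refine Finset.card_bij' (fun i _ => (d.1 (Sum.inr i)).elim id id)
    (fun i _ => (d.1 (Sum.inl i)).elim id id) ?_ ?_ ?_ ?_ <;> intro i hi <;>
    rw [Finset.mem_filter] at hi
  · obtain ⟨j, hj⟩ := apply_inr_of_eq hi.2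
    simp only [hj, Finset.mem_filter, Finset.mem_univ, true_and, Sum.elim_inl, id]
    exact topInv_of_inr (j := i) (by rw [← hj, d.2.1])
  · obtain ⟨j, hj⟩ := apply_inl_of_eq hi.2
    simp only [hj, Finset.mem_filter, Finset.mem_univ, true_and, Sum.elim_inr, id]
    exact botInv_of_inl (j := i) (by rw [← hj, d.2.1])
  · obtain ⟨j, hj⟩ := apply_inr_of_eq hi.2
    simp only [hj, Sum.elim_inl, id]
    rw [← hj, d.2.1]; rfl
  · obtain ⟨j, hj⟩ := apply_inl_of_eq hi.2
    simp only [hj, Sum.elim_inr, id]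
    rw [← hj, d.2.1]; rfl

theorem card_botInv_lt (d : BrauerDiagram n) :
    (Finset.univ.filter fun i => d.botInv i < i).card =
      (Finset.univ.filter fun i => d.topInv i < i).card := by
  have h1 := two_mul_card_lt_add d.topInv d.topInv_topInv
  have h2 := two_mul_card_lt_add d.botInv d.botInv_botInv
  rw [card_botInv_eq] at h2
  omega

/-- Each horizontal edge is represented once by its larger end, and both rows contain equally many.
-/
theorem card_horizontalEdges (d : BrauerDiagram n) :
    d.horizontalEdges.card = 2 * (Finset.univ.filter fun i => d.topInv i < i).card := by
  have key : d.horizontalEdges =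
      ((Finset.univ.filter fun i => d.topInv i < i).image fun i => s(Sum.inl i, d.1 (Sum.inl i))) ∪
      (Finset.univ.filter fun i => d.botInv i < i).image fun i => s(Sum.inr i, d.1 (Sum.inr i)) := by
    ext z
    simp only [horizontalEdges, Finset.mem_union, Finset.mem_image, Finset.mem_filter,
      Finset.mem_univ, true_and]
    constructor
    · rintro ⟨x | x, h, rfl⟩
      · left
        have hx : d.topInv x ≠ x := by
          intro hc
          obtain ⟨j, hj⟩ := apply_inl_of_eq hc
          simp [hj] at h
        rcases lt_or_gt_of_ne hx with h1 | h1
        · exact ⟨x, h1, rfl⟩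
        · refine ⟨d.topInv x, by rwa [topInv_topInv], ?_⟩
          rw [← apply_inl_of_ne hx, d.2.1, Sym2.eq_swap]
      · right
        have hx : d.botInv x ≠ x := by
          intro hc
          obtain ⟨j, hj⟩ := apply_inr_of_eq hc
          simp [hj] at h
        rcases lt_or_gt_of_ne hx with h1 | h1
        · exact ⟨x, h1, rfl⟩
        · refine ⟨d.botInv x, by rwa [botInv_botInv], ?_⟩
          rw [← apply_inr_of_ne hx, d.2.1, Sym2.eq_swap]
    · rintro (⟨x, h, rfl⟩ | ⟨x, h, rfl⟩)
      · exact ⟨Sum.inl x, by rw [apply_inl_of_ne h.ne]; rfl, rfl⟩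
      · exact ⟨Sum.inr x, by rw [apply_inr_of_ne h.ne]; rfl, rfl⟩
  rw [key, Finset.card_union_of_disjoint, Finset.card_image_of_injOn, Finset.card_image_of_injOn,
    card_botInv_lt, two_mul]
  · intro x hx y hy hxy
    simp only [Finset.coe_filter, Finset.mem_univ, true_and, Set.mem_ofPred_eq] at hx hy hxy
    rw [apply_inr_of_ne hx.ne, apply_inr_of_ne hy.ne, Sym2.eq_iff] at hxy
    rcases hxy with ⟨h1, -⟩ | ⟨h1, h2⟩
    · exact Sum.inr_injective h1
    · rw [Sum.inr_injective h2] at hx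
      rw [← Sum.inr_injective h1] at hy
      exact absurd hx hy.not_gt
  · intro x hx y hy hxy
    simp only [Finset.coe_filter, Finset.mem_univ, true_and, Set.mem_ofPred_eq] at hx hy hxy
    rw [apply_inl_of_ne hx.ne, apply_inl_of_ne hy.ne, Sym2.eq_iff] at hxy
    rcases hxy with ⟨h1, -⟩ | ⟨h1, h2⟩
    · exact Sum.inl_injective h1
    · rw [Sum.inl_injective h2] at hx
      rw [← Sum.inl_injective h1] at hy
      exact absurd hx hy.not_gt
  · rw [Finset.disjoint_left]
    intro z hz hz'
    obtain ⟨x, hx, rfl⟩ := Finset.mem_image.1 hz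
    obtain ⟨y, hy, h⟩ := Finset.mem_image.1 hz'
    have hx := (Finset.mem_filter.1 hx).2
    have hy := (Finset.mem_filter.1 hy).2
    rw [apply_inl_of_ne hx.ne, apply_inr_of_ne hy.ne, Sym2.eq_iff] at h
    simp at h

end BrauerDiagram

/-! ### The diagrams α e_(k) β and their reduced expressions -/

section Product

open BrauerDiagram

variable {n k : ℕ} {h : 2 * k ≤ n} {d : BrauerDiagram n} {α β : Equiv.Perm (Fin n)}

theorem eDiagram_inl (x : Fin n) : (eDiagram n k h).1 (Sum.inl x) =
    if x.1 < 2 * k then Sum.inl (pairing k h x) else Sum.inr x := by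
  simp only [eDiagram, Equiv.coe_fn_mk, eMap, pairing]
  split_ifs <;> rfl

theorem eDiagram_inr (x : Fin n) : (eDiagram n k h).1 (Sum.inr x) =
    if x.1 < 2 * k then Sum.inr (pairing k h x) else Sum.inl x := by
  simp only [eDiagram, Equiv.coe_fn_mk, eMap, pairing]
  split_ifs <;> rfl

theorem mul_eDiagram_mul_eq (α β : Equiv.Perm (Fin n)) :
    ((eDiagram n k h).leftMul α).rightMul β =
      (eDiagram n k h).relabel (Equiv.sumCongr α β⁻¹) := by
  rw [leftMul, rightMul, relabel_relabel]
  congr 1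
  ext x; rcases x with x | x <;> simp

theorem mul_apply_inl (α β : Equiv.Perm (Fin n)) (x : Fin n) :
    (((eDiagram n k h).leftMul α).rightMul β).1 (Sum.inl (α x)) =
      if x.1 < 2 * k then Sum.inl (α (pairing k h x)) else Sum.inr (β⁻¹ x) := by
  rw [mul_eDiagram_mul_eq]
  refine ((eDiagram n k h).relabel_apply (Equiv.sumCongr α β⁻¹) (Sum.inl x)).trans ?_
  rw [eDiagram_inl]; split_ifs <;> rfl

theorem mul_apply_inr (α β : Equiv.Perm (Fin n)) (x : Fin n) :
    (((eDiagram n k h).leftMul α).rightMul β).1 (Sum.inr (β⁻¹ x)) =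
      if x.1 < 2 * k then Sum.inr (β⁻¹ (pairing k h x)) else Sum.inl (α x) := by
  rw [mul_eDiagram_mul_eq]
  refine ((eDiagram n k h).relabel_apply (Equiv.sumCongr α β⁻¹) (Sum.inr x)).trans ?_
  rw [eDiagram_inr]; split_ifs <;> rfl

theorem topInv_mul (α β : Equiv.Perm (Fin n)) (x : Fin n) :
    (((eDiagram n k h).leftMul α).rightMul β).topInv (α x) = α (pairing k h x) := by
  have := mul_apply_inl (h := h) α β x
  split_ifs at this with hx
  · exact topInv_of_inl this
  · rw [topInv_of_inr this, pairing_of_le h (by omega)]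

theorem botInv_mul (α β : Equiv.Perm (Fin n)) (x : Fin n) :
    (((eDiagram n k h).leftMul α).rightMul β).botInv (β⁻¹ x) = β⁻¹ (pairing k h x) := by
  have := mul_apply_inr (h := h) α β x
  split_ifs at this with hx
  · exact botInv_of_inr this
  · rw [botInv_of_inl this, pairing_of_le h (by omega)]

theorem mul_eq_of (h1 : ∀ x, d.topInv (α x) = α (pairing k h x))
    (h2 : ∀ x, d.botInv (β⁻¹ x) = β⁻¹ (pairing k h x))
    (h3 : ∀ x : Fin n, 2 * k ≤ x.1 → d.1 (Sum.inl (α x)) = Sum.inr (β⁻¹ x)) :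
    ((eDiagram n k h).leftMul α).rightMul β = d := by
  refine ext_apply ?_
  rintro (x | x)
  · obtain ⟨x, rfl⟩ := α.surjective x
    rw [mul_apply_inl]
    split_ifs with hx
    · rw [apply_inl_of_ne, h1]
      rw [h1, ne_eq, α.injective.eq_iff]; exact (pairing_ne_iff h x).2 hx
    · rw [h3 x (by omega)]
  · obtain ⟨x, rfl⟩ := β⁻¹.surjective x
    rw [mul_apply_inr]
    split_ifs with hx
    · rw [apply_inr_of_ne, h2]
      rw [h2, ne_eq, β⁻¹.injective.eq_iff]; exact (pairing_ne_iff h x).2 hx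
    · rw [← h3 x (by omega), d.2.1]

theorem noVerticalCrossing_mul_iff : (((eDiagram n k h).leftMul α).rightMul β).NoVerticalCrossing ↔
    ∀ x y : Fin n, 2 * k ≤ x.1 → 2 * k ≤ y.1 → α x < α y → β⁻¹ x < β⁻¹ y := by
  constructor
  · intro H x y hx hy hxy
    refine H _ _ _ _ hxy ?_ ?_ <;> rw [mul_apply_inl, if_neg (by omega)]
  · intro H i j a b hij hi hj
    obtain ⟨x, rfl⟩ := α.surjective i
    obtain ⟨y, rfl⟩ := α.surjective j
    rw [mul_apply_inl] at hi hj
    split_ifs at hi hj with hx hy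
    rw [← Sum.inr_injective hi, ← Sum.inr_injective hj]
    exact H x y (by omega) (by omega) hij

theorem lt_of_reverse {α : Equiv.Perm (Fin n)} {x y : Fin n} (H : α y < α x → y < x)
    (hxy : x < y) : α x < α y :=
  (lt_or_gt_of_ne fun e => hxy.ne (α.injective e)).resolve_right fun h => lt_asymm hxy (H h)

theorem noVerticalCrossing_leftMul_iff : ((eDiagram n k h).leftMul α).NoVerticalCrossing ↔
    ∀ x y : Fin n, 2 * k ≤ x.1 → x < y → α x < α y := by
  rw [← rightMul_one ((eDiagram n k h).leftMul α), noVerticalCrossing_mul_iff]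
  simp only [inv_one, Equiv.Perm.one_apply]
  constructor
  · exact fun H x y hx hxy => lt_of_reverse (H y x (by rw [Fin.lt_def] at hxy; omega) hx) hxy
  · intro H x y _ hy hxy
    exact lt_of_reverse (α := 1) (fun hc => by
      have := H y x hy hc
      exact absurd hxy this.not_gt) (by
      rcases lt_trichotomy x y with hc | hc | hc
      · exact hc
      · rw [hc] at hxy; exact absurd hxy (lt_irrefl _)
      · exact absurd hxy (H y x hy hc).not_gt)

theorem noVerticalCrossing_rightMul_iff : ((eDiagram n k h).rightMul β).NoVerticalCrossing ↔
    ∀ x y : Fin n, 2 * k ≤ x.1 → x < y → β⁻¹ x < β⁻¹ y := by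
  rw [← leftMul_one (eDiagram n k h), noVerticalCrossing_mul_iff]
  simp only [Equiv.Perm.one_apply]
  exact ⟨fun H x y hx hxy => H x y hx (by rw [Fin.lt_def] at hxy; omega) hxy,
    fun H x y hx _ hxy => H x y hx hxy⟩

theorem isSorted_iff (ω : Equiv.Perm (Fin n)) : IsSorted k ω ↔
    IsPairSorted k ω ∧ ∀ x y : Fin n, 2 * k ≤ x.1 → x < y → ω x < ω y :=
  ⟨fun H => ⟨⟨H.pair, H.max⟩, H.rest⟩, fun H => ⟨H.1.pair, H.1.max, H.2⟩⟩

theorem isSorted_one : IsSorted k (1 : Equiv.Perm (Fin n)) :=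
  ⟨fun x y _ _ _ => by simp only [Equiv.Perm.one_apply, Fin.lt_def]; omega,
    fun x y _ _ _ => by simp only [Equiv.Perm.one_apply, Fin.lt_def]; omega,
    fun x y _ h => h⟩

theorem permsFrom_lt_iff {σ : Equiv.Perm (Fin n)} (hσ : σ ∈ permsFrom (2 * k + 1) n) (x : Fin n) :
    (σ x).1 < 2 * k ↔ x.1 < 2 * k := by
  constructor
  · intro hx
    have := σ.injective (fixed_of_mem_permsFrom hσ (x := σ x) (by omega))
    rwa [this] at hx
  · intro hx
    rwa [fixed_of_mem_permsFrom hσ (by omega)]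

theorem permsFrom_pairing {σ : Equiv.Perm (Fin n)} (hσ : σ ∈ permsFrom (2 * k + 1) n) (x : Fin n) :
    σ (pairing k h x) = pairing k h (σ x) := by
  rcases Nat.lt_or_ge x.1 (2 * k) with hx | hx
  · rw [fixed_of_mem_permsFrom hσ (x := x) (by omega), fixed_of_mem_permsFrom hσ]
    have := (pairing_lt_iff h x).2 hx
    omega
  · rw [pairing_of_le h hx, pairing_of_le h]
    by_contra hc
    have := (permsFrom_lt_iff hσ x).1 (by omega)
    omega

/-- The length of a product of sorted permutations and `e_{(k)}`. -/
theorem diagramLength_mul {ω₁ σ ω₂ : Equiv.Perm (Fin n)} (h1 : IsSorted k ω₁)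
    (hσ : σ ∈ permsFrom (2 * k + 1) n) (h2 : IsSorted k ω₂⁻¹) :
    diagramLength k h (((eDiagram n k h).leftMul ω₁).rightMul (σ * ω₂)) =
      permLength ω₁ + permLength σ + permLength ω₂ := by
  refine le_antisymm ?_ ?_
  · have h3 := permLength_mul_le σ ω₂
    have h4 : diagramLength k h (((eDiagram n k h).leftMul ω₁).rightMul (σ * ω₂)) ≤
        permLength ω₁ + permLength (σ * ω₂) := Nat.sInf_le ⟨ω₁, σ * ω₂, rfl, rfl⟩
    omega
  · refine le_csInf ⟨_, ω₁, σ * ω₂, rfl, rfl⟩ ?_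
    rintro _ ⟨α, β, heq, rfl⟩
    have hσ' : σ⁻¹ ∈ permsFrom (2 * k + 1) n := inv_mem hσ
    -- Let α e_(k) β be another expression of the same diagram. Since the rows agree, ω₁⁻¹ α and ω₂
    -- β⁻¹ commute with the pairing.
    have top : ∀ x, (ω₁⁻¹ * α) (pairing k h x) = pairing k h ((ω₁⁻¹ * α) x) := by
      intro x
      have e1 := topInv_mul (h := h) α β x
      have e2 := topInv_mul (h := h) ω₁ (σ * ω₂) ((ω₁⁻¹ * α) x)
      rw [Equiv.Perm.mul_apply, show ω₁ (ω₁⁻¹ (α x)) = α x from ω₁.apply_symm_apply _,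
        ← heq, e1] at e2
      rw [Equiv.Perm.mul_apply, e2]
      exact ω₁.symm_apply_apply _
    have bot : ∀ x, (ω₂ * β⁻¹) (pairing k h x) = pairing k h ((ω₂ * β⁻¹) x) := by
      intro x
      have e1 := botInv_mul (h := h) α β x
      have e2 := botInv_mul (h := h) ω₁ (σ * ω₂) (σ ((ω₂ * β⁻¹) x))
      rw [← permsFrom_pairing hσ, mul_inv_rev, Equiv.Perm.mul_apply, Equiv.Perm.mul_apply,
        Equiv.Perm.mul_apply, show ∀ z, σ⁻¹ (σ z) = z from σ.symm_apply_apply,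
        show ∀ z, σ⁻¹ (σ z) = z from σ.symm_apply_apply,
        show ω₂⁻¹ (ω₂ (β⁻¹ x)) = β⁻¹ x from ω₂.symm_apply_apply _, ← heq, e1] at e2
      rw [Equiv.Perm.mul_apply, e2]
      exact ω₂.apply_symm_apply _
    have small : ∀ (g : Equiv.Perm (Fin n)), (∀ x, g (pairing k h x) = pairing k h (g x)) →
        ∀ x, (g x).1 < 2 * k ↔ x.1 < 2 * k := by
      intro g hg x
      rw [← pairing_ne_iff h, ← pairing_ne_iff h, ← hg, ne_eq, g.injective.eq_iff]
    have b1 := h1.permLength_mul_ge h top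
    have b2 := h2.permLength_mul_ge h bot
    rw [mul_inv_cancel_left] at b1
    rw [inv_mul_cancel_left, permLength_inv, permLength_inv] at b2
    -- The bounds `b1` and `b2` compare α with ω₁ and β with ω₂ up to the rest lengths; comparing
    -- the vertical edges shows that the rest lengths together are at least the length of σ.
    have b3 := permLength_le_restLength_add hσ (small _ bot) (g := ω₁⁻¹ * α) (by
      intro x hx
      have hx' : ¬ ((ω₁⁻¹ * α) x).1 < 2 * k := by rw [small _ top]; omega
      have e1 := mul_apply_inl (h := h) α β x
      have e2 := mul_apply_inl (h := h) ω₁ (σ * ω₂) ((ω₁⁻¹ * α) x)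
      rw [if_neg hx', Equiv.Perm.mul_apply, show ω₁ (ω₁⁻¹ (α x)) = α x from ω₁.apply_symm_apply _,
        ← heq, e1, if_neg (by omega)] at e2
      rw [Equiv.Perm.mul_apply, Equiv.Perm.mul_apply, Sum.inr_injective e2, mul_inv_rev,
        Equiv.Perm.mul_apply, show ∀ z, ω₂ (ω₂⁻¹ z) = z from ω₂.apply_symm_apply]
      exact (σ.apply_symm_apply _).symm)
    omega

theorem card_horizontalEdges_mul :
    (((eDiagram n k h).leftMul α).rightMul β).horizontalEdges.card = 2 * k := by
  set d := ((eDiagram n k h).leftMul α).rightMul β with hd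
  have h1 := two_mul_card_lt_add d.topInv d.topInv_topInv
  have h2 : (Finset.univ.filter fun i => d.topInv i = i).card = n - 2 * k := by
    have : (Finset.univ.filter fun x : Fin n => ¬ x.1 < 2 * k).card = n - 2 * k := by
      have h3 := Finset.card_filter_add_card_filter_not (s := (Finset.univ : Finset (Fin n)))
        (fun i => i.1 < 2 * k)
      rw [Fin.card_filter_val_lt, Finset.card_univ, Fintype.card_fin] at h3
      omega
    rw [← this]
    refine (Finset.card_bij (fun x _ => α x) ?_ (fun x _ y _ hxy => α.injective hxy) ?_).symm
    · intro x hx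
      rw [Finset.mem_filter] at hx ⊢
      exact ⟨Finset.mem_univ _, by rw [hd, topInv_mul, pairing_of_le h (by omega)]⟩
    · intro y hy
      obtain ⟨x, rfl⟩ := α.surjective y
      refine ⟨x, ?_, rfl⟩
      rw [Finset.mem_filter] at hy ⊢
      rw [hd, topInv_mul, α.injective.eq_iff, ← not_not (a := pairing k h x = x)] at hy
      exact ⟨Finset.mem_univ _, by rw [← pairing_ne_iff h]; exact hy.2⟩
  rw [card_horizontalEdges]
  omega

/-- The reduced expressions are exactly the expressions through sorted permutations. -/
theorem isReducedExpression_iff {ω₁ σ ω₂ : Equiv.Perm (Fin n)} :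
    IsReducedExpression d k ω₁ σ ω₂ ↔ ∃ h : 2 * k ≤ n, IsSorted k ω₁ ∧
      σ ∈ permsFrom (2 * k + 1) n ∧ IsSorted k ω₂⁻¹ ∧
      ((eDiagram n k h).leftMul ω₁).rightMul (σ * ω₂) = d := by
  constructor
  · intro H
    refine ⟨H.le, (isSorted_iff _).2 ⟨(mem_BStar_iff H.le _).1 H.left_mem,
      noVerticalCrossing_leftMul_iff.1 H.left_noCrossing⟩, H.mid_mem, (isSorted_iff _).2 ⟨?_,
      noVerticalCrossing_rightMul_iff.1 H.right_noCrossing⟩, ?_⟩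
    · obtain ⟨α, h1, h2⟩ := H.right_mem
      rw [h2, inv_inv]; exact (mem_BStar_iff H.le _).1 h1
    · rw [← rightMul_rightMul]; exact H.eq_mul
  · rintro ⟨h, h1, hσ, h2, rfl⟩
    refine ⟨h, card_horizontalEdges_mul, (mem_BStar_iff h _).2 ((isSorted_iff _).1 h1).1, hσ,
      ⟨ω₂⁻¹, (mem_BStar_iff h _).2 ((isSorted_iff _).1 h2).1, (inv_inv _).symm⟩,
      noVerticalCrossing_leftMul_iff.2 h1.rest, noVerticalCrossing_rightMul_iff.2 h2.rest,
      rightMul_rightMul _ _ _, ?_, ?_, diagramLength_mul h1 hσ h2⟩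
    · have := diagramLength_mul (h := h) (σ := 1) (ω₂ := 1) h1 (one_mem _)
        (by rw [inv_one]; exact isSorted_one)
      simpa [rightMul_one, permLength_one] using this
    · have := diagramLength_mul (h := h) (ω₁ := 1) (σ := 1) isSorted_one (one_mem _) h2
      simpa [leftMul_one, permLength_one] using this

/-- Sorted permutations for the two row involutions give the outer factors; the vertical edges match
the remaining positions and give the middle factor. -/
theorem exists_isReducedExpression (d : BrauerDiagram n) :
    ∃ k ω₁ σ ω₂, IsReducedExpression d k ω₁ σ ω₂ := by
  obtain ⟨h, ω₁, h1, f1⟩ := exists_isSorted d.topInv d.topInv_topInv rfl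
  obtain ⟨_, ω, h2, f2⟩ := exists_isSorted d.botInv d.botInv_botInv d.card_botInv_lt
  set k := (Finset.univ.filter fun i => d.topInv i < i).card with hk
  have fwd : ∀ x : Fin n, ¬ x.1 < 2 * k → ∃ y : Fin n, ¬ y.1 < 2 * k ∧
      d.1 (Sum.inl (ω₁ x)) = Sum.inr (ω y) := by
    intro x hx
    obtain ⟨j, hj⟩ := apply_inl_of_eq (d := d) (i := ω₁ x) (by
      rw [f1, pairing_of_le h (by omega)])
    obtain ⟨y, rfl⟩ := ω.surjective j
    refine ⟨y, ?_, hj⟩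
    rw [← pairing_ne_iff h, not_not]
    refine ω.injective ?_
    rw [← f2]
    exact botInv_of_inl (by rw [← hj, d.2.1])
  choose! τ τ1 τ2 using fwd
  let t : Fin n → Fin n := fun x => if x.1 < 2 * k then x else τ x
  have ht : Function.Injective t := by
    intro x y hxy
    simp only [t] at hxy
    split_ifs at hxy with hx hy hy
    · exact hxy
    · exact absurd (hxy ▸ hx) (τ1 y hy)
    · exact absurd (hxy ▸ hy) (τ1 x hx)
    · have := τ2 x hx
      rw [hxy, ← τ2 y hy] at this
      exact ω₁.injective (Sum.inl_injective (d.1.injective this))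
  let T := Equiv.ofBijective t (Finite.injective_iff_bijective.1 ht)
  have hT : T ∈ permsFrom (2 * k + 1) n := mem_permsFrom fun {x} hx => by
    exact if_pos (by omega)
  -- Inverses appear because d β moves a bottom vertex by β⁻¹: here β⁻¹ = ωT, the map that sends x
  -- to the lower end of the edge from ω₁ x.
  refine ⟨k, ω₁, T⁻¹, ω⁻¹, isReducedExpression_iff.2 ⟨h, h1, inv_mem hT, by rwa [inv_inv], ?_⟩⟩
  refine mul_eq_of f1 (fun x => ?_) fun x hx => ?_
  · rw [mul_inv_rev, inv_inv, inv_inv, Equiv.Perm.mul_apply, f2, Equiv.Perm.mul_apply,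
      permsFrom_pairing hT]
  · rw [mul_inv_rev, inv_inv, inv_inv, Equiv.Perm.mul_apply, τ2 x (by omega)]
    congr 2
    exact (if_neg (by omega)).symm

/-- The number of horizontal edges determines k, the row involutions determine the sorted factors,
and the vertical edges then determine σ. -/
theorem IsReducedExpression.unique {k' : ℕ} {ω₁ σ ω₂ ω₁' σ' ω₂' : Equiv.Perm (Fin n)}
    (H : IsReducedExpression d k ω₁ σ ω₂) (H' : IsReducedExpression d k' ω₁' σ' ω₂') :
    k = k' ∧ ω₁ = ω₁' ∧ σ = σ' ∧ ω₂ = ω₂' := by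
  obtain rfl : k = k' := by
    have := H.card_horizontalEdges.symm.trans H'.card_horizontalEdges
    omega
  obtain ⟨h, h1, hσ, h2, e⟩ := isReducedExpression_iff.1 H
  obtain ⟨_, h1', hσ', h2', e'⟩ := isReducedExpression_iff.1 H'
  have bot : ∀ σ ω₂ ω₁ : Equiv.Perm (Fin n), σ ∈ permsFrom (2 * k + 1) n →
      ((eDiagram n k h).leftMul ω₁).rightMul (σ * ω₂) = d →
        ∀ x, d.botInv (ω₂⁻¹ x) = ω₂⁻¹ (pairing k h x) := by
    intro σ ω₂ ω₁ hσ e x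
    have e2 := botInv_mul (h := h) ω₁ (σ * ω₂) (σ x)
    rw [← permsFrom_pairing hσ, mul_inv_rev, Equiv.Perm.mul_apply, Equiv.Perm.mul_apply,
      show ∀ z, σ⁻¹ (σ z) = z from σ.symm_apply_apply,
      show ∀ z, σ⁻¹ (σ z) = z from σ.symm_apply_apply, e] at e2
    exact e2
  obtain rfl : ω₁ = ω₁' := h1.unique h h1' (f := d.topInv)
    (fun x => by rw [← e, topInv_mul]) (fun x => by rw [← e', topInv_mul])
  obtain rfl : ω₂ = ω₂' := inv_injective (h2.unique h h2' (f := d.botInv) (bot _ _ _ hσ e)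
    (bot _ _ _ hσ' e'))
  refine ⟨rfl, rfl, inv_injective (Equiv.ext fun x => ?_), rfl⟩
  rcases Nat.lt_or_ge x.1 (2 * k) with hx | hx
  · rw [fixed_of_mem_permsFrom (inv_mem hσ) (by omega),
      fixed_of_mem_permsFrom (inv_mem hσ') (by omega)]
  · have e1 := mul_apply_inl (h := h) ω₁ (σ * ω₂) x
    have e2 := mul_apply_inl (h := h) ω₁ (σ' * ω₂) x
    rw [e, ← e', e2, if_neg (by omega), if_neg (by omega), mul_inv_rev, mul_inv_rev] at e1
    exact (ω₂⁻¹.injective (Sum.inr_injective e1)).symm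

end Product

/-! ### The representation on tensor space -/

section Coefficients

variable {S : Type*} [CommRing S]

/-- The diagonal coefficient of `g_j` on a tensor with entries `i`, `j`. -/
def gDiag (s : Sˣ) (i j : ℕ) : S := if i = j then (s : S) ^ 2 else if j < i then (s : S) ^ 2 - 1 else 0

/-- The diagonal coefficient of `g_j⁻¹` on a tensor with entries `i`, `j`. -/
def gInvDiag (s : Sˣ) (i j : ℕ) : S :=
  if i = j then (↑s⁻¹ : S) ^ 2 else if i < j then (↑s⁻¹ : S) ^ 2 - 1 else 0

/-- The off-diagonal coefficient of `g_j` and `g_j⁻¹`, with `s` and `s⁻¹` for `a`. -/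
def gOff (a : S) (i j : ℕ) : S := if i = j then 0 else a

theorem gOff_symm (a : S) (i j : ℕ) : gOff a i j = gOff a j i := by
  simp only [gOff, eq_comm]

theorem gDiag_self (s : Sˣ) (i : ℕ) : gDiag s i i = (s : S) ^ 2 := if_pos rfl

theorem gInvDiag_self (s : Sˣ) (i : ℕ) : gInvDiag s i i = (↑s⁻¹ : S) ^ 2 := if_pos rfl

theorem gOff_self (a : S) (i : ℕ) : gOff a i i = 0 := if_pos rfl

theorem gDiag_mul_gInvDiag (s : Sˣ) (i j : ℕ) :
    gDiag s i j * gInvDiag s i j = if i = j then 1 else 0 := by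
  have h : (s : S) * (↑s⁻¹ : S) = 1 := s.mul_inv
  unfold gDiag gInvDiag
  split_ifs <;> first | omega | skip
  · rw [← mul_pow, h, one_pow]
  · rw [mul_zero]
  · rw [zero_mul]

/-- The sum telescopes: with q = s², a partial sum of m terms is 0 for m ≤ k and q^m afterwards.
This makes e g_2 e = r e hold with r = q^N. -/
theorem sum_pow_mul_gDiag (s : Sˣ) {N k : ℕ} (hk : k < N) :
    ∑ c ∈ Finset.range N, ((s : S) ^ 2) ^ c * gDiag s c k = ((s : S) ^ 2) ^ N := by
  have key : ∀ m, ∑ c ∈ Finset.range m, ((s : S) ^ 2) ^ c * gDiag s c k =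
      if m ≤ k then 0 else ((s : S) ^ 2) ^ m := by
    intro m
    induction m with
    | zero => simp
    | succ m ih =>
      rw [Finset.sum_range_succ, ih, gDiag]
      split_ifs <;> first | omega | ring
  rw [key, if_neg (by omega)]

/-- The partial sums are nonzero at most between k and l, and vanish once both have been passed.
This removes the off-diagonal part of e W_1 e. -/
theorem sum_pow_mul_gDiag_mul_gInvDiag (s : Sˣ) {N k l : ℕ} (hk : k < N) (hl : l < N)
    (hkl : k ≠ l) :
    ∑ c ∈ Finset.range N, ((s : S) ^ 2) ^ c * (gDiag s c k * gInvDiag s c l) = 0 := by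
  have h : (s : S) ^ 2 * (↑s⁻¹ : S) ^ 2 = 1 := by rw [← mul_pow, s.mul_inv, one_pow]
  have key : ∀ m, ∑ c ∈ Finset.range m, ((s : S) ^ 2) ^ c * (gDiag s c k * gInvDiag s c l) =
      if m ≤ k then 0 else if m ≤ l then ((↑s⁻¹ : S) ^ 2 - 1) * ((s : S) ^ 2) ^ m else 0 := by
    intro m
    induction m with
    | zero => simp
    | succ m ih =>
      rw [Finset.sum_range_succ, ih, gDiag, gInvDiag]
      split_ifs <;> first | omega | ring1 | skip
      · linear_combination ((s : S) ^ 2) ^ m * h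
  rw [key, if_neg (by omega), if_neg (by omega)]

end Coefficients

/-! ### Operators on four adjacent tensor factors -/

section LocalOperators

variable {S : Type*} [CommRing S] {N : ℕ}

/-- Functions of four colours. -/
abbrev Quad (S : Type*) (N : ℕ) : Type _ := Fin N → Fin N → Fin N → Fin N → S

/-- An exchange operator in the first two variables. -/
def loc₁ (A B : ℕ → ℕ → S) (F : Quad S N) : Quad S N := fun i j k l =>
  A i j * F i j k l + B i j * F j i k l

/-- An exchange operator in the two middle variables. -/
def loc₂ (A B : ℕ → ℕ → S) (F : Quad S N) : Quad S N := fun i j k l =>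
  A j k * F i j k l + B j k * F i k j l

/-- An exchange operator in the last two variables. -/
def loc₃ (A B : ℕ → ℕ → S) (F : Quad S N) : Quad S N := fun i j k l =>
  A k l * F i j k l + B k l * F i j l k

/-- Contraction of the first two variables. -/
def locE (a : S) (F : Quad S N) : Quad S N := fun i j k l =>
  if i = j then ∑ c : Fin N, a ^ c.1 * F c c k l else 0

/-- Contraction of both pairs of variables. -/
def locEE (a : S) (F : Quad S N) : Quad S N := fun i j k l =>
  if i = j ∧ k = l then ∑ c : Fin N, ∑ d : Fin N, a ^ c.1 * (a ^ d.1 * F c c d d) else 0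

variable (s : Sˣ) (F : Quad S N)

theorem loc_sq : loc₁ (gDiag s) (gOff (s : S)) (loc₁ (gDiag s) (gOff (s : S)) F) =
    fun i j k l => ((s : S) ^ 2 - 1) * loc₁ (gDiag s) (gOff (s : S)) F i j k l +
      (s : S) ^ 2 * F i j k l := by
  funext i j k l
  simp only [loc₁]
  rcases lt_trichotomy i.1 j.1 with h | h | h
  · simp [gDiag, gOff, h.ne, h.ne', h, h.not_gt]; ring
  · obtain rfl := Fin.ext h; simp [gDiag, gOff]; ring
  · simp [gDiag, gOff, h.ne, h.ne', h, h.not_gt]; ring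

theorem loc_braid : loc₁ (gDiag s) (gOff (s : S)) (loc₂ (gDiag s) (gOff (s : S))
      (loc₁ (gDiag s) (gOff (s : S)) F)) =
    loc₂ (gDiag s) (gOff (s : S)) (loc₁ (gDiag s) (gOff (s : S))
      (loc₂ (gDiag s) (gOff (s : S)) F)) := by
  funext i j k l
  simp only [loc₁, loc₂]
  rcases lt_trichotomy i.1 j.1 with h | h | h <;>
  rcases lt_trichotomy j.1 k.1 with h' | h' | h' <;>
  rcases lt_trichotomy i.1 k.1 with h'' | h'' | h'' <;>
  first
  | omega
  | (try cases Fin.ext h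
     try cases Fin.ext h'
     try cases Fin.ext h''
     simp only [gDiag, gOff, *, if_true, if_false, lt_irrefl, LT.lt.not_gt, LT.lt.ne, LT.lt.ne']
     try ring1)

theorem locE_sq {δ : S} (hδ : δ = ∑ c ∈ Finset.range N, ((s : S) ^ 2) ^ c) :
    locE ((s : S) ^ 2) (locE ((s : S) ^ 2) F) = fun i j k l => δ * locE ((s : S) ^ 2) F i j k l := by
  funext i j k l
  simp only [locE, if_true, mul_ite, mul_zero, ← Finset.sum_mul]
  rw [Fin.sum_univ_eq_sum_range (fun c => ((s : S) ^ 2) ^ c), hδ]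

theorem locE_loc₁ : locE ((s : S) ^ 2) (loc₁ (gDiag s) (gOff (s : S)) F) =
    fun i j k l => (s : S) ^ 2 * locE ((s : S) ^ 2) F i j k l := by
  funext i j k l
  simp only [locE, loc₁, gDiag_self, gOff_self, mul_ite, mul_zero, Finset.mul_sum, zero_mul, add_zero]
  split_ifs
  · exact Finset.sum_congr rfl fun c _ => by ring
  · rfl

theorem loc₁_locE : loc₁ (gDiag s) (gOff (s : S)) (locE ((s : S) ^ 2) F) =
    fun i j k l => (s : S) ^ 2 * locE ((s : S) ^ 2) F i j k l := by
  funext i j k l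
  by_cases h : i = j
  · subst h; simp [locE, loc₁, gDiag_self, gOff_self]
  · simp [locE, loc₁, h, Ne.symm h]

theorem locE_loc₂_locE : locE ((s : S) ^ 2) (loc₂ (gDiag s) (gOff (s : S))
      (locE ((s : S) ^ 2) F)) =
    fun i j k l => ((s : S) ^ 2) ^ N * locE ((s : S) ^ 2) F i j k l := by
  funext i j k l
  have key : ∀ c : Fin N, ((s : S) ^ 2) ^ c.1 *
      loc₂ (gDiag s) (gOff (s : S)) (locE ((s : S) ^ 2) F) c c k l =
      ((s : S) ^ 2) ^ c.1 * gDiag s c k * locE ((s : S) ^ 2) F k k k l := by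
    intro c
    by_cases h : c = k
    · subst h; simp [loc₂, gOff_self, mul_assoc]
    · simp [loc₂, locE, h, mul_assoc]
  by_cases h : i = j
  · subst h
    have h1 : ∀ G, locE ((s : S) ^ 2) G i i k l = ∑ c : Fin N, ((s : S) ^ 2) ^ c.1 * G c c k l :=
      fun G => if_pos rfl
    rw [h1, Finset.sum_congr rfl fun c _ => key c, ← Finset.sum_mul,
      Fin.sum_univ_eq_sum_range (fun c => ((s : S) ^ 2) ^ c * gDiag s c k),
      sum_pow_mul_gDiag s k.2]
    simp [locE]
  · simp [locE, h]

/-- The claim is that e W_1 e contracts both pairs. The entry before the last contraction is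
computed in `key`: for k = l only the contracted value remains, and for k ≠ l the coefficients sum
to zero. -/
theorem locE_mid_locE : locE ((s : S) ^ 2) (loc₂ (gDiag s) (gOff (s : S))
      (loc₃ (gDiag s) (gOff (s : S)) (loc₁ (gInvDiag s) (gOff (↑s⁻¹ : S))
        (loc₂ (gInvDiag s) (gOff (↑s⁻¹ : S)) (locE ((s : S) ^ 2) F))))) =
    locEE ((s : S) ^ 2) F := by
  have hs : (s : S) * (↑s⁻¹ : S) = 1 := s.mul_inv
  set Φ : Fin N → Fin N → S := fun k l => ∑ d : Fin N, ((s : S) ^ 2) ^ d.1 * F d d k l with hΦ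
  have key : ∀ c k l : Fin N, loc₂ (gDiag s) (gOff (s : S))
      (loc₃ (gDiag s) (gOff (s : S)) (loc₁ (gInvDiag s) (gOff (↑s⁻¹ : S))
        (loc₂ (gInvDiag s) (gOff (↑s⁻¹ : S)) (locE ((s : S) ^ 2) F)))) c c k l =
      if k = l then Φ c c else
        gDiag s c k * gInvDiag s c l * ((↑s⁻¹ : S) ^ 2 * s * Φ l k) +
        gDiag s c l * gInvDiag s c k * Φ k l := by
    intro c k l
    have hE : ∀ i j k l, locE ((s : S) ^ 2) F i j k l = if i = j then Φ k l else 0 :=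
      fun i j k l => rfl
    simp only [loc₁, loc₂, loc₃, hE]
    by_cases hkl : k = l
    · subst hkl
      by_cases hck : c = k
      · subst hck
        simp only [gDiag_self, gInvDiag_self, gOff_self, if_true]
        linear_combination (((s : S) * (↑s⁻¹ : S)) ^ 3 + ((s : S) * (↑s⁻¹ : S)) ^ 2 +
          (s : S) * (↑s⁻¹ : S) + 1) * Φ c c * hs
      · have h1 : (c : ℕ) ≠ k := fun h => hck (Fin.ext h)
        have h2 := gDiag_mul_gInvDiag s c.1 k.1
        rw [if_neg h1] at h2
        simp only [gDiag_self, gInvDiag_self, gOff_self, gOff, if_true, hck, h1, h1.symm, if_false,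
          Ne.symm hck]
        linear_combination ((↑s⁻¹ : S) ^ 2 * s ^ 2 * Φ k k + s * (↑s⁻¹ : S) * Φ k k) * h2 +
          (((s : S) * (↑s⁻¹ : S)) + 1) * Φ c c * hs
    · have h3 : (k : ℕ) ≠ l := fun h => hkl (Fin.ext h)
      by_cases hck : c = k
      · subst hck
        simp only [gDiag_self, gInvDiag_self, gOff_self, gOff, if_true, hkl, h3, h3.symm, if_false,
          Ne.symm hkl]
        linear_combination gDiag s c.1 l.1 * (↑s⁻¹ : S) ^ 2 * Φ c l *
          (((s : S) * (↑s⁻¹ : S)) + 1) * hs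
      · have h1 : (c : ℕ) ≠ k := fun h => hck (Fin.ext h)
        have h2 := gDiag_mul_gInvDiag s c.1 k.1
        rw [if_neg h1] at h2
        by_cases hcl : c = l
        · subst hcl
          simp only [gDiag_self, gInvDiag_self, gOff_self, gOff, if_true, hck, h1, h1.symm,
            if_false, Ne.symm hck]
          linear_combination gDiag s k.1 c.1 * (↑s⁻¹ : S) ^ 2 * Φ k c * h2 +
            (s : S) ^ 2 * gInvDiag s c.1 k.1 * Φ k c * hs
        · have h4 : (c : ℕ) ≠ l := fun h => hcl (Fin.ext h)
          simp only [gDiag_self, gInvDiag_self, gOff_self, gOff, if_true, hck, h1, h1.symm,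
            if_false, Ne.symm hck, hkl, Ne.symm hkl, hcl, Ne.symm hcl, h3, h3.symm, h4, h4.symm]
          linear_combination gDiag s k.1 l.1 * (↑s⁻¹ : S) ^ 2 * Φ k l * h2 +
            gDiag s c.1 l.1 * gInvDiag s c.1 k.1 * Φ k l * hs
  funext i j k l
  by_cases hij : i = j
  · subst hij
    have h1 : ∀ G, locE ((s : S) ^ 2) G i i k l = ∑ c : Fin N, ((s : S) ^ 2) ^ c.1 * G c c k l :=
      fun G => if_pos rfl
    rw [h1, Finset.sum_congr rfl fun c _ => congrArg _ (key c k l)]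
    by_cases hkl : k = l
    · subst hkl
      simp only [if_true, locEE, and_self, hΦ, Finset.mul_sum]
      rw [Finset.sum_comm]
      exact Finset.sum_congr rfl fun c _ => Finset.sum_congr rfl fun d _ => by ring
    · have h3 : (k : ℕ) ≠ l := fun h => hkl (Fin.ext h)
      have e1 := sum_pow_mul_gDiag_mul_gInvDiag s k.2 l.2 h3
      have e2 := sum_pow_mul_gDiag_mul_gInvDiag s l.2 k.2 h3.symm
      rw [← Fin.sum_univ_eq_sum_range
        (fun c => ((s : S) ^ 2) ^ c * (gDiag s c k * gInvDiag s c l))] at e1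
      rw [← Fin.sum_univ_eq_sum_range
        (fun c => ((s : S) ^ 2) ^ c * (gDiag s c l * gInvDiag s c k))] at e2
      simp only [if_neg hkl, locEE, hkl, and_false, if_false, mul_add, ← mul_assoc] at e1 e2 ⊢
      rw [Finset.sum_add_distrib]
      simp only [mul_assoc] at e1 e2 ⊢
      simp only [← mul_assoc, ← Finset.sum_mul] at e1 e2 ⊢
      simp [e1, e2]
  · simp [locE, locEE, hij]

/-- The double contraction takes values that depend only on i = j and k = l; the identity is then
checked according to which colours agree. The off-diagonal coefficients have to be symmetric. -/
theorem loc₃_loc₂_locEE (A B : ℕ → ℕ → S) (hB : ∀ i j, B i j = B j i) (a : S) :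
    loc₃ (gDiag s) (gOff (s : S)) (loc₂ A B (locEE a F)) =
      loc₁ (gDiag s) (gOff (s : S)) (loc₂ A B (locEE a F)) := by
  funext i j k l
  have hE : ∀ i j k l, locEE a F i j k l = (if i = j ∧ k = l then 1 else 0) *
      ∑ c : Fin N, ∑ d : Fin N, a ^ c.1 * (a ^ d.1 * F c c d d) :=
    fun i j k l => by simp [locEE]
  generalize (∑ c : Fin N, ∑ d : Fin N, a ^ c.1 * (a ^ d.1 * F c c d d)) = Z at hE
  simp only [loc₁, loc₂, loc₃, hE]
  by_cases h1 : i = j ∧ k = l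
  · obtain ⟨rfl, rfl⟩ := h1
    by_cases h2 : i = k
    · subst h2; simp
    · simp [gDiag_self, gOff_self]
  by_cases h2 : i = k ∧ j = l
  · obtain ⟨rfl, rfl⟩ := h2
    have h3 : ¬ j = i := fun h => h1 ⟨h.symm, h.symm⟩
    simp [h3, Ne.symm h3]
  by_cases h3 : i = l ∧ j = k
  · obtain ⟨rfl, rfl⟩ := h3
    have h4 : ¬ j = i := fun h => h1 ⟨h.symm, h⟩
    simp [h4, Ne.symm h4, gOff_symm (s : S) j i, hB j i]
  · have h1' : ¬ (i = j ∧ l = k) := fun h => h1 ⟨h.1, h.2.symm⟩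
    have h1'' : ¬ (j = i ∧ k = l) := fun h => h1 ⟨h.1.symm, h.2⟩
    have h3' : ¬ (j = k ∧ i = l) := fun h => h3 ⟨h.2, h.1⟩
    simp only [h1, h1', h1'', h2, h3, h3', if_false, zero_mul, mul_zero, add_zero]

/-- The difference of the two sides has summands antisymmetric in the two contracted colours, so
their double sum is zero. -/
theorem locEE_loc₂_loc₃ (a : S) :
    locEE a (loc₂ (gDiag s) (gOff (s : S)) (loc₃ (gDiag s) (gOff (s : S)) F)) =
      locEE a (loc₂ (gDiag s) (gOff (s : S)) (loc₁ (gDiag s) (gOff (s : S)) F)) := by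
  funext i j k l
  unfold locEE
  congr 1
  have e : ∀ x y : Fin N, a ^ x.1 * (a ^ y.1 * loc₂ (gDiag s) (gOff (s : S))
        (loc₃ (gDiag s) (gOff (s : S)) F) x x y y) -
      a ^ x.1 * (a ^ y.1 * loc₂ (gDiag s) (gOff (s : S))
        (loc₁ (gDiag s) (gOff (s : S)) F) x x y y) =
      a ^ x.1 * (a ^ y.1 * (gOff (s : S) x y ^ 2 * F x y y x)) -
        a ^ y.1 * (a ^ x.1 * (gOff (s : S) y x ^ 2 * F y x x y)) := by
    intro x y
    simp only [loc₁, loc₂, loc₃, gDiag_self, gOff_self, gOff_symm (s : S) y x]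
    ring
  rw [← sub_eq_zero]
  simp only [← Finset.sum_sub_distrib, e]
  simp only [Finset.sum_sub_distrib]
  rw [Finset.sum_comm (f := fun x y : Fin N =>
    a ^ y.1 * (a ^ x.1 * (gOff (s : S) y x ^ 2 * F y x x y))), sub_self]

theorem loc₁_inv : loc₁ (gDiag s) (gOff (s : S)) (loc₁ (gInvDiag s) (gOff (↑s⁻¹ : S)) F) = F := by
  have hs : (s : S) * (↑s⁻¹ : S) = 1 := s.mul_inv
  funext i j k l
  simp only [loc₁]
  rcases lt_trichotomy i.1 j.1 with h | h | h
  · simp only [gDiag, gInvDiag, gOff, h, h.ne, h.ne', h.not_gt, if_true, if_false]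
    linear_combination F i j k l * hs
  · obtain rfl := Fin.ext h
    simp only [gDiag, gInvDiag, gOff, if_true]
    linear_combination F i i k l * ((s : S) * (↑s⁻¹ : S) + 1) * hs
  · simp only [gDiag, gInvDiag, gOff, h, h.ne, h.ne', h.not_gt, if_true, if_false]
    linear_combination (F i j k l + F j i k l * ((s : S) + (↑s⁻¹ : S))) * hs

theorem loc₁_inv' : loc₁ (gInvDiag s) (gOff (↑s⁻¹ : S)) (loc₁ (gDiag s) (gOff (s : S)) F) = F := by
  have hs : (s : S) * (↑s⁻¹ : S) = 1 := s.mul_inv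
  funext i j k l
  simp only [loc₁]
  rcases lt_trichotomy i.1 j.1 with h | h | h
  · simp only [gDiag, gInvDiag, gOff, h, h.ne, h.ne', h.not_gt, if_true, if_false]
    linear_combination (F i j k l + F j i k l * ((s : S) + (↑s⁻¹ : S))) * hs
  · obtain rfl := Fin.ext h
    simp only [gDiag, gInvDiag, gOff, if_true]
    linear_combination F i i k l * ((s : S) * (↑s⁻¹ : S) + 1) * hs
  · simp only [gDiag, gInvDiag, gOff, h, h.ne, h.ne', h.not_gt, if_true, if_false]
    linear_combination F i j k l * hs

theorem loc₂_inv : loc₂ (gDiag s) (gOff (s : S)) (loc₂ (gInvDiag s) (gOff (↑s⁻¹ : S)) F) = F := by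
  funext i j k l
  exact congrFun (congrFun (congrFun (congrFun
    (loc₁_inv s fun a b c d => F c a b d) j) k) i) l

theorem loc₃_loc₁_comm (A B A' B' : ℕ → ℕ → S) :
    loc₃ A B (loc₁ A' B' F) = loc₁ A' B' (loc₃ A B F) := by
  funext i j k l
  simp only [loc₁, loc₃]
  ring

theorem mid_locEE (a : S) : loc₂ (gDiag s) (gOff (s : S)) (loc₃ (gDiag s) (gOff (s : S))
    (loc₁ (gInvDiag s) (gOff (↑s⁻¹ : S)) (loc₂ (gInvDiag s) (gOff (↑s⁻¹ : S)) (locEE a F)))) =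
      locEE a F := by
  rw [loc₃_loc₁_comm, loc₃_loc₂_locEE _ _ _ _ (gOff_symm _), loc₁_inv', loc₂_inv]

theorem locEE_mid (a : S) : locEE a (loc₂ (gDiag s) (gOff (s : S)) (loc₃ (gDiag s) (gOff (s : S))
    (loc₁ (gInvDiag s) (gOff (↑s⁻¹ : S)) (loc₂ (gInvDiag s) (gOff (↑s⁻¹ : S)) F)))) =
      locEE a F := by
  rw [locEE_loc₂_loc₃, loc₁_inv, loc₂_inv]

end LocalOperators

/-! ### The operators on tensor space -/

section TensorSpace

variable {S : Type*} [CommRing S] {n N : ℕ}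

/-- The operator on tensor space with local coefficients `A`, `B` at the positions exchanged by
`s_j`. -/
def exchange (A B : ℕ → ℕ → S) (j : SIndex n) : Module.End S ((Fin n → Fin N) → S) where
  toFun f x := A (x j.lo) (x j.hi) * f x + B (x j.lo) (x j.hi) * f (x ∘ sgen j)
  map_add' f f' := by funext x; simp only [Pi.add_apply]; ring
  map_smul' a f := by funext x; simp only [Pi.smul_apply, smul_eq_mul, RingHom.id_apply]; ring

theorem exchange_apply (A B : ℕ → ℕ → S) (j : SIndex n) (f : (Fin n → Fin N) → S)
    (x : Fin n → Fin N) : exchange A B j f x =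
      A (x j.lo) (x j.hi) * f x + B (x j.lo) (x j.hi) * f (x ∘ sgen j) := rfl

/-- Replace the first two colours by `c`. -/
def putPair (x : Fin n → Fin N) (c : Fin N) : Fin n → Fin N := fun m => if m.1 < 2 then c else x m

/-- The contraction of the first two positions. -/
def contract (hn : 2 ≤ n) (a : S) : Module.End S ((Fin n → Fin N) → S) where
  toFun f x := if x ⟨0, by omega⟩ = x ⟨1, hn⟩ then ∑ c : Fin N, a ^ c.1 * f (putPair x c) else 0
  map_add' f f' := by
    funext x; simp only [Pi.add_apply, mul_add, Finset.sum_add_distrib]; split_ifs <;> simp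
  map_smul' b f := by
    funext x
    simp only [Pi.smul_apply, smul_eq_mul, RingHom.id_apply, mul_ite, mul_zero, Finset.mul_sum]
    split_ifs
    · exact Finset.sum_congr rfl fun c _ => by ring
    · rfl

theorem contract_apply (hn : 2 ≤ n) (a : S) (f : (Fin n → Fin N) → S) (x : Fin n → Fin N) :
    contract hn a f x =
      if x ⟨0, by omega⟩ = x ⟨1, hn⟩ then ∑ c : Fin N, a ^ c.1 * f (putPair x c) else 0 := rfl

/-- Replace the colours at the positions `p, p+1, p+2, p+3`. -/
def put (p : ℕ) (x : Fin n → Fin N) (i j k l : Fin N) : Fin n → Fin N := fun m =>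
  if m.1 = p then i else if m.1 = p + 1 then j else if m.1 = p + 2 then k else
    if m.1 = p + 3 then l else x m

/-- Restriction to the positions `p, p+1, p+2, p+3`. -/
def restr (p : ℕ) (x : Fin n → Fin N) (f : (Fin n → Fin N) → S) : Quad S N := fun i j k l =>
  f (put p x i j k l)

theorem exists_put {p : ℕ} (hp : p < n) (x : Fin n → Fin N) :
    ∃ i j k l, x = put p x i j k l := by
  -- Positions beyond the last one receive a dummy colour, which `put` never uses.
  let y : ℕ → Fin N := fun m => if h : m < n then x ⟨m, h⟩ else x ⟨p, hp⟩
  refine ⟨y p, y (p + 1), y (p + 2), y (p + 3), funext fun m => ?_⟩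
  have hy : y m.1 = x m := dif_pos m.2
  unfold put
  split_ifs with h1 h2 h3 h4
  · rw [← h1, hy]
  · rw [← h2, hy]
  · rw [← h3, hy]
  · rw [← h4, hy]
  · rfl

/-- Operator identities can thus be verified on four consecutive positions. The window may extend
past the end, since `put` only affects existing positions. -/
theorem ext_restr {p : ℕ} (hp : p < n) {f f' : (Fin n → Fin N) → S}
    (h : ∀ x, restr p x f = restr p x f') : f = f' := by
  funext x
  obtain ⟨i, j, k, l, e⟩ := exists_put hp x
  rw [e]
  exact congrFun (congrFun (congrFun (congrFun (h x) i) j) k) l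

theorem restr_exchange₁ (A B : ℕ → ℕ → S) {p : ℕ} (h : 1 ≤ p + 1 ∧ p + 1 < n)
    (x : Fin n → Fin N) (f : (Fin n → Fin N) → S) :
    restr p x (exchange A B ⟨p + 1, h⟩ f) = loc₁ A B (restr p x f) := by
  funext i j k l
  have e : put p x i j k l ∘ sgen ⟨p + 1, h⟩ = put p x j i k l := by
    funext m
    simp only [Function.comp_apply, put, sgen_apply_val]
    split_ifs <;> first | omega | rfl | skip
    rw [sgen_apply_of_ne] <;> simp only [ne_eq, Fin.ext_iff, SIndex.lo, SIndex.hi] <;> omega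
  simp only [restr, exchange_apply, loc₁, e]
  congr 2 <;> simp [put, SIndex.lo, SIndex.hi]

theorem restr_exchange₂ (A B : ℕ → ℕ → S) {p : ℕ} (h : 1 ≤ p + 2 ∧ p + 2 < n)
    (x : Fin n → Fin N) (f : (Fin n → Fin N) → S) :
    restr p x (exchange A B ⟨p + 2, h⟩ f) = loc₂ A B (restr p x f) := by
  funext i j k l
  have e : put p x i j k l ∘ sgen ⟨p + 2, h⟩ = put p x i k j l := by
    funext m
    simp only [Function.comp_apply, put, sgen_apply_val]
    split_ifs <;> first | omega | rfl | skip
    rw [sgen_apply_of_ne] <;> simp only [ne_eq, Fin.ext_iff, SIndex.lo, SIndex.hi] <;> omega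
  simp only [restr, exchange_apply, loc₂, e]
  congr 2 <;> simp [put, SIndex.lo, SIndex.hi]

theorem restr_exchange₃ (A B : ℕ → ℕ → S) {p : ℕ} (h : 1 ≤ p + 3 ∧ p + 3 < n)
    (x : Fin n → Fin N) (f : (Fin n → Fin N) → S) :
    restr p x (exchange A B ⟨p + 3, h⟩ f) = loc₃ A B (restr p x f) := by
  funext i j k l
  have e : put p x i j k l ∘ sgen ⟨p + 3, h⟩ = put p x i j l k := by
    funext m
    simp only [Function.comp_apply, put, sgen_apply_val]
    split_ifs <;> first | omega | rfl | skip
    rw [sgen_apply_of_ne] <;> simp only [ne_eq, Fin.ext_iff, SIndex.lo, SIndex.hi] <;> omega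
  simp only [restr, exchange_apply, loc₃, e]
  congr 2 <;> simp [put, SIndex.lo, SIndex.hi]

theorem restr_contract (hn : 2 ≤ n) (a : S) (x : Fin n → Fin N) (f : (Fin n → Fin N) → S) :
    restr 0 x (contract hn a f) = locE a (restr 0 x f) := by
  funext i j k l
  have e : ∀ c, putPair (put 0 x i j k l) c = put 0 x c c k l := by
    intro c
    funext m
    simp only [putPair, put]
    split_ifs <;> first | omega | rfl
  simp only [restr, contract_apply, locE, e]
  simp [put]

theorem restr_smul (p : ℕ) (x : Fin n → Fin N) (a : S) (f : (Fin n → Fin N) → S) :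
    restr p x (a • f) = fun i j k l => a * restr p x f i j k l := rfl

theorem restr_add (p : ℕ) (x : Fin n → Fin N) (f f' : (Fin n → Fin N) → S) :
    restr p x (f + f') = fun i j k l => restr p x f i j k l + restr p x f' i j k l := rfl

theorem exchange_inv (s : Sˣ) (j : SIndex n) :
    (↑s⁻¹ : S) ^ 2 • exchange (N := N) (gDiag s) (gOff (s : S)) j + ((↑s⁻¹ : S) ^ 2 - 1) • 1 =
      exchange (gInvDiag s) (gOff (↑s⁻¹ : S)) j := by
  have hs : (s : S) * (↑s⁻¹ : S) = 1 := s.mul_inv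
  refine LinearMap.ext fun f => funext fun x => ?_
  simp only [LinearMap.add_apply, LinearMap.smul_apply, Pi.add_apply, Pi.smul_apply, smul_eq_mul,
    exchange_apply, Module.End.one_apply]
  rcases lt_trichotomy (x j.lo).1 (x j.hi).1 with h | h | h
  · simp only [gDiag, gInvDiag, gOff, h, h.ne, h.not_gt, if_true, if_false]
    linear_combination (↑s⁻¹ : S) * f (x ∘ sgen j) * hs
  · simp only [gDiag, gInvDiag, gOff, h, if_true]
    linear_combination f x * ((s : S) * (↑s⁻¹ : S) + 1) * hs
  · simp only [gDiag, gInvDiag, gOff, h, h.ne', h.not_gt, if_true, if_false]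
    linear_combination f x * ((s : S) * (↑s⁻¹ : S) + 1) * hs + (↑s⁻¹ : S) * f (x ∘ sgen j) * hs

theorem exchange_comm (A B : ℕ → ℕ → S) {i j : SIndex n} (h : i.1 + 1 < j.1) :
    exchange (N := N) A B i * exchange A B j = exchange A B j * exchange A B i := by
  refine LinearMap.ext fun f => funext fun x => ?_
  have c := sgen_comm i j (Or.inl h)
  have e1 : sgen i j.lo = j.lo := sgen_apply_of_ne _
    (by simp only [ne_eq, Fin.ext_iff, SIndex.lo, SIndex.hi]; omega)
    (by simp only [ne_eq, Fin.ext_iff, SIndex.lo, SIndex.hi]; omega)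
  have e2 : sgen i j.hi = j.hi := sgen_apply_of_ne _
    (by simp only [ne_eq, Fin.ext_iff, SIndex.lo, SIndex.hi]; omega)
    (by simp only [ne_eq, Fin.ext_iff, SIndex.lo, SIndex.hi]; omega)
  have e3 : sgen j i.lo = i.lo := sgen_apply_of_ne _
    (by simp only [ne_eq, Fin.ext_iff, SIndex.lo, SIndex.hi]; omega)
    (by simp only [ne_eq, Fin.ext_iff, SIndex.lo, SIndex.hi]; omega)
  have e4 : sgen j i.hi = i.hi := sgen_apply_of_ne _
    (by simp only [ne_eq, Fin.ext_iff, SIndex.lo, SIndex.hi]; omega)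
    (by simp only [ne_eq, Fin.ext_iff, SIndex.lo, SIndex.hi]; omega)
  have e5 : (x ∘ sgen i) ∘ sgen j = (x ∘ sgen j) ∘ sgen i := by
    funext m
    exact congrArg x (Equiv.congr_fun c m)
  simp only [Module.End.mul_apply, exchange_apply, Function.comp_apply, e1, e2, e3, e4, e5]
  ring

theorem contract_exchange_comm (hn : 2 ≤ n) (a : S) (A B : ℕ → ℕ → S) {j : SIndex n}
    (h : 2 < j.1) :
    contract (N := N) hn a * exchange A B j = exchange A B j * contract hn a := by
  refine LinearMap.ext fun f => funext fun x => ?_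
  have e1 : sgen j ⟨0, by omega⟩ = ⟨0, by omega⟩ := sgen_apply_of_ne _
    (by simp only [ne_eq, Fin.ext_iff, SIndex.lo]; omega)
    (by simp only [ne_eq, Fin.ext_iff, SIndex.hi]; omega)
  have e2 : sgen j ⟨1, hn⟩ = ⟨1, hn⟩ := sgen_apply_of_ne _
    (by simp only [ne_eq, Fin.ext_iff, SIndex.lo]; omega)
    (by simp only [ne_eq, Fin.ext_iff, SIndex.hi]; omega)
  have e3 : ∀ c, putPair x c j.lo = x j.lo := fun c => if_neg (by simp only [SIndex.lo]; omega)
  have e4 : ∀ c, putPair x c j.hi = x j.hi := fun c => if_neg (by simp only [SIndex.hi]; omega)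
  have e5 : ∀ c, putPair x c ∘ sgen j = putPair (x ∘ sgen j) c := by
    intro c
    funext m
    have : (sgen j m).1 < 2 ↔ m.1 < 2 := by
      rw [sgen_apply_val]; split_ifs <;> omega
    simp only [putPair, Function.comp_apply, this]
  simp only [Module.End.mul_apply, exchange_apply, contract_apply, Function.comp_apply, e1, e2, e3,
    e4, e5, mul_add, Finset.sum_add_distrib, mul_ite, mul_zero, Finset.mul_sum]
  split_ifs
  · congr 1 <;> exact Finset.sum_congr rfl fun c _ => by ring
  · simp

/-- The representation of the q-Brauer algebra on tensor space. -/
def tensorSystem (hn : 2 ≤ n) (s δ : Sˣ) (N : ℕ)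
    (hδ : (δ : S) = ∑ c ∈ Finset.range N, ((s : S) ^ 2) ^ c) :
    QSystem n (s ^ 2) ((s ^ 2) ^ N) δ (Module.End S ((Fin n → Fin N) → S)) where
  g j := if h : 1 ≤ j ∧ j < n then exchange (gDiag s) (gOff (s : S)) ⟨j, h⟩ else 1
  e := contract hn ((s : S) ^ 2)
  sq j h1 h2 := by
    obtain ⟨p, rfl⟩ := Nat.exists_eq_add_of_le' h1
    rw [dif_pos ⟨h1, h2⟩]
    refine LinearMap.ext fun f => ext_restr (p := p) (by omega) fun x => ?_
    simp only [Module.End.mul_apply, LinearMap.add_apply, LinearMap.smul_apply, restr_add,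
      restr_smul, restr_exchange₁, loc_sq, Module.End.one_apply, Units.val_pow_eq_pow_val]
  braid j h1 h2 := by
    obtain ⟨p, rfl⟩ := Nat.exists_eq_add_of_le' h1
    rw [dif_pos ⟨h1, by omega⟩, dif_pos ⟨by omega, h2⟩]
    refine LinearMap.ext fun f => ext_restr (p := p) (by omega) fun x => ?_
    simp only [Module.End.mul_apply, restr_exchange₁, restr_exchange₂, loc_braid]
  comm i j h1 h2 h3 := by
    rw [dif_pos ⟨h1, by omega⟩, dif_pos ⟨by omega, h3⟩]
    exact exchange_comm _ _ h2
  e_sq := by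
    refine LinearMap.ext fun f => ext_restr (p := 0) (by omega) fun x => ?_
    simp only [Module.End.mul_apply, LinearMap.smul_apply, restr_smul, restr_contract,
      locE_sq s _ hδ]
  e_comm i h1 h2 := by
    rw [dif_pos ⟨by omega, h2⟩]
    exact contract_exchange_comm hn _ _ _ h1
  e_g_one h := by
    rw [dif_pos ⟨le_rfl, h⟩]
    refine LinearMap.ext fun f => ext_restr (p := 0) (by omega) fun x => ?_
    simp only [Module.End.mul_apply, LinearMap.smul_apply, restr_smul, restr_contract,
      restr_exchange₁ (p := 0), locE_loc₁, Units.val_pow_eq_pow_val]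
  g_one_e h := by
    rw [dif_pos ⟨le_rfl, h⟩]
    refine LinearMap.ext fun f => ext_restr (p := 0) (by omega) fun x => ?_
    simp only [Module.End.mul_apply, LinearMap.smul_apply, restr_smul, restr_contract,
      restr_exchange₁ (p := 0), loc₁_locE, Units.val_pow_eq_pow_val]
  e_g_two_e h := by
    rw [dif_pos ⟨by omega, h⟩]
    refine LinearMap.ext fun f => ext_restr (p := 0) (by omega) fun x => ?_
    simp only [Module.End.mul_apply, LinearMap.smul_apply, restr_smul, restr_contract,
      restr_exchange₂ (p := 0), locE_loc₂_locE, Units.val_pow_eq_pow_val]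
  e_two_left h := by
    have hs : (↑(s ^ 2)⁻¹ : S) = (↑s⁻¹ : S) ^ 2 := by simp
    rw [dif_pos (show 1 ≤ 1 ∧ 1 < n by omega), dif_pos (show 1 ≤ 2 ∧ 2 < n by omega),
      dif_pos (show 1 ≤ 3 ∧ 3 < n by omega), hs,
      exchange_inv, exchange_inv]
    refine LinearMap.ext fun f => ext_restr (p := 0) (by omega) fun x => ?_
    simp only [Module.End.mul_apply, restr_contract, restr_exchange₁ (p := 0),
      restr_exchange₂ (p := 0), restr_exchange₃ (p := 0), locE_mid_locE, mid_locEE]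
  e_two_right h := by
    have hs : (↑(s ^ 2)⁻¹ : S) = (↑s⁻¹ : S) ^ 2 := by simp
    rw [dif_pos (show 1 ≤ 1 ∧ 1 < n by omega), dif_pos (show 1 ≤ 2 ∧ 2 < n by omega),
      dif_pos (show 1 ≤ 3 ∧ 3 < n by omega), hs,
      exchange_inv, exchange_inv]
    refine LinearMap.ext fun f => ext_restr (p := 0) (by omega) fun x => ?_
    simp only [Module.End.mul_apply, restr_contract, restr_exchange₁ (p := 0),
      restr_exchange₂ (p := 0), restr_exchange₃ (p := 0), locE_mid_locE, locEE_mid]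

end TensorSpace

/-! ### Functoriality -/

namespace QSystem

section Map

variable {n : ℕ} {R R' : Type*} [CommRing R] [CommRing R'] {q r δ : Rˣ} {q' r' δ' : R'ˣ}
  {T T' : Type*} [Ring T] [Algebra R T] [Ring T'] [Algebra R' T']
  (D : QSystem n q r δ T) (D' : QSystem n q' r' δ' T')

theorem map_gw (f : T →+* T') (hg : ∀ j, 1 ≤ j → j < n → f (D.g j) = D'.g j)
    (l : List (SIndex n)) : f (D.gw l) = D'.gw l := by
  rw [gw, gw, map_list_prod, List.map_map]
  exact congrArg _ (List.map_congr_left fun j _ => hg j.1 j.2.1 j.2.2)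

theorem map_gT (f : T →+* T') (hg : ∀ j, 1 ≤ j → j < n → f (D.g j) = D'.g j)
    (ω : Equiv.Perm (Fin n)) : f (D.gT ω) = D'.gT ω :=
  D.map_gw D' f hg _

theorem map_ascProd {M M' : Type*} [Monoid M] [Monoid M'] (f : M →* M') (u : ℕ → M) (v : ℕ → M')
    {a b : ℕ} (h : ∀ j, a ≤ j → j ≤ b → f (u j) = v j) : f (ascProd u a b) = ascProd v a b := by
  rw [ascProd, map_list_prod, List.map_map]
  exact ascProd_congr (f := f ∘ u) h

theorem map_h (f : T →+* T') (φ : R →+* R') (hf : ∀ (a : R) (x : T), f (a • x) = φ a • f x)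
    (hq : Units.map φ q = q') {j : ℕ} (hg : f (D.g j) = D'.g j) : f (D.h j) = D'.h j := by
  have e : φ (↑q⁻¹ : R) = (↑q'⁻¹ : R') := by rw [← hq]; rfl
  rw [h, h, map_add, hf, hf, hg, map_one, map_sub, map_one, e]

theorem map_eK (f : T →+* T') (φ : R →+* R') (hf : ∀ (a : R) (x : T), f (a • x) = φ a • f x)
    (hq : Units.map φ q = q') (hg : ∀ j, 1 ≤ j → j < n → f (D.g j) = D'.g j)
    (he : f D.e = D'.e) {k : ℕ} (hk : 2 * k ≤ n) : f (D.eK k) = D'.eK k := by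
  induction k with
  | zero => exact map_one f
  | succ k ih =>
    rw [eK_succ, eK_succ, map_mul, map_mul, he, ih (by omega), W, W, map_mul]
    congr 2
    congr 1
    · exact map_ascProd (f : T →* T') _ _ fun j h1 h2 => hg j (by omega) (by omega)
    · exact map_ascProd (f : T →* T') _ _ fun j h1 h2 =>
        D.map_h D' f φ hf hq (hg j h1 (by omega))

/-- The element `g_d`. -/
noncomputable def gD (d : BrauerDiagram n) : T :=
  D.gT (exists_isReducedExpression d).choose_spec.choose *
    D.eK (exists_isReducedExpression d).choose *
    D.gT (exists_isReducedExpression d).choose_spec.choose_spec.choose *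
    D.gT (exists_isReducedExpression d).choose_spec.choose_spec.choose_spec.choose

theorem gD_eq {d : BrauerDiagram n} {k : ℕ} {ω₁ σ ω₂ : Equiv.Perm (Fin n)}
    (h : IsReducedExpression d k ω₁ σ ω₂) : D.gD d = D.gT ω₁ * D.eK k * D.gT σ * D.gT ω₂ := by
  obtain ⟨e1, e2, e3, e4⟩ := h.unique
    (exists_isReducedExpression d).choose_spec.choose_spec.choose_spec.choose_spec
  rw [e1, e2, e3, e4, gD]

theorem map_gD (f : T →+* T') (φ : R →+* R') (hf : ∀ (a : R) (x : T), f (a • x) = φ a • f x)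
    (hq : Units.map φ q = q') (hg : ∀ j, 1 ≤ j → j < n → f (D.g j) = D'.g j)
    (he : f D.e = D'.e) (d : BrauerDiagram n) : f (D.gD d) = D'.gD d := by
  obtain ⟨k, ω₁, σ, ω₂, h⟩ := exists_isReducedExpression d
  rw [D.gD_eq h, D'.gD_eq h, map_mul, map_mul, map_mul, D.map_eK D' f φ hf hq hg he h.le,
    D.map_gT D' f hg, D.map_gT D' f hg, D.map_gT D' f hg]

theorem span_gD : D.twoSided ≤ Submodule.span R (Set.range D.gD) := by
  refine D.twoSided_le.trans (Submodule.span_mono ?_)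
  rintro _ ⟨k, ω₁, σ, ω₂, h, h1, h2, h3, rfl⟩
  exact ⟨_, D.gD_eq (isReducedExpression_iff.2 ⟨h, h1, h2, h3, rfl⟩)⟩

/-- The image of a system under a semilinear ring homomorphism. -/
def map (f : T →+* T') (φ : R →+* R') (hf : ∀ (a : R) (x : T), f (a • x) = φ a • f x) :
    QSystem n (Units.map (φ : R →* R') q) (Units.map (φ : R →* R') r)
      (Units.map (φ : R →* R') δ) T' where
  g j := f (D.g j)
  e := f D.e
  sq j h1 h2 := by
    simpa [hf] using congrArg f (D.sq j h1 h2)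
  braid j h1 h2 := by
    simpa using congrArg f (D.braid j h1 h2)
  comm i j h1 h2 h3 := by
    simpa using congrArg f (D.comm i j h1 h2 h3)
  e_sq := by
    simpa [hf] using congrArg f D.e_sq
  e_comm i h1 h2 := by
    simpa using congrArg f (D.e_comm i h1 h2)
  e_g_one h := by
    simpa [hf] using congrArg f (D.e_g_one h)
  g_one_e h := by
    simpa [hf] using congrArg f (D.g_one_e h)
  e_g_two_e h := by
    simpa [hf] using congrArg f (D.e_g_two_e h)
  e_two_left h := by
    have e : φ (↑q⁻¹ : R) = (↑(Units.map (φ : R →* R') q)⁻¹ : R') := rfl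
    simpa only [hf, map_mul, map_add, map_sub, map_one, e] using congrArg f (D.e_two_left h)
  e_two_right h := by
    have e : φ (↑q⁻¹ : R) = (↑(Units.map (φ : R →* R') q)⁻¹ : R') := rfl
    simpa only [hf, map_mul, map_add, map_sub, map_one, e] using congrArg f (D.e_two_right h)

/-- A system over `R'` as a system over `R`. -/
def restrict [Algebra R T'] (φ : R →+* R') (hφ : ∀ (a : R) (x : T'), a • x = φ a • x)
    (hq : Units.map (φ : R →* R') q = q') (hr : Units.map (φ : R →* R') r = r')
    (hδ : Units.map (φ : R →* R') δ = δ') : QSystem n q r δ T' where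
  g := D'.g
  e := D'.e
  sq j h1 h2 := by
    subst hq; simpa [hφ] using D'.sq j h1 h2
  braid := D'.braid
  comm := D'.comm
  e_sq := by
    subst hδ; simpa [hφ] using D'.e_sq
  e_comm := D'.e_comm
  e_g_one h := by
    subst hq; simpa [hφ] using D'.e_g_one h
  g_one_e h := by
    subst hq; simpa [hφ] using D'.g_one_e h
  e_g_two_e h := by
    subst hr; simpa [hφ] using D'.e_g_two_e h
  e_two_left h := by
    subst hq
    have e : φ (↑q⁻¹ : R) = (↑(Units.map (φ : R →* R') q)⁻¹ : R') := rfl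
    simpa only [hφ, map_sub, map_one, e] using D'.e_two_left h
  e_two_right h := by
    subst hq
    have e : φ (↑q⁻¹ : R) = (↑(Units.map (φ : R →* R') q)⁻¹ : R') := rfl
    simpa only [hφ, map_sub, map_one, e] using D'.e_two_right h

end Map

end QSystem

/-! ### The q-Brauer algebra as a system -/

section Canonical

variable {R : Type*} [CommRing R] (n : ℕ) (q r δ : Rˣ)

theorem gInvElt_eq (j : SIndex n) : gInvElt n q r δ j =
    (↑q⁻¹ : R) • gElt n q r δ j + ((↑q⁻¹ : R) - 1) • 1 := by
  simp [gInvElt, gElt, freeGInv]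

theorem gNat_eq {j : ℕ} (h1 : 1 ≤ j) (h2 : j < n) : gNat n q r δ j = gElt n q r δ ⟨j, h1, h2⟩ :=
  dif_pos ⟨h1, h2⟩

/-- The generators of the q-Brauer algebra. -/
noncomputable def canonicalSystem : QSystem n q r δ (QBr n q r δ) where
  g := gNat n q r δ
  e := eElt n q r δ
  sq j h1 h2 := by
    rw [gNat_eq n q r δ h1 h2]; exact gElt_sq n q r δ _
  braid j h1 h2 := by
    rw [gNat_eq n q r δ h1 (by omega), gNat_eq n q r δ (by omega) h2]
    simpa [gElt] using RingQuot.mkAlgHom_rel R (Rel.braid (q := q) (r := r) (δ := δ)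
      (⟨j, h1, by omega⟩ : SIndex n) ⟨j + 1, by omega, h2⟩ rfl)
  comm i j h1 h2 h3 := by
    rw [gNat_eq n q r δ h1 (by omega), gNat_eq n q r δ (by omega) h3]
    simpa [gElt] using RingQuot.mkAlgHom_rel R (Rel.comm (q := q) (r := r) (δ := δ)
      (⟨i, h1, by omega⟩ : SIndex n) ⟨j, by omega, h3⟩ (Or.inl h2))
  e_sq := by
    simpa [eElt] using RingQuot.mkAlgHom_rel R (Rel.e_sq (n := n) (q := q) (r := r) (δ := δ))
  e_comm i h1 h2 := by
    rw [gNat_eq n q r δ (by omega) h2]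
    simpa [gElt, eElt] using RingQuot.mkAlgHom_rel R (Rel.e_comm (q := q) (r := r) (δ := δ)
      (⟨i, by omega, h2⟩ : SIndex n) h1)
  e_g_one h := by
    rw [gNat_eq n q r δ le_rfl h]
    simpa [gElt, eElt] using RingQuot.mkAlgHom_rel R (Rel.e_g_one (q := q) (r := r) (δ := δ)
      (⟨1, le_rfl, h⟩ : SIndex n) rfl)
  g_one_e h := by
    rw [gNat_eq n q r δ le_rfl h]
    simpa [gElt, eElt] using RingQuot.mkAlgHom_rel R (Rel.g_one_e (q := q) (r := r) (δ := δ)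
      (⟨1, le_rfl, h⟩ : SIndex n) rfl)
  e_g_two_e h := by
    rw [gNat_eq n q r δ (by omega) h]
    simpa [gElt, eElt] using RingQuot.mkAlgHom_rel R (Rel.e_g_two_e (q := q) (r := r) (δ := δ)
      (⟨2, by omega, h⟩ : SIndex n) rfl)
  e_two_left h := by
    rw [gNat_eq n q r δ le_rfl (by omega), gNat_eq n q r δ (j := 2) (by omega) (by omega),
      gNat_eq n q r δ (by omega) h]
    simpa only [map_mul, map_add, map_smul, map_one, freeMid, freeGInv, gElt, eElt] using
      RingQuot.mkAlgHom_rel R (Rel.e_two_left (q := q) (r := r) (δ := δ)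
        (⟨1, by omega, by omega⟩ : SIndex n) ⟨2, by omega, by omega⟩ ⟨3, by omega, h⟩ rfl rfl rfl)
  e_two_right h := by
    rw [gNat_eq n q r δ le_rfl (by omega), gNat_eq n q r δ (j := 2) (by omega) (by omega),
      gNat_eq n q r δ (by omega) h]
    simpa only [map_mul, map_add, map_smul, map_one, freeMid, freeGInv, gElt, eElt] using
      RingQuot.mkAlgHom_rel R (Rel.e_two_right (q := q) (r := r) (δ := δ)
        (⟨1, by omega, by omega⟩ : SIndex n) ⟨2, by omega, by omega⟩ ⟨3, by omega, h⟩ rfl rfl rfl)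

theorem gWord_eq (l : List (SIndex n)) : gWord n q r δ l = (canonicalSystem n q r δ).gw l :=
  congrArg List.prod (List.map_congr_left fun j _ => (gNat_eq n q r δ j.2.1 j.2.2).symm)

theorem gPerm_eq (ω : Equiv.Perm (Fin n)) : gPerm n q r δ ω = (canonicalSystem n q r δ).gT ω :=
  gWord_eq n q r δ _

theorem eK_eq {k : ℕ} (hk : 2 * k ≤ n) : eK n q r δ k = (canonicalSystem n q r δ).eK k := by
  induction k using Nat.strong_induction_on with
  | _ k ih =>
  rcases k with _ | _ | k
  · rfl
  · exact (canonicalSystem n q r δ).eK_one.symm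
  · rw [eK, ih (k + 1) (by omega) (by omega), QSystem.eK_succ _ (k + 1), QSystem.W, ← mul_assoc]
    congr 2
    refine ascProd_congr (f := gInvNat n q r δ) fun j h1 h2 => ?_
    rw [gInvNat, dif_pos ⟨h1, by omega⟩, gInvElt_eq, ← gNat_eq n q r δ h1 (by omega)]
    rfl

theorem adjoin_canonicalSystem :
    Algebra.adjoin R ({(canonicalSystem n q r δ).e} ∪
      (canonicalSystem n q r δ).g '' {j | 1 ≤ j ∧ j < n}) = ⊤ := by
  rw [eq_top_iff, ← (AlgHom.range_eq_top (RingQuot.mkAlgHom R (Rel n q r δ))).2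
    (RingQuot.mkAlgHom_surjective R _), ← Algebra.map_top, ← FreeAlgebra.adjoin_range_ι,
    AlgHom.map_adjoin]
  refine Algebra.adjoin_mono ?_
  rintro _ ⟨_, ⟨j | _, rfl⟩, rfl⟩
  · exact Or.inr ⟨j.1, j.2, gNat_eq n q r δ j.2.1 j.2.2⟩
  · exact Or.inl rfl

theorem span_gD_eq_top (hn : 2 ≤ n) :
    Submodule.span R (Set.range (canonicalSystem n q r δ).gD) = ⊤ := by
  refine eq_top_iff.2 fun x _ => QSystem.span_gD _ ((canonicalSystem n q r δ).adjoin_le_twoSided hn ?_)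
  rw [adjoin_canonicalSystem]
  trivial

variable {n q r δ}

/-- The coefficient is q⁻¹ r + (q⁻¹ - 1) δ = q⁻¹ (r - δ(q - 1)) = q⁻¹. -/
theorem QSystem.e_h_two_e {T : Type*} [Ring T] [Algebra R T] (D : QSystem n q r δ T)
    (hδ : (r : R) - 1 = (δ : R) * ((q : R) - 1)) (h : 2 < n) :
    D.e * D.h 2 * D.e = (↑q⁻¹ : R) • D.e := by
  have hq : (↑q⁻¹ : R) * (q : R) = 1 := q.inv_mul
  rw [QSystem.h, mul_add, add_mul, mul_smul_comm, smul_mul_assoc, D.e_g_two_e h, mul_smul_comm,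
    smul_mul_assoc, mul_one, D.e_sq, smul_smul, smul_smul, ← add_smul]
  congr 1
  linear_combination (↑q⁻¹ : R) * hδ + (δ : R) * hq

/-- A system in an algebra defines a representation of the q-Brauer algebra. -/
noncomputable def QSystem.lift {T : Type*} [Ring T] [Algebra R T] (D : QSystem n q r δ T)
    (hδ : (r : R) - 1 = (δ : R) * ((q : R) - 1)) : QBr n q r δ →ₐ[R] T :=
  RingQuot.liftAlgHom R ⟨FreeAlgebra.lift R fun x => match x with
    | Gen.g j => D.g j.1
    | Gen.e => D.e, by
    intro x y hxy
    cases hxy with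
    | quadratic j => simpa [freeG] using D.sq j.1 j.2.1 j.2.2
    | braid i j hij =>
      have := D.braid i.1 i.2.1 (hij ▸ j.2.2)
      rw [← hij] at this
      simpa [freeG] using this
    | comm i j hij =>
      simpa [freeG] using (D.commute_g i.2.1 j.2.1 i.2.2 j.2.2 hij).eq
    | e_sq => simpa [freeE] using D.e_sq
    | e_comm i hi => simpa [freeE, freeG] using D.e_comm i.1 hi i.2.2
    | e_g_one i hi =>
      have := D.e_g_one (hi ▸ i.2.2)
      rw [← hi] at this
      simpa [freeE, freeG] using this
    | g_one_e i hi =>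
      have := D.g_one_e (hi ▸ i.2.2)
      rw [← hi] at this
      simpa [freeE, freeG] using this
    | e_g_two_e i hi =>
      have := D.e_g_two_e (hi ▸ i.2.2)
      rw [← hi] at this
      simpa [freeE, freeG] using this
    | e_g_two_inv_e i hi =>
      have := D.e_h_two_e hδ (hi ▸ i.2.2)
      rw [← hi] at this
      simpa only [freeE, freeG, freeGInv, map_mul, map_add, map_smul, map_one,
        FreeAlgebra.lift_ι_apply, QSystem.h] using this
    | e_two_left i₁ i₂ i₃ h₁ h₂ h₃ =>
      have := D.e_two_left (h₃ ▸ i₃.2.2)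
      simpa only [freeE, freeG, freeGInv, freeMid, map_mul, map_add, map_smul, map_one,
        FreeAlgebra.lift_ι_apply, h₁, h₂, h₃] using this
    | e_two_right i₁ i₂ i₃ h₁ h₂ h₃ =>
      have := D.e_two_right (h₃ ▸ i₃.2.2)
      simpa only [freeE, freeG, freeGInv, freeMid, map_mul, map_add, map_smul, map_one,
        FreeAlgebra.lift_ι_apply, h₁, h₂, h₃] using this⟩

theorem QSystem.lift_gD {T : Type*} [Ring T] [Algebra R T] (D : QSystem n q r δ T)
    (hδ : (r : R) - 1 = (δ : R) * ((q : R) - 1)) (d : BrauerDiagram n) :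
    D.lift hδ ((canonicalSystem n q r δ).gD d) = D.gD d := by
  refine (canonicalSystem n q r δ).map_gD D (D.lift hδ : QBr n q r δ →+* T) (RingHom.id R)
    (fun a x => map_smul (D.lift hδ) a x) (Units.ext rfl) (fun j h1 h2 => ?_) ?_ d
  · change D.lift hδ (gNat n q r δ j) = _
    rw [gNat_eq n q r δ h1 h2, gElt, freeG, QSystem.lift, RingQuot.liftAlgHom_mkAlgHom_apply,
      FreeAlgebra.lift_ι_apply]
  · change D.lift hδ (eElt n q r δ) = _
    rw [eElt, freeE, QSystem.lift, RingQuot.liftAlgHom_mkAlgHom_apply, FreeAlgebra.lift_ι_apply]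

end Canonical

/-! ### Specialization of the representation on tensor space at `q = 1` -/

section Residue

variable {S K : Type*} [CommRing S] [CommRing K] {n N : ℕ}

/-- Permutation of the tensor factors. -/
def permHom (K : Type*) [CommRing K] (n N : ℕ) :
    Equiv.Perm (Fin n) →* Module.End K ((Fin n → Fin N) → K) where
  toFun ω := LinearMap.funLeft K K fun x => x ∘ ω
  map_one' := rfl
  map_mul' _ _ := rfl

theorem permHom_apply (ω : Equiv.Perm (Fin n)) (f : (Fin n → Fin N) → K) (x : Fin n → Fin N) :
    permHom K n N ω f x = f (x ∘ ω) := rfl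

/-- Reduction of the matrix entries of an operator on tensor space. -/
noncomputable def residueHom (c : S →+* K) :
    Module.End S ((Fin n → Fin N) → S) →+* Module.End K ((Fin n → Fin N) → K) :=
  ((Matrix.toLinAlgEquiv' (R := K) (n := Fin n → Fin N)).toRingEquiv.toRingHom.comp
    c.mapMatrix).comp (LinearMap.toMatrixAlgEquiv' (R := S) (n := Fin n → Fin N)).toRingEquiv.toRingHom

theorem residueHom_apply (c : S →+* K) (A : Module.End S ((Fin n → Fin N) → S))
    (v : (Fin n → Fin N) → S) (x : Fin n → Fin N) : residueHom c A (c ∘ v) x = c (A v x) := by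
  have h := RingHom.map_mulVec c (LinearMap.toMatrixAlgEquiv' A) v x
  have h' : (LinearMap.toMatrixAlgEquiv' A).mulVec v = A v := by
    rw [← Matrix.toLinAlgEquiv'_apply, Matrix.toLinAlgEquiv'_toMatrixAlgEquiv']
  rw [h'] at h
  exact h.symm

theorem comp_single (c : S →+* K) (y : Fin n → Fin N) :
    c ∘ (Pi.single y 1 : (Fin n → Fin N) → S) = Pi.single y 1 := by
  funext x
  simp only [Function.comp_apply, Pi.single_apply]
  split_ifs <;> simp

theorem residueHom_eq (c : S →+* K) {A : Module.End S ((Fin n → Fin N) → S)}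
    {B : Module.End K ((Fin n → Fin N) → K)} (h : ∀ v x, B (c ∘ v) x = c (A v x)) :
    residueHom c A = B := by
  refine (Pi.basisFun K (Fin n → Fin N)).ext fun y => funext fun x => ?_
  rw [Pi.basisFun_apply, ← comp_single c, residueHom_apply, h]

theorem residueHom_smul (c : S →+* K) (a : S) (A : Module.End S ((Fin n → Fin N) → S)) :
    residueHom c (a • A) = c a • residueHom c A :=
  residueHom_eq c fun v x => by
    rw [LinearMap.smul_apply, LinearMap.smul_apply, Pi.smul_apply, residueHom_apply, Pi.smul_apply,
      smul_eq_mul, smul_eq_mul, map_mul]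

variable {c : S →+* K} {s : Sˣ}

/-- At s = 1 the diagonal coefficient vanishes for distinct colours and the off-diagonal one is 1;
for equal colours the exchange does not change the colouring. -/
theorem residueHom_exchange (hs : c s = 1) (j : SIndex n) :
    residueHom c (exchange (N := N) (gDiag s) (gOff (s : S)) j) = permHom K n N (sgen j) := by
  refine residueHom_eq c fun v x => ?_
  rw [permHom_apply, exchange_apply, map_add, map_mul, map_mul, Function.comp_apply]
  rcases lt_trichotomy (x j.lo).1 (x j.hi).1 with h | h | h
  · simp [gDiag, gOff, h.ne, h.not_gt, hs]
  · have e : x ∘ sgen j = x := by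
      funext m
      rw [Function.comp_apply]
      by_cases h1 : m = j.lo
      · rw [h1, sgen_lo, Fin.ext h]
      by_cases h2 : m = j.hi
      · rw [h2, sgen_hi, Fin.ext h]
      · rw [sgen_apply_of_ne j h1 h2]
    simp [gDiag, gOff, h, hs, e]
  · simp [gDiag, gOff, h.ne', h, hs]

theorem residueHom_contract (hn : 2 ≤ n) (hs : c s = 1) :
    residueHom c (contract (N := N) hn ((s : S) ^ 2)) = contract hn 1 := by
  refine residueHom_eq c fun v x => ?_
  rw [contract_apply, contract_apply]
  split_ifs <;> simp [hs]

variable (hn : 2 ≤ n) {δ : Sˣ} (hδ : (δ : S) = ∑ c ∈ Finset.range N, ((s : S) ^ 2) ^ c)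

theorem residueHom_g (hs : c s = 1) {j : ℕ} (h1 : 1 ≤ j) (h2 : j < n) :
    residueHom c ((tensorSystem hn s δ N hδ).g j) = permHom K n N (sNat n j) := by
  rw [sNat, dif_pos ⟨h1, h2⟩, ← residueHom_exchange hs]
  congr 1
  exact dif_pos ⟨h1, h2⟩

theorem residueHom_h (hs : c s = 1) {j : ℕ} (h1 : 1 ≤ j) (h2 : j < n) :
    residueHom c ((tensorSystem hn s δ N hδ).h j) = permHom K n N (sNat n j) := by
  have e : c (↑(s ^ 2)⁻¹ : S) = 1 := by
    have : (s : S) ^ 2 * (↑(s ^ 2)⁻¹ : S) = 1 := by rw [← Units.val_pow_eq_pow_val, Units.mul_inv]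
    simpa [hs] using congrArg c this
  rw [QSystem.h, map_add, residueHom_smul, residueHom_smul, residueHom_g hn hδ hs h1 h2, map_sub, e,
    map_one, one_smul, sub_self, zero_smul, add_zero]

theorem residueHom_gT (hs : c s = 1) (ω : Equiv.Perm (Fin n)) :
    residueHom c ((tensorSystem hn s δ N hδ).gT ω) = permHom K n N ω := by
  have h := (exists_reducedWord ω).choose_spec.1
  conv_rhs => rw [← h]
  rw [QSystem.gT, QSystem.gw, map_list_prod, map_list_prod, List.map_map, List.map_map]
  refine congrArg _ (List.map_congr_left fun j _ => ?_)
  rw [Function.comp_apply, residueHom_g hn hδ hs j.2.1 j.2.2, sNat, dif_pos j.2]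
  rfl

theorem residueHom_W (hs : c s = 1) {k : ℕ} (hk : 2 * k + 1 < n) :
    residueHom c ((tensorSystem hn s δ N hδ).W k) =
      permHom K n N (sAsc n 2 (2 * k + 1) * sAsc n 1 (2 * k)) := by
  rw [QSystem.W, map_mul, map_mul]
  congr 1
  · refine (QSystem.map_ascProd (a := 2) (b := 2 * k + 1) (residueHom c).toMonoidHom
      (tensorSystem hn s δ N hδ).g (fun j => permHom K n N (sNat n j)) fun j h1 h2 =>
        residueHom_g hn hδ hs (show 1 ≤ j by omega) (show j < n by omega)).trans ?_
    exact (QSystem.map_ascProd (permHom K n N) (sNat n) _ fun _ _ _ => rfl).symm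
  · refine (QSystem.map_ascProd (a := 1) (b := 2 * k) (residueHom c).toMonoidHom
      (tensorSystem hn s δ N hδ).h (fun j => permHom K n N (sNat n j)) fun j h1 h2 =>
        residueHom_h hn hδ hs h1 (show j < n by omega)).trans ?_
    exact (QSystem.map_ascProd (permHom K n N) (sNat n) _ fun _ _ _ => rfl).symm

/-- The colours at the positions `2i`, `2i+1` agree for `i < k`. -/
def PairConst (k : ℕ) (w : Fin n → Fin N) : Prop :=
  ∀ x y : Fin n, x.1 % 2 = 0 → y.1 = x.1 + 1 → y.1 < 2 * k → w x = w y

-- At q = 1, W_k becomes the permutation that shifts the first 2k positions by two and sends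
-- positions 2k and 2k + 1 to the front. The contraction thus adds one pair to those of e_(k), which
-- gives the usual matrix of the diagram.
open Classical in
theorem residueHom_eK (hs : c s = 1) {k : ℕ} (hk : 2 * k ≤ n) (z w : Fin n → Fin N) :
    residueHom c ((tensorSystem hn s δ N hδ).eK k) (Pi.single z 1) w =
      if PairConst k w ∧ PairConst k z ∧ ∀ x : Fin n, 2 * k ≤ x.1 → w x = z x then 1 else 0 := by
  induction k generalizing w with
  | zero =>
    rw [QSystem.eK, map_one, Module.End.one_apply, Pi.single_apply]
    congr 1
    simp only [PairConst, eq_iff_iff, funext_iff]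
    exact ⟨fun h => ⟨fun _ _ _ _ h => by omega, fun _ _ _ _ h => by omega, fun x _ => h x⟩,
      fun h x => h.2.2 x (by omega)⟩
  | succ k ih =>
    have he : residueHom c (tensorSystem hn s δ N hδ).e = contract hn 1 := residueHom_contract hn hs
    rw [QSystem.eK_succ, map_mul, map_mul, Module.End.mul_apply, Module.End.mul_apply, he,
      residueHom_W hn hδ hs (by omega), contract_apply]
    simp only [permHom_apply, ih (by omega), one_pow, one_mul]
    have hπ : ∀ x : Fin n, ((sAsc n 2 (2 * k + 1) * sAsc n 1 (2 * k)) x).1 =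
        if x.1 < 2 * k then x.1 + 2 else if x.1 < 2 * k + 2 then x.1 - 2 * k else x.1 := by
      intro x
      have h1 := sAsc_apply (n := n) (i := 1) (j := 2 * k) le_rfl (by omega) x (by omega)
      have h2 := sAsc_apply (n := n) (i := 2) (j := 2 * k + 1) (by omega) (by omega)
        (sAsc n 1 (2 * k) x) (by omega)
      rw [Equiv.Perm.mul_apply]
      split_ifs at h1 h2 ⊢ <;> omega
    set π := sAsc n 2 (2 * k + 1) * sAsc n 1 (2 * k)
    have u1 : ∀ a, ∀ x y : Fin n, x.1 < 2 * k → y.1 = x.1 + 2 → (putPair w a ∘ π) x = w y := by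
      intro a x y h1 h2
      have h3 := hπ x
      rw [if_pos h1] at h3
      rw [Function.comp_apply, putPair, if_neg (by omega), show π x = y from Fin.ext (by omega)]
    have u2 : ∀ a, ∀ x : Fin n, 2 * k ≤ x.1 → x.1 < 2 * k + 2 → (putPair w a ∘ π) x = a := by
      intro a x h1 h2
      have h3 := hπ x
      rw [if_neg (by omega), if_pos h2] at h3
      rw [Function.comp_apply, putPair, if_pos (by omega)]
    have u3 : ∀ a, ∀ x : Fin n, 2 * k + 2 ≤ x.1 → (putPair w a ∘ π) x = w x := by
      intro a x h1
      have h3 := hπ x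
      rw [if_neg (by omega), if_neg (by omega)] at h3
      rw [Function.comp_apply, putPair, if_neg (by omega), show π x = x from Fin.ext h3]
    -- Of the colours a in the contraction only the one that z has at position 2k contributes.
    have key : w ⟨0, by omega⟩ = w ⟨1, hn⟩ → ∀ a : Fin N,
        (PairConst k (putPair w a ∘ π) ∧ PairConst k z ∧
          ∀ x : Fin n, 2 * k ≤ x.1 → (putPair w a ∘ π) x = z x) ↔
        (PairConst (k + 1) w ∧ PairConst (k + 1) z ∧
          ∀ x : Fin n, 2 * (k + 1) ≤ x.1 → w x = z x) ∧ a = z ⟨2 * k, by omega⟩ := by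
      intro h0 a
      constructor
      · rintro ⟨h1, h2, h3⟩
        have e1 : a = z ⟨2 * k, by omega⟩ := by
          rw [← h3 _ le_rfl, u2 a _ le_rfl (by simp only; omega)]
        refine ⟨⟨?_, ?_, ?_⟩, e1⟩
        · intro x y hx hy hxy
          rcases Nat.eq_zero_or_pos x.1 with h | h
          · rw [show x = ⟨0, by omega⟩ from Fin.ext h, h0,
              show y = ⟨1, hn⟩ from Fin.ext (by simp only; omega)]
          · rw [← u1 a ⟨x.1 - 2, by omega⟩ x (by simp only; omega) (by simp only; omega),
              ← u1 a ⟨y.1 - 2, by omega⟩ y (by simp only; omega) (by simp only; omega)]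
            exact h1 _ _ (by simp only; omega) (by simp only; omega) (by simp only; omega)
        · intro x y hx hy hxy
          rcases (show y.1 < 2 * k ∨ x.1 = 2 * k by omega) with h | h
          · exact h2 x y hx hy h
          · rw [← h3 x (by omega), ← h3 y (by omega), u2 a x (by omega) (by omega),
              u2 a y (by omega) (by omega)]
        · intro x hx
          rw [← h3 x (by omega), u3 a x (by omega)]
      · rintro ⟨⟨h1, h2, h3⟩, rfl⟩
        refine ⟨?_, fun x y hx hy hxy => h2 x y hx hy (by omega), ?_⟩
        · intro x y hx hy hxy
          rw [u1 _ x ⟨x.1 + 2, by omega⟩ (by omega) rfl, u1 _ y ⟨y.1 + 2, by omega⟩ hxy rfl]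
          exact h1 _ _ (by simp only; omega) (by simp only; omega) (by simp only; omega)
        · intro x hx
          rcases (show x.1 = 2 * k ∨ x.1 = 2 * k + 1 ∨ 2 * k + 2 ≤ x.1 by omega) with h | h | h
          · rw [u2 _ x hx (by omega)]
            exact congrArg z (Fin.ext h.symm)
          · rw [u2 _ x hx (by omega)]
            exact h2 _ _ (by simp only; omega) (by simp only; omega) (by omega)
          · rw [u3 _ x h]
            exact h3 x (by omega)
    by_cases h0 : w ⟨0, by omega⟩ = w ⟨1, hn⟩
    · rw [if_pos h0]
      simp only [key h0]
      by_cases hF : PairConst (k + 1) w ∧ PairConst (k + 1) z ∧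
          ∀ x : Fin n, 2 * (k + 1) ≤ x.1 → w x = z x
      · rw [if_pos hF]
        simp only [and_iff_right hF]
        simp
      · simp only [hF, false_and, if_false, Finset.sum_const_zero]
    · rw [if_neg h0, if_neg]
      exact fun h => h0 (h.1 _ _ rfl rfl (by simp only; omega))

theorem pairConst_iff {k : ℕ} (h : 2 * k ≤ n) (w : Fin n → Fin N) :
    PairConst k w ↔ ∀ x : Fin n, x.1 < 2 * k → w x = w (pairing k h x) := by
  constructor
  · intro H x hx
    have hv := pairing_val h x
    rw [if_pos hx] at hv
    rcases Nat.mod_two_eq_zero_or_one x.1 with h0 | h0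
    · rw [if_pos h0] at hv
      exact H x _ h0 hv (by omega)
    · rw [if_neg (by omega)] at hv
      exact (H _ x (by omega) (by omega) hx).symm
  · intro H x y hx hy hxy
    rw [H x (by omega)]
    congr 1
    ext
    rw [pairing_val, if_pos (by omega), if_pos hx, hy]

open Classical in
/-- At `q = 1`, the matrix entries of `g_d` detect the colourings that are constant on the edges
of `d`. -/
theorem residueHom_gD (hs : c s = 1) (d : BrauerDiagram n) (x y : Fin n → Fin N) :
    residueHom c ((tensorSystem hn s δ N hδ).gD d) (Pi.single y 1) x =
      if ∀ v, Sum.elim x y (d.1 v) = Sum.elim x y v then 1 else 0 := by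
  obtain ⟨k, ω₁, σ, ω₂, H⟩ := exists_isReducedExpression d
  rw [QSystem.gD_eq _ H]
  obtain ⟨h, -, -, -, rfl⟩ := isReducedExpression_iff.1 H
  have e : permHom K n N (σ * ω₂) (Pi.single y 1) = Pi.single (y ∘ ((σ * ω₂)⁻¹ : Equiv.Perm (Fin n))) 1 := by
    funext u
    rw [permHom_apply, Pi.single_apply, Pi.single_apply]
    congr 1
    exact eq_iff_iff.2 (Equiv.eq_comp_symm (σ * ω₂) u y).symm
  rw [map_mul, map_mul, map_mul, residueHom_gT hn hδ hs, residueHom_gT hn hδ hs,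
    residueHom_gT hn hδ hs, mul_assoc, ← map_mul, Module.End.mul_apply, Module.End.mul_apply, e,
    permHom_apply, residueHom_eK hn hδ hs h]
  set β := σ * ω₂
  congr 1
  rw [eq_iff_iff, pairConst_iff h, pairConst_iff h]
  constructor
  · rintro ⟨h1, h2, h3⟩ (v | v)
    · obtain ⟨v, rfl⟩ := ω₁.surjective v
      rw [mul_apply_inl]
      split_ifs with hv
      · exact (h1 v hv).symm
      · exact (h3 v (by omega)).symm
    · obtain ⟨v, rfl⟩ := β⁻¹.surjective v
      rw [mul_apply_inr]
      split_ifs with hv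
      · exact (h2 v hv).symm
      · exact h3 v (by omega)
  · intro H
    refine ⟨fun v hv => ?_, fun v hv => ?_, fun v hv => ?_⟩
    · have := H (Sum.inl (ω₁ v))
      rw [mul_apply_inl, if_pos hv] at this
      exact this.symm
    · have := H (Sum.inr (β⁻¹ v))
      rw [mul_apply_inr, if_pos hv] at this
      exact this.symm
    · have := H (Sum.inl (ω₁ v))
      rw [mul_apply_inl, if_neg (by omega)] at this
      exact this.symm

end Residue

/-- A colouring of the vertices that separates the edges of `d`. -/
theorem exists_coloring {n N : ℕ} (hN : n ≤ N) (d : BrauerDiagram n) :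
    ∃ x y : Fin n → Fin N, ∀ v w, Sum.elim x y v = Sum.elim x y w ↔ v = w ∨ d.1 v = w := by
  obtain ⟨k, ω₁, σ, ω₂, H⟩ := exists_isReducedExpression d
  obtain ⟨h, -, -, -, rfl⟩ := isReducedExpression_iff.1 H
  set β := σ * ω₂
  -- In e_(k) the upper pairs receive the colours 0, …, k - 1, the lower pairs k, …, 2k - 1, and
  -- each vertical edge its own position: n colours for n edges.
  obtain ⟨x, hx⟩ : ∃ x : Fin n → Fin N, ∀ v, (x v).1 = if v.1 < 2 * k then v.1 / 2 else v.1 :=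
    ⟨fun v => ⟨if v.1 < 2 * k then v.1 / 2 else v.1, by split_ifs <;> omega⟩, fun _ => rfl⟩
  obtain ⟨y, hy⟩ : ∃ y : Fin n → Fin N, ∀ v, (y v).1 = if v.1 < 2 * k then k + v.1 / 2 else v.1 :=
    ⟨fun v => ⟨if v.1 < 2 * k then k + v.1 / 2 else v.1, by split_ifs <;> omega⟩, fun _ => rfl⟩
  have key : ∀ v w, Sum.elim x y v = Sum.elim x y w ↔ v = w ∨ (eDiagram n k h).1 v = w := by
    rintro (v | v) (w | w)
    · have h1 := hx v
      have h2 := hx w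
      have h3 := pairing_val h v
      rw [eDiagram_inl]
      split_ifs at h1 h2 h3 ⊢ <;>
        simp only [Sum.elim_inl, Fin.ext_iff, Sum.inl.injEq, reduceCtorEq, or_false] <;> omega
    · have h1 := hx v
      have h2 := hy w
      rw [eDiagram_inl]
      split_ifs at h1 h2 ⊢ <;> simp only [Sum.elim_inl, Sum.elim_inr, Fin.ext_iff, Sum.inr.injEq,
        reduceCtorEq, false_or, or_false, iff_false] <;> omega
    · have h1 := hy v
      have h2 := hx w
      rw [eDiagram_inr]
      split_ifs at h1 h2 ⊢ <;> simp only [Sum.elim_inl, Sum.elim_inr, Fin.ext_iff, Sum.inl.injEq,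
        reduceCtorEq, false_or, or_false, iff_false] <;> omega
    · have h1 := hy v
      have h2 := hy w
      have h3 := pairing_val h v
      rw [eDiagram_inr]
      split_ifs at h1 h2 h3 ⊢ <;>
        simp only [Sum.elim_inr, Fin.ext_iff, Sum.inr.injEq, reduceCtorEq, or_false] <;> omega
  let P : Equiv.Perm (Fin n ⊕ Fin n) := Equiv.sumCongr ω₁ β⁻¹
  have e : ∀ v, Sum.elim (x ∘ (ω₁⁻¹ : Equiv.Perm (Fin n))) (y ∘ β) (P v) = Sum.elim x y v := by
    rintro (v | v) <;> simp [P]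
  refine ⟨x ∘ (ω₁⁻¹ : Equiv.Perm (Fin n)), y ∘ β, fun v w => ?_⟩
  obtain ⟨v, rfl⟩ := P.surjective v
  obtain ⟨w, rfl⟩ := P.surjective w
  rw [e, e, key, mul_eDiagram_mul_eq, BrauerDiagram.relabel_apply, P.injective.eq_iff,
    P.injective.eq_iff]

/-! ### Linear independence -/

noncomputable instance (n : ℕ) : Fintype (BrauerDiagram n) :=
  haveI : Finite (BrauerDiagram n) := Subtype.finite
  Fintype.ofFinite _

section Independence

-- Row d of the matrix M holds the entries of g_d at the separating colourings of all d'. Under c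
-- such an entry is 1 only if the edges of d are edges of d', so M reduces to the identity, and its
-- determinant is a unit because c is local.
open Classical in
theorem linearIndependent_tensorSystem {S K : Type*} [CommRing S] [CommRing K] {n N : ℕ}
    {c : S →+* K} [IsLocalHom c] {s δ : Sˣ} (hs : c s = 1) (hn : 2 ≤ n)
    (hδ : (δ : S) = ∑ c ∈ Finset.range N, ((s : S) ^ 2) ^ c) (hN : n ≤ N) :
    LinearIndependent S (tensorSystem hn s δ N hδ).gD := by
  choose x y hxy using fun d : BrauerDiagram n => exists_coloring hN d
  set D := tensorSystem hn s δ N hδ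
  let M : Matrix (BrauerDiagram n) (BrauerDiagram n) S :=
    Matrix.of fun d d' => D.gD d (Pi.single (y d') 1) (x d')
  have hM : c.mapMatrix M = 1 := by
    ext d d'
    change c (D.gD d (Pi.single (y d') 1) (x d')) = _
    rw [← residueHom_apply, comp_single,
      residueHom_gD hn hδ hs, Matrix.one_apply]
    congr 1
    rw [eq_iff_iff]
    constructor
    · intro H
      refine BrauerDiagram.ext_apply fun v => ?_
      rcases (hxy d' _ _).1 (H v).symm with h | h
      · exact absurd h.symm (d.2.2 v)
      · exact h.symm
    · rintro rfl v
      exact ((hxy d _ _).2 (Or.inr rfl)).symm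
  have hdet : IsUnit M := by
    rw [Matrix.isUnit_iff_isUnit_det]
    refine isUnit_of_map_unit c _ ?_
    rw [RingHom.map_det, hM, Matrix.det_one]
    exact isUnit_one
  rw [Fintype.linearIndependent_iff]
  intro a ha
  have h0 : Matrix.vecMul a M = Matrix.vecMul 0 M := by
    rw [Matrix.zero_vecMul]
    funext d'
    have := congrFun (congrArg (fun A => A (Pi.single (y d') 1)) ha) (x d')
    simpa [Matrix.vecMul, dotProduct, M, LinearMap.sum_apply, Finset.sum_apply] using this
  exact congrFun (Matrix.vecMul_injective_of_isUnit hdet h0)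

/-- Linear independence over a ring with sufficiently many homomorphisms to `ℚ⟦t⟧`. -/
theorem linearIndependent_of_homs {A : Type*} [CommRing A] {n : ℕ} (hn : 2 ≤ n) (q r δ : Aˣ)
    (hδ : (r : A) - 1 = (δ : A) * ((q : A) - 1))
    (H : ∀ a : A, (∀ N, n ≤ N → ∀ φ : A →+* PowerSeries ℚ, φ q = (1 + PowerSeries.X) ^ 2 →
      φ δ = ∑ c ∈ Finset.range N, ((1 + PowerSeries.X) ^ 2) ^ c → φ a = 0) → a = 0) :
    LinearIndependent A (canonicalSystem n q r δ).gD := by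
  rw [Fintype.linearIndependent_iff]
  intro a ha d
  refine H _ fun N hN φ hφq hφδ => ?_
  have hs : IsUnit (1 + PowerSeries.X : PowerSeries ℚ) := by
    rw [PowerSeries.isUnit_iff_constantCoeff]; simp
  obtain ⟨s, hs⟩ := hs
  rw [← hs] at hφq hφδ
  have h1 : PowerSeries.constantCoeff (s : PowerSeries ℚ) = (1 : ℚ) := by rw [hs]; simp
  have : IsLocalHom (PowerSeries.constantCoeff (R := ℚ)) :=
    ⟨fun _ h => PowerSeries.isUnit_iff_constantCoeff.2 h⟩
  let D := tensorSystem hn s (Units.map (φ : A →* PowerSeries ℚ) δ) N hφδ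
  have hli : LinearIndependent (PowerSeries ℚ) D.gD := linearIndependent_tensorSystem h1 hn hφδ hN
  letI : Algebra A (PowerSeries ℚ) := φ.toAlgebra
  have hsm : ∀ (a : A) (x : Module.End (PowerSeries ℚ) ((Fin n → Fin N) → PowerSeries ℚ)),
      a • x = φ a • x := fun a x => algebra_compatible_smul (PowerSeries ℚ) a x
  -- The image of r is forced: φ(r) - 1 = φ(δ)(φ(q) - 1), and the geometric sum makes the right side
  -- φ(q)^N - 1.
  let D' : QSystem n q r δ (Module.End (PowerSeries ℚ) ((Fin n → Fin N) → PowerSeries ℚ)) :=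
    D.restrict φ hsm (Units.ext (by simpa using hφq)) (Units.ext (by
      have h2 := congrArg φ hδ
      rw [map_sub, map_mul, map_sub, map_one, hφq, hφδ, geom_sum_mul] at h2
      simpa using h2)) rfl
  have hD : ∀ d, D'.gD d = D.gD d := fun d =>
    D'.map_gD D (RingHom.id _) φ hsm (Units.ext (by simpa using hφq)) (fun _ _ _ => rfl) rfl d
  have h3 := congrArg (D'.lift hδ) ha
  rw [map_sum, map_zero] at h3
  simp only [map_smul, QSystem.lift_gD, hD, hsm] at h3
  exact Fintype.linearIndependent_iff.1 hli _ h3 d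

/-- Linear independence is preserved by base change. -/
theorem linearIndependent_baseChange {A R : Type*} [CommRing A] [CommRing R] {n : ℕ} (hn : 2 ≤ n)
    (q r δ : Aˣ) (φ : A →+* R) (hδ : (r : A) - 1 = (δ : A) * ((q : A) - 1))
    (hli : LinearIndependent A (canonicalSystem n q r δ).gD) :
    LinearIndependent R (canonicalSystem n (Units.map (φ : A →* R) q) (Units.map (φ : A →* R) r)
      (Units.map (φ : A →* R) δ)).gD := by
  letI : Algebra A R := φ.toAlgebra
  let b := Module.Basis.mk hli (span_gD_eq_top n q r δ hn).ge
  let b' := Algebra.TensorProduct.basis R b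
  let f : QBr n q r δ →ₐ[A] TensorProduct A R (QBr n q r δ) := Algebra.TensorProduct.includeRight
  let f' : QBr n q r δ →+* TensorProduct A R (QBr n q r δ) := f.toRingHom
  have hf : ∀ (a : A) (x : QBr n q r δ), f' (a • x) = φ a • f' x :=
    fun a x => (map_smul f a x).trans (algebra_compatible_smul R a (f x))
  let D := (canonicalSystem n q r δ).map f' φ hf
  have hδ' : ((Units.map (φ : A →* R) r : Rˣ) : R) - 1 = ((Units.map (φ : A →* R) δ : Rˣ) : R) *
      (((Units.map (φ : A →* R) q : Rˣ) : R) - 1) := by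
    simpa using congrArg φ hδ
  -- It is enough that one linear map sends the g_d to independent elements. The lift to the
  -- extended generic algebra sends them to the base change of a basis; that it is an isomorphism is
  -- not needed.
  refine LinearIndependent.of_comp (D.lift hδ').toLinearMap ?_
  have e : (D.lift hδ').toLinearMap ∘ (canonicalSystem n (Units.map (φ : A →* R) q)
      (Units.map (φ : A →* R) r) (Units.map (φ : A →* R) δ)).gD = b' := by
    funext d
    refine (D.lift_gD hδ' d).trans ?_
    rw [← (canonicalSystem n q r δ).map_gD D f' φ hf rfl (fun _ _ _ => rfl) rfl d,
      Algebra.TensorProduct.basis_apply, Module.Basis.mk_apply]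
    rfl
  rw [e]
  exact b'.linearIndependent

end Independence

/-! ### The generic parameters -/

section Generic

open Polynomial

/-- The product of the generic `q`, `δ` and `r = 1 + δ (q - 1)`. -/
noncomputable def genericProduct : ℤ[X][X] := C X * X * (1 + X * (C X - 1))

/-- The ring of the generic parameters. -/
abbrev GenericRing : Type := Localization.Away genericProduct

/-- Evaluation at `δ = d`, and at the value of `q` given by `f`. -/
noncomputable def evalParams {R : Type*} [CommRing R] (f : ℤ[X] →+* R) (d : R) : ℤ[X][X] →+* R :=
  eval₂RingHom f d

theorem evalParams_C {R : Type*} [CommRing R] (f : ℤ[X] →+* R) (d : R) (p : ℤ[X]) :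
    evalParams f d (C p) = f p := eval₂_C _ _

theorem evalParams_X {R : Type*} [CommRing R] (f : ℤ[X] →+* R) (d : R) :
    evalParams f d X = d := eval₂_X _ _

theorem evalParams_genericProduct {R : Type*} [CommRing R] (f : ℤ[X] →+* R) (d : R) :
    evalParams f d genericProduct = f X * d * (1 + d * (f X - 1)) := by
  simp only [genericProduct, map_mul, map_add, map_sub, map_one, evalParams_C, evalParams_X]

theorem isUnit_genericProduct : IsUnit (algebraMap ℤ[X][X] GenericRing genericProduct) :=
  IsLocalization.Away.algebraMap_isUnit _

theorem exists_generic_units : ∃ q r δ : GenericRingˣ,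
    (q : GenericRing) = algebraMap ℤ[X][X] GenericRing (C X) ∧
    (δ : GenericRing) = algebraMap ℤ[X][X] GenericRing X ∧
    (r : GenericRing) - 1 = (δ : GenericRing) * ((q : GenericRing) - 1) := by
  have h : IsUnit (algebraMap ℤ[X][X] GenericRing (C X * X * (1 + X * (C X - 1)))) :=
    isUnit_genericProduct
  rw [map_mul, map_mul] at h
  obtain ⟨r, hr⟩ := isUnit_of_mul_isUnit_right h
  have h' := isUnit_of_mul_isUnit_left h
  obtain ⟨q, hq⟩ := isUnit_of_mul_isUnit_left h'
  obtain ⟨δ, hδ⟩ := isUnit_of_mul_isUnit_right h'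
  refine ⟨q, r, δ, hq, hδ, ?_⟩
  rw [hr, hq, hδ]
  simp only [map_mul, map_add, map_sub, map_one]
  ring

/-- The substitution `q = (1 + t)²`. -/
noncomputable def squareSubst : ℤ[X] →+* PowerSeries ℚ :=
  (coeToPowerSeries.ringHom.comp (compRingHom ((1 + X) ^ 2))).comp (mapRingHom (Int.castRingHom ℚ))

theorem squareSubst_X : squareSubst X = (1 + PowerSeries.X) ^ 2 := by
  simp [squareSubst]

theorem squareSubst_injective : Function.Injective squareSubst := by
  refine (Polynomial.coe_injective ℚ).comp (Function.Injective.comp ?_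
    (map_injective _ Int.cast_injective))
  refine (injective_iff_map_eq_zero (compRingHom ((1 + X : ℚ[X]) ^ 2))).2 fun p hp => ?_
  rcases comp_eq_zero_iff.1 hp with h | ⟨-, h⟩
  · exact h
  · have h2 := congrArg natDegree h
    rw [natDegree_C, natDegree_pow, add_comm, ← C_1, natDegree_X_add_C] at h2
    omega

/-- After clearing denominators, a is a polynomial in δ with coefficients in ℤ[q], and ℤ[q] embeds
in ℚ⟦t⟧ by q = (1 + t)². Its roots include the sums 1 + q + ⋯ + q^(N-1) for all N ≥ n, which are
distinct since their constant terms are N. -/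
theorem genericRing_eq_zero (n : ℕ) (hn : 2 ≤ n) (q δ : GenericRing)
    (hq : q = algebraMap ℤ[X][X] GenericRing (C X)) (hδ : δ = algebraMap ℤ[X][X] GenericRing X)
    (a : GenericRing)
    (H : ∀ N, n ≤ N → ∀ φ : GenericRing →+* PowerSeries ℚ, φ q = (1 + PowerSeries.X) ^ 2 →
      φ δ = ∑ c ∈ Finset.range N, ((1 + PowerSeries.X) ^ 2) ^ c → φ a = 0) : a = 0 := by
  obtain ⟨m, b, hb⟩ := IsLocalization.Away.surj genericProduct a
  let d : ℕ → PowerSeries ℚ := fun N => ∑ c ∈ Finset.range N, ((1 + PowerSeries.X) ^ 2) ^ c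
  have hd : ∀ N, PowerSeries.constantCoeff (d N) = (N : ℚ) := by
    intro N
    simp [d]
  have key : ∀ N, n ≤ N → evalParams squareSubst (d N) b = 0 := by
    intro N hN
    -- The constant term of q δ (1 + δ(q - 1)) is N, which is invertible over ℚ.
    have hu : IsUnit (evalParams squareSubst (d N) genericProduct) := by
      rw [evalParams_genericProduct, PowerSeries.isUnit_iff_constantCoeff, squareSubst_X]
      have : (N : ℚ) ≠ 0 := by
        rw [Nat.cast_ne_zero]; omega
      simpa [hd] using this
    let φ : GenericRing →+* PowerSeries ℚ := IsLocalization.Away.lift genericProduct hu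
    have hφ : ∀ p, φ (algebraMap ℤ[X][X] GenericRing p) = evalParams squareSubst (d N) p :=
      fun p => IsLocalization.Away.lift_eq genericProduct hu p
    have h0 := H N hN φ (by rw [hq, hφ, evalParams_C, squareSubst_X])
      (by rw [hδ, hφ, evalParams_X])
    rw [← hφ, ← hb, map_mul, h0, zero_mul]
  have h1 : b.map squareSubst = 0 := by
    refine eq_zero_of_infinite_isRoot _ (Set.Infinite.mono (s := d '' Set.Ici n) ?_ ?_)
    · rintro _ ⟨N, hN, rfl⟩
      have := key N hN
      rwa [evalParams, coe_eval₂RingHom, ← eval_map] at this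
    · refine (Set.Ici_infinite n).image fun N _ N' _ h => ?_
      have := congrArg PowerSeries.constantCoeff h
      rw [hd, hd] at this
      exact_mod_cast this
  have h2 : b = 0 := (Polynomial.map_eq_zero_iff squareSubst_injective).1 h1
  rw [h2, map_zero] at hb
  exact (isUnit_genericProduct.pow m).mul_left_eq_zero.1 hb

/-- The generic ring inverts precisely q, δ and r = 1 + δ(q - 1), so it maps to every R with
admissible parameters, and base change applies. -/
theorem linearIndependent_gD {R : Type*} [CommRing R] {n : ℕ} (hn : 2 ≤ n) (q r δ : Rˣ)
    (hδ : (r : R) - 1 = (δ : R) * ((q : R) - 1)) :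
    LinearIndependent R (canonicalSystem n q r δ).gD := by
  obtain ⟨q', r', δ', h1, h2, h3⟩ := exists_generic_units
  have hli := linearIndependent_of_homs hn q' r' δ' h3
    fun a H => genericRing_eq_zero n hn q' δ' h1 h2 a H
  let ev : ℤ[X][X] →+* R := evalParams (eval₂RingHom (Int.castRingHom R) q) δ
  have hX : eval₂RingHom (Int.castRingHom R) (q : R) X = q := eval₂_X _ _
  have hu : IsUnit (ev genericProduct) := by
    have : ev genericProduct = q * δ * r := by
      rw [evalParams_genericProduct, hX]
      linear_combination (-(q : R) * δ) * hδ
    rw [this]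
    exact (q * δ * r).isUnit
  let φ : GenericRing →+* R := IsLocalization.Away.lift genericProduct hu
  have hφ : ∀ p, φ (algebraMap ℤ[X][X] GenericRing p) = ev p :=
    fun p => IsLocalization.Away.lift_eq genericProduct hu p
  have e1 : Units.map (φ : GenericRing →* R) q' = q := Units.ext (by
    change φ q' = q
    rw [h1, hφ, evalParams_C, hX])
  have e2 : Units.map (φ : GenericRing →* R) δ' = δ := Units.ext (by
    change φ δ' = δ
    rw [h2, hφ, evalParams_X])
  have e3 : Units.map (φ : GenericRing →* R) r' = r := Units.ext (by
    change φ r' = r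
    have := congrArg φ h3
    have e1' : φ q' = q := congrArg Units.val e1
    have e2' : φ δ' = δ := congrArg Units.val e2
    rw [map_sub, map_mul, map_sub, map_one, e1', e2', ← hδ] at this
    exact sub_left_injective this)
  have := linearIndependent_baseChange hn q' r' δ' φ h3 hli
  rwa [e1, e2, e3] at this

end Generic

/-- The basis of the elements `g_d`. -/
noncomputable def basis {R : Type*} [CommRing R] {n : ℕ} (hn : 2 ≤ n) (q r δ : Rˣ)
    (hδ : (r : R) - 1 = (δ : R) * ((q : R) - 1)) :
    Module.Basis (BrauerDiagram n) R (QBr n q r δ) :=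
  Module.Basis.mk (linearIndependent_gD hn q r δ hδ) (span_gD_eq_top n q r δ hn).ge

end QBrauer

theorem theorem3p5 {R : Type*} [CommRing R] (q r δ : Rˣ)
    (hδ : (r : R) - 1 = (δ : R) * ((q : R) - 1)) (n : ℕ) (hn : 2 ≤ n) :
    -- `g_ω` does not depend on the reduced expression of `ω`
    (∀ (ω : Equiv.Perm (Fin n)) (l : List (QBrauer.SIndex n)),
      QBrauer.IsReducedWord l ω → QBrauer.gWord n q r δ l = QBrauer.gPerm n q r δ ω) ∧
    -- every diagram has a unique reduced expression
    (∀ d : QBrauer.BrauerDiagram n,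
      ∃! t : ℕ × Equiv.Perm (Fin n) × Equiv.Perm (Fin n) × Equiv.Perm (Fin n),
        QBrauer.IsReducedExpression d t.1 t.2.1 t.2.2.1 t.2.2.2) ∧
    -- the elements `g_d` form a basis
    ∃ b : Module.Basis (QBrauer.BrauerDiagram n) R (QBrauer.QBr n q r δ),
      ∀ (d : QBrauer.BrauerDiagram n) (k : ℕ) (ω₁ ω ω₂ : Equiv.Perm (Fin n)),
        QBrauer.IsReducedExpression d k ω₁ ω ω₂ →
          b d = QBrauer.gPerm n q r δ ω₁ * QBrauer.eK n q r δ k *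
            QBrauer.gPerm n q r δ ω * QBrauer.gPerm n q r δ ω₂ := by
  refine ⟨fun ω l hl => ?_, fun d => ?_, QBrauer.basis hn q r δ hδ, fun d k ω₁ ω ω₂ h => ?_⟩
  · rw [QBrauer.gWord_eq, QBrauer.gPerm_eq, QBrauer.QSystem.gw_eq_gT _ hl]
  · obtain ⟨k, ω₁, σ, ω₂, h⟩ := QBrauer.exists_isReducedExpression d
    refine ⟨(k, ω₁, σ, ω₂), h, ?_⟩
    rintro ⟨k', ω₁', σ', ω₂'⟩ h'
    obtain ⟨rfl, rfl, rfl, rfl⟩ := h.unique h'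
    rfl
  · rw [QBrauer.basis, Module.Basis.mk_apply, QBrauer.QSystem.gD_eq _ h, QBrauer.gPerm_eq,
      QBrauer.gPerm_eq, QBrauer.gPerm_eq, QBrauer.eK_eq n q r δ h.le]
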